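/- Let $U\subset\mathbb R^2$ be open, let $g=(g_{ij})$ be a smooth Riemannian metric on $U$ (a surface in local coordinates $x=(x_1,x_2)$), and let $H(x,p)=\tfrac12\sum_{i,j} g^{ij}(x)p_ip_j$ be the Hamiltonian of its geodesic flow on $T^*U$. A fractional-linear integral over an open set $W\subset U$ is a function $$I(x,p)=\frac{A(x)p_1+B(x)p_2}{C(x)p_1+E(x)p_2}$$ with $A,B,C,E$ smooth on $W$, $AE-BC\neq0$ everywhere on $W$, and $\{I,H\}=0$ wherever the denominator does not vanish. Fix $s\in U$ and consider the space of germs at $s$ of such integrals (integrals over some neighbourhood of $s$, two of them being identified if they agree, as functions, over a neighbourhood of $s$). An effective $d$-parameter family is a family $I_t$, $t\in O\subset\mathbb R^d$ open, of fractional-linear integrals over one fixed neighbourhood $W$ of $s$, whose coefficients are smooth in $(t,x)\in O\times W$, and such that for no $t\in O$ and no $v\neq0$ in $\mathbb R^d$ does the derivative of $I_t$ in the direction $v$ vanish identically over a neighbourhood of $s$. We say that the space of germs of integrals at $s$ has dimension $d$ if it is covered by countably many effective $d$-parameter families and no nonempty effective family has more than $d$ parameters. **Theorem.** Suppose that the geodesic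 flow of $g$ admits a fractional-linear integral in some neighbourhood of $s$. Then the space of germs at $s$ of fractional-linear integrals has dimension $5$ if and only if the Gaussian curvature of $g$ is constant in a neighbourhood of $s$. Moreover, the dimension of this space is always $3$ or $5$. -/

import Mathlib

open scoped ContDiff Matrix Topology

noncomputable section

namespace FracLin

/-- The coordinate plane `(x, y)` of a coordinate patch of a surface. -/
abbrev Plane := Fin 2 → ℝ

/-- The `i`-th partial derivative of a function of the two coordinates. -/
def partialDeriv (i : Fin 2) (f : Plane → ℝ) (x : Plane) : ℝ :=
  fderiv ℝ f x (Pi.single i 1)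

/-- `g` is a smooth Riemannian metric (given by its Gram matrix) on the open set `U`. -/
structure IsRiemannianMetricOn (g : Plane → Matrix (Fin 2) (Fin 2) ℝ) (U : Set Plane) :
    Prop where
  smooth : ∀ i j, ContDiffOn ℝ ∞ (fun x => g x i j) U
  posDef : ∀ x ∈ U, (g x).PosDef

/-- Christoffel symbols `Γ^k_{ij}` of the Levi-Civita connection. -/
def christoffel (g : Plane → Matrix (Fin 2) (Fin 2) ℝ) (k i j : Fin 2) (x : Plane) : ℝ :=
  (1 / 2) * ∑ l, (g x)⁻¹ k l *
    (partialDeriv i (fun y => g y j l) x + partialDeriv j (fun y => g y i l) x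
      - partialDeriv l (fun y => g y i j) x)

/-- Components of the curvature tensor: `R(∂_i, ∂_j) ∂_k = ∑ l, R^l_{kij} ∂_l`. -/
def riemann (g : Plane → Matrix (Fin 2) (Fin 2) ℝ) (l k i j : Fin 2) (x : Plane) : ℝ :=
  partialDeriv i (christoffel g l j k) x - partialDeriv j (christoffel g l i k) x
    + ∑ m, (christoffel g l i m x * christoffel g m j k x
      - christoffel g l j m x * christoffel g m i k x)

/-- Gaussian curvature `g(R(∂₁, ∂₂) ∂₂, ∂₁) / det g`. -/
def gaussianCurvature (g : Plane → Matrix (Fin 2) (Fin 2) ℝ) (x : Plane) : ℝ :=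
  (∑ l, g x l 0 * riemann g l 1 0 1 x) / (g x).det

/-- The Gaussian curvature is constant in a neighbourhood of the point `s`. -/
def HasConstantCurvatureNear (g : Plane → Matrix (Fin 2) (Fin 2) ℝ) (s : Plane) : Prop :=
  ∃ κ : ℝ, ∀ᶠ x in 𝓝 s, gaussianCurvature g x = κ

/-- The Hamiltonian `H = ½ g^{ij} p_i p_j` of the geodesic flow, a function on the cotangent
bundle, whose points are written `(x, p)`. -/
def hamiltonian (g : Plane → Matrix (Fin 2) (Fin 2) ℝ) (z : Plane × Plane) : ℝ :=
  (1 / 2) * ∑ i, ∑ j, (g z.1)⁻¹ i j * z.2 i * z.2 j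

/-- The canonical Poisson bracket on the cotangent bundle. -/
def poissonBracket (F G : Plane × Plane → ℝ) (z : Plane × Plane) : ℝ :=
  ∑ i : Fin 2,
    (fderiv ℝ F z (Pi.single i 1, 0) * fderiv ℝ G z (0, Pi.single i 1)
      - fderiv ℝ F z (0, Pi.single i 1) * fderiv ℝ G z (Pi.single i 1, 0))

/-- Denominator `C p + E q` of the fractional-linear function with coefficient matrix
`c = !![A, B; C, E]`. -/
def denom (c : Plane → Matrix (Fin 2) (Fin 2) ℝ) (z : Plane × Plane) : ℝ :=
  (c z.1 *ᵥ z.2) 1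

/-- The fractional-linear function `(A p + B q) / (C p + E q)`; only its values at points with
nonzero denominator are used. -/
def fracLin (c : Plane → Matrix (Fin 2) (Fin 2) ℝ) (z : Plane × Plane) : ℝ :=
  (c z.1 *ᵥ z.2) 0 / denom c z

/-- The fractional-linear function with smooth coefficient matrix `c`, `AE - BC ≠ 0`, is a first
integral of the geodesic flow over the set `W`. -/
structure IsIntegralOn (g : Plane → Matrix (Fin 2) (Fin 2) ℝ) (W : Set Plane)
    (c : Plane → Matrix (Fin 2) (Fin 2) ℝ) : Prop where
  smooth : ∀ i j, ContDiffOn ℝ ∞ (fun x => c x i j) W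
  det_ne_zero : ∀ x ∈ W, (c x).det ≠ 0
  bracket_eq_zero : ∀ x ∈ W, ∀ p : Plane, denom c (x, p) ≠ 0 →
    poissonBracket (fracLin c) (hamiltonian g) (x, p) = 0

/-- `c` gives a fractional-linear integral in some neighbourhood, contained in `U`, of `s`. -/
def IsLocalIntegral (g : Plane → Matrix (Fin 2) (Fin 2) ℝ) (U : Set Plane) (s : Plane)
    (c : Plane → Matrix (Fin 2) (Fin 2) ℝ) : Prop :=
  ∃ W : Set Plane, IsOpen W ∧ W ⊆ U ∧ s ∈ W ∧ IsIntegralOn g W c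

/-- Two coefficient matrices give the same fractional-linear function near `s`, i.e. the same
germ at `s`. -/
def SameGerm (s : Plane) (c c' : Plane → Matrix (Fin 2) (Fin 2) ℝ) : Prop :=
  ∀ᶠ x in 𝓝 s, ∀ p : Plane, denom c (x, p) ≠ 0 → denom c' (x, p) ≠ 0 →
    fracLin c (x, p) = fracLin c' (x, p)

/-- A smooth `d`-parameter family `t ↦ c t`, `t ∈ O`, of fractional-linear integrals over a fixed
neighbourhood `W` of `s` that depends effectively on its parameters: at no `t` does a nonzero
parameter direction `v` leave the germ at `s` of the integral unchanged to first order. -/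
structure IsIntegralFamily (g : Plane → Matrix (Fin 2) (Fin 2) ℝ) (U : Set Plane) (s : Plane)
    (d : ℕ) (O : Set (Fin d → ℝ)) (W : Set Plane)
    (c : (Fin d → ℝ) → Plane → Matrix (Fin 2) (Fin 2) ℝ) : Prop where
  isOpen_param : IsOpen O
  isOpen_base : IsOpen W
  base_subset : W ⊆ U
  mem_base : s ∈ W
  smooth : ∀ i j, ContDiffOn ℝ ∞ (fun z : (Fin d → ℝ) × Plane => c z.1 z.2 i j) (O ×ˢ W)
  integral : ∀ t ∈ O, IsIntegralOn g W (c t)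
  effective : ∀ t ∈ O, ∀ v : Fin d → ℝ,
    (∀ᶠ x in 𝓝 s, ∀ p : Plane, denom (c t) (x, p) ≠ 0 →
      fderiv ℝ (fun τ => fracLin (c τ) (x, p)) t v = 0) → v = 0

/-- The space of germs at `s` of fractional-linear integrals has dimension `d`: it is covered by
countably many effective smooth `d`-parameter families, and no nonempty effective smooth family
has more than `d` parameters. (As soon as there is an integral, at most one `d` qualifies.) -/
def IntegralSpaceHasDim (g : Plane → Matrix (Fin 2) (Fin 2) ℝ) (U : Set Plane) (s : Plane)
    (d : ℕ) : Prop :=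
  (∃ (O : ℕ → Set (Fin d → ℝ)) (W : ℕ → Set Plane)
      (c : ℕ → (Fin d → ℝ) → Plane → Matrix (Fin 2) (Fin 2) ℝ),
    (∀ n, IsIntegralFamily g U s d (O n) (W n) (c n)) ∧
    ∀ c', IsLocalIntegral g U s c' → ∃ n, ∃ t ∈ O n, SameGerm s (c n t) c') ∧
  ∀ (k : ℕ) (O : Set (Fin k → ℝ)) (W : Set Plane)
    (c : (Fin k → ℝ) → Plane → Matrix (Fin 2) (Fin 2) ℝ),
    IsIntegralFamily g U s k O W c → O.Nonempty → k ≤ d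

end FracLin

end

/-!
A fractional-linear integral `I` is written as a quotient of two linear forms in the velocity
`v = g⁻¹ p`, which make up a coframe `N`. The bracket `{I, H}` is then a cubic form in `v` divided
by the square of the denominator (`poissonBracket_eq`), and its vanishing means that
`∇_i N_j = κ_i N_j + υ_j N_i` for both forms of the coframe, with two common `1`-forms `κ` and `υ`
(`IsIntegralOn.covDer_eq`). Rescaling all coefficients changes `κ` only, and two integrals with the
same `υ` differ by a constant projective transformation, that is, by postcomposition of `I` with a
Möbius transformation (`exists_smul_eq_of_upsilon_eq`). These account for three parameters, and
what remains is to count the possible `υ`.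

Commuting the covariant derivatives of `N` shows that `υ` together with `μ = ½ dυ` solves a closed
differential system in which all first derivatives are prescribed (`IsSolution`,
`IsSolution.d_mu`). On a convex set a solution is therefore determined by its value at one point
(`IsSolution.unique`). The integrability condition of this system is
`6 μ² + 3 (λ₀ υ₁ - λ₁ υ₀) + (a known function) = 0`, where `λ` is the rotated differential of the
Gaussian curvature (`IsSolution.constraint`). These identities are verified in an arbitrary
commutative ring with two commuting derivations and applied to the ring of smooth functions on an
open set.

If the curvature is constant, then `λ = 0` and the condition says `μ = 0`. The coefficients of an
integral can then be rescaled so that the coframe consists of differentials `du₀`, `du₁`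
(`exists_potentials`). Multiplication by the matrices `1 + ϑ ⊗ (-u₁, u₀)` yields further integrals
whose `υ` takes every value at `s` (`upsilon_transvection_mul`), so that every integral is a
projective transform of one of these. This gives `3 + 2 = 5` parameters
(`integralSpaceHasDim_five`).

If the curvature is not constant near `s`, then `λ` does not vanish identically on any ball about
`s`. At a point where `λ ≠ 0` the integrability condition and its derivatives are polynomial
equations for the value of `(υ, μ)`, and they have only finitely many solutions, apart from those
with one exceptional value of `μ` (`finite_values`). Applied on a countable dense set, this leaves
countably many solutions of the system and those for which `μ` is one fixed function; of the
latter there is at most one, because two would have `μ = 0` and hence `λ = 0`. So there are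
countably many `υ` (`countable_solutions`), every family of integrals has locally constant `υ`, and
the dimension is `3` (`integralSpaceHasDim_three`).

In both cases the passage from the possible `υ` to the dimension is the same. Given families of
integrals normalized at `s` (`IsBaseFamily`), the orbits of their members under projective
transformations are covered by two charts, which gives effective families
(`IsBaseFamily.isIntegralFamily`, `exists_covering`). Conversely a family of integrals that lie in
these orbits has as parameters at most its value at `s` up to a factor and the parameters of the
base family (`IsIntegralFamily.card_le`).
-/

open scoped ContDiff Matrix Topology

noncomputable section

namespace FracLin

open TopologicalSpace

/-! ### Identities in a commutative ring with two commuting derivations -/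

section Algebra

variable {R : Type*} [CommRing R] [Algebra ℝ R]

lemma eq_zero_of_two_mul {z : R} (hz : 2 * z = 0) : z = 0 := by
  have h2 : (2 : R) = algebraMap ℝ R 2 := (map_ofNat (algebraMap ℝ R) 2).symm
  have h : algebraMap ℝ R (1 / 2) * algebraMap ℝ R 2 = 1 := by rw [← map_mul]; norm_num
  rw [← h2] at h
  linear_combination algebraMap ℝ R (1 / 2) * hz - z * h

/-- An algebraic model of a surface with a metric: in a commutative ring `R` with commuting
derivations `d 0`, `d 1`, the family `Γ` is the torsion-free connection that preserves the
symmetric form `g`, and its curvature is that of a surface of Gaussian curvature `K`. -/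
structure IsLeviCivita (d : Fin 2 → Derivation ℝ R R) (g : Fin 2 → Fin 2 → R)
    (Γ : Fin 2 → Fin 2 → Fin 2 → R) (K : R) : Prop where
  comm : ∀ f, d 0 (d 1 f) = d 1 (d 0 f)
  symm : g 1 0 = g 0 1
  torsion_free : ∀ k, Γ k 1 0 = Γ k 0 1
  metric : ∀ i j k, d k (g i j) = Γ 0 k i * g 0 j + Γ 1 k i * g 1 j
    + (Γ 0 k j * g i 0 + Γ 1 k j * g i 1)
  curvature : ∀ l k, d 0 (Γ l 1 k) - d 1 (Γ l 0 k)
    + (Γ l 0 0 * Γ 0 1 k - Γ l 1 0 * Γ 0 0 k + (Γ l 0 1 * Γ 1 1 k - Γ l 1 1 * Γ 1 0 k))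
      = K * ((if l = 0 then g 1 k else 0) - (if l = 1 then g 0 k else 0))

/-- In dimension two the whole curvature tensor is determined by the component that enters the
Gaussian curvature, since lowering an index makes it skew. -/
lemma IsLeviCivita.of_component (d : Fin 2 → Derivation ℝ R R) (g : Fin 2 → Fin 2 → R)
    (Γ : Fin 2 → Fin 2 → Fin 2 → R) (K u : R)
    (comm : ∀ f, d 0 (d 1 f) = d 1 (d 0 f)) (symm : g 1 0 = g 0 1)
    (torsion_free : ∀ k, Γ k 1 0 = Γ k 0 1)
    (metric : ∀ i j k, d k (g i j) = Γ 0 k i * g 0 j + Γ 1 k i * g 1 j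
      + (Γ 0 k j * g i 0 + Γ 1 k j * g i 1))
    (hu : (g 0 0 * g 1 1 - g 0 1 * g 0 1) * u = 1)
    (hK : g 0 0 * (d 0 (Γ 0 1 1) - d 1 (Γ 0 0 1)
        + (Γ 0 0 0 * Γ 0 1 1 - Γ 0 1 0 * Γ 0 0 1 + (Γ 0 0 1 * Γ 1 1 1 - Γ 0 1 1 * Γ 1 0 1)))
      + g 1 0 * (d 0 (Γ 1 1 1) - d 1 (Γ 1 0 1)
        + (Γ 1 0 0 * Γ 0 1 1 - Γ 1 1 0 * Γ 0 0 1 + (Γ 1 0 1 * Γ 1 1 1 - Γ 1 1 1 * Γ 1 0 1)))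
      = K * (g 0 0 * g 1 1 - g 0 1 * g 0 1)) :
    IsLeviCivita d g Γ K := by
  refine ⟨comm, symm, torsion_free, metric, ?_⟩
  have c00 := comm (g 0 0)
  have c01 := comm (g 0 1)
  have c11 := comm (g 1 1)
  simp only [metric, map_add, Derivation.leibniz, smul_eq_mul, torsion_free, symm] at c00 c01 c11
  simp only [torsion_free, symm] at hK
  have cancel : ∀ z, 2 * ((g 0 0 * g 1 1 - g 0 1 * g 0 1) * z) = 0 → z = 0 := fun z hz => by
    linear_combination u * eq_zero_of_two_mul hz - z * hu
  simp only [Fin.forall_fin_two, torsion_free, symm]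
  norm_num
  refine ⟨⟨?_, ?_⟩, ?_, ?_⟩ <;> rw [← sub_eq_zero] <;> apply cancel
  · linear_combination g 1 1 * c00 - 2 * g 0 1 * (c01 - hK)
  · linear_combination 2 * g 1 1 * hK - g 0 1 * c11
  · linear_combination 2 * g 0 0 * (c01 - hK) - g 0 1 * c00
  · linear_combination g 0 0 * c11 - 2 * g 0 1 * hK

section Coframe

variable {d : Fin 2 → Derivation ℝ R R} {g : Fin 2 → Fin 2 → R} {Γ : Fin 2 → Fin 2 → Fin 2 → R}
  {K : R}

/-- If the connection `Γ + κ + υ` has two independent parallel forms, then it is flat, and this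
is what flatness says about `υ` and `κ`. -/
lemma IsLeviCivita.upsilon_eq (h : IsLeviCivita d g Γ K) {N : Fin 2 → Fin 2 → R}
    {κ υ : Fin 2 → R} {u : R} (hu : (N 0 0 * N 1 1 - N 0 1 * N 1 0) * u = 1)
    (hN : ∀ a i j, d i (N a j) = Γ 0 i j * N a 0 + Γ 1 i j * N a 1 + κ i * N a j + υ j * N a i) :
    d 0 (υ 0) = Γ 0 0 0 * υ 0 + Γ 1 0 0 * υ 1 + υ 0 * υ 0 + K * g 0 0 ∧
    d 1 (υ 1) = Γ 0 1 1 * υ 0 + Γ 1 1 1 * υ 1 + υ 1 * υ 1 + K * g 1 1 ∧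
    d 0 (υ 1) = Γ 0 0 1 * υ 0 + Γ 1 0 1 * υ 1 + υ 0 * υ 1 + K * g 0 1
      - (d 0 (κ 1) - d 1 (κ 0)) ∧
    d 1 (υ 0) = Γ 0 0 1 * υ 0 + Γ 1 0 1 * υ 1 + υ 0 * υ 1 + K * g 0 1
      + (d 0 (κ 1) - d 1 (κ 0)) := by
  have cancel : ∀ z, (N 0 0 * N 1 1 - N 0 1 * N 1 0) * z = 0 → z = 0 := fun z hz => by
    linear_combination u * hz - z * hu
  have c : ∀ a j, d 0 (d 1 (N a j)) = d 1 (d 0 (N a j)) := fun a j => h.comm _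
  have cv := h.curvature
  have symm := h.symm
  have tf := h.torsion_free
  simp only [hN, map_add, Derivation.leibniz, smul_eq_mul, Fin.forall_fin_two, tf] at c
  simp only [Fin.forall_fin_two, tf, symm] at cv
  norm_num at cv
  obtain ⟨⟨v00, v01⟩, v10, v11⟩ := cv
  obtain ⟨⟨c00, c01⟩, c10, c11⟩ := c
  refine ⟨?_, ?_, ?_, ?_⟩ <;> rw [← sub_eq_zero] <;> apply cancel
  · linear_combination N 0 0 * (c10 - N 1 0 * v00 - N 1 1 * v10)
      - N 1 0 * (c00 - N 0 0 * v00 - N 0 1 * v10)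
  · linear_combination N 0 1 * (c11 - N 1 0 * v01 - N 1 1 * v11)
      - N 1 1 * (c01 - N 0 0 * v01 - N 0 1 * v11)
  · linear_combination N 0 0 * (c11 - N 1 0 * v01 - N 1 1 * v11)
      - N 1 0 * (c01 - N 0 0 * v01 - N 0 1 * v11)
  · linear_combination N 0 1 * (c10 - N 1 0 * v00 - N 1 1 * v10)
      - N 1 1 * (c00 - N 0 0 * v00 - N 0 1 * v10)

/-- The closed differential system satisfied by the `1`-form `υ` of an integral, with the exterior
derivative `2 μ` of `υ` as an additional unknown. -/
structure IsSolution (d : Fin 2 → Derivation ℝ R R) (g : Fin 2 → Fin 2 → R)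
    (Γ : Fin 2 → Fin 2 → Fin 2 → R) (K : R) (υ : Fin 2 → R) (μ : R) : Prop where
  d00 : d 0 (υ 0) = Γ 0 0 0 * υ 0 + Γ 1 0 0 * υ 1 + υ 0 * υ 0 + K * g 0 0
  d11 : d 1 (υ 1) = Γ 0 1 1 * υ 0 + Γ 1 1 1 * υ 1 + υ 1 * υ 1 + K * g 1 1
  d01 : d 0 (υ 1) = Γ 0 0 1 * υ 0 + Γ 1 0 1 * υ 1 + υ 0 * υ 1 + K * g 0 1 + μ
  d10 : d 1 (υ 0) = Γ 0 0 1 * υ 0 + Γ 1 0 1 * υ 1 + υ 0 * υ 1 + K * g 0 1 - μ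

/-- The (weighted) differential of the curvature, rotated by a right angle; this is the obstruction
to flatness of the projective structure of the geodesics. -/
def lam (d : Fin 2 → Derivation ℝ R R) (g : Fin 2 → Fin 2 → R) (K : R) (j : Fin 2) : R :=
  d 0 K * g 1 j - d 1 K * g 0 j

/-- The term free of the unknowns in the integrability condition `IsSolution.constraint`. -/
def source (d : Fin 2 → Derivation ℝ R R) (g : Fin 2 → Fin 2 → R)
    (Γ : Fin 2 → Fin 2 → Fin 2 → R) (K : R) : R :=
  lam d g K 0 * (Γ 0 0 1 + Γ 1 1 1) - lam d g K 1 * (Γ 0 0 0 + Γ 1 0 1)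
    + d 0 (lam d g K 1) - d 1 (lam d g K 0)

variable {υ : Fin 2 → R} {μ : R}

/-- The exterior derivative of the equations for `υ` gives the derivatives of `μ`. -/
lemma IsSolution.d_mu (h : IsLeviCivita d g Γ K) (hs : IsSolution d g Γ K υ μ) :
    d 0 μ = (Γ 0 0 0 + Γ 1 0 1 + 3 * υ 0) * μ + lam d g K 0 ∧
    d 1 μ = (Γ 0 0 1 + Γ 1 1 1 + 3 * υ 1) * μ + lam d g K 1 := by
  have cv := h.curvature
  have symm := h.symm
  have tf := h.torsion_free
  have m := h.metric
  simp only [Fin.forall_fin_two, tf, symm] at cv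
  norm_num at cv
  obtain ⟨⟨v00, v01⟩, v10, v11⟩ := cv
  have c0 := h.comm (υ 0)
  have c1 := h.comm (υ 1)
  simp only [hs.d00, hs.d01, hs.d10, hs.d11, map_add, map_sub, Derivation.leibniz, smul_eq_mul,
    tf, m, symm] at c0 c1
  simp only [lam, symm]
  constructor
  · linear_combination -c0 + υ 0 * v00 + υ 1 * v10
  · linear_combination -c1 + υ 0 * v01 + υ 1 * v11

/-- The integrability condition of the system for `μ`. -/
lemma IsSolution.constraint (h : IsLeviCivita d g Γ K) (hs : IsSolution d g Γ K υ μ) :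
    6 * μ * μ + 3 * (lam d g K 0 * υ 1 - lam d g K 1 * υ 0) + source d g Γ K = 0 := by
  have cv := h.curvature
  have symm := h.symm
  have tf := h.torsion_free
  simp only [Fin.forall_fin_two, tf, symm] at cv
  norm_num at cv
  obtain ⟨⟨v00, v01⟩, v10, v11⟩ := cv
  obtain ⟨m0, m1⟩ := hs.d_mu h
  have n3 : ∀ i, d i 3 = 0 := fun i => by
    simpa using (d i).map_natCast 3
  have c := h.comm μ
  simp only [m0, m1, hs.d01, hs.d10, map_add, Derivation.leibniz, smul_eq_mul, n3] at c
  simp only [source]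
  linear_combination c - μ * (v00 + v11)

/-- The difference of two solutions solves a linear system. -/
lemma IsSolution.d_sub (h : IsLeviCivita d g Γ K) {υ' : Fin 2 → R} {μ' : R}
    (hs : IsSolution d g Γ K υ μ) (hs' : IsSolution d g Γ K υ' μ') :
    d 0 (υ 0 - υ' 0) = (Γ 0 0 0 + υ 0 + υ' 0) * (υ 0 - υ' 0) + Γ 1 0 0 * (υ 1 - υ' 1)
      + 0 * (μ - μ') ∧
    d 0 (υ 1 - υ' 1) = (Γ 0 0 1 + υ 1) * (υ 0 - υ' 0) + (Γ 1 0 1 + υ' 0) * (υ 1 - υ' 1)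
      + 1 * (μ - μ') ∧
    d 0 (μ - μ') = 3 * μ' * (υ 0 - υ' 0) + 0 * (υ 1 - υ' 1)
      + (Γ 0 0 0 + Γ 1 0 1 + 3 * υ 0) * (μ - μ') ∧
    d 1 (υ 0 - υ' 0) = (Γ 0 0 1 + υ 1) * (υ 0 - υ' 0) + (Γ 1 0 1 + υ' 0) * (υ 1 - υ' 1)
      + -1 * (μ - μ') ∧
    d 1 (υ 1 - υ' 1) = Γ 0 1 1 * (υ 0 - υ' 0) + (Γ 1 1 1 + υ 1 + υ' 1) * (υ 1 - υ' 1)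
      + 0 * (μ - μ') ∧
    d 1 (μ - μ') = 0 * (υ 0 - υ' 0) + 3 * μ' * (υ 1 - υ' 1)
      + (Γ 0 0 1 + Γ 1 1 1 + 3 * υ 1) * (μ - μ') := by
  obtain ⟨m0, m1⟩ := hs.d_mu h
  obtain ⟨m0', m1'⟩ := hs'.d_mu h
  simp only [map_sub, hs.d00, hs'.d00, hs.d01, hs'.d01, hs.d10, hs'.d10, hs.d11, hs'.d11,
    m0, m0', m1, m1']
  refine ⟨?_, ?_, ?_, ?_, ?_, ?_⟩ <;> ring

/-- The part of the right-hand side of `IsSolution.d_constraint` that does not contain `μ`: an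
expression affine in `υ`. -/
def affinePart (d : Fin 2 → Derivation ℝ R R) (g : Fin 2 → Fin 2 → R)
    (Γ : Fin 2 → Fin 2 → Fin 2 → R) (K : R) (υ : Fin 2 → R) (j : Fin 2) : R :=
  -6 * source d g Γ K * υ j
    - (6 * (lam d g K 0 * υ 1 - lam d g K 1 * υ 0) + 2 * source d g Γ K) * (Γ 0 0 j + Γ 1 1 j)
    + 3 * (d j (lam d g K 0) * υ 1 - d j (lam d g K 1) * υ 0
      + lam d g K 0 * (Γ 0 j 1 * υ 0 + Γ 1 j 1 * υ 1 + K * g j 1)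
      - lam d g K 1 * (Γ 0 j 0 * υ 0 + Γ 1 j 0 * υ 1 + K * g j 0)) + d j (source d g Γ K)

/-- The derivatives of the integrability condition, simplified by means of that condition. -/
lemma IsSolution.d_constraint (h : IsLeviCivita d g Γ K) (hs : IsSolution d g Γ K υ μ) (j : Fin 2) :
    15 * (lam d g K 0 * υ 1 - lam d g K 1 * υ 0) * υ j
      = 15 * μ * lam d g K j + affinePart d g Γ K υ j := by
  have symm := h.symm
  have tf := h.torsion_free
  obtain ⟨m0, m1⟩ := hs.d_mu h
  have n3 : ∀ i, d i 3 = 0 := fun i => by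
    simpa using (d i).map_natCast 3
  have n6 : ∀ i, d i 6 = 0 := fun i => by
    simpa using (d i).map_natCast 6
  have hc := hs.constraint h
  have c := congrArg (d j) hc
  fin_cases j
  · simp only [Fin.zero_eta, m0, hs.d00, hs.d01, map_add, map_sub, map_zero, Derivation.leibniz,
      smul_eq_mul, n3, n6] at c
    simp only [Fin.zero_eta, affinePart, tf]
    linear_combination (6 * υ 0 + 2 * (Γ 0 0 0 + Γ 1 0 1)) * hc - c
  · simp only [Fin.mk_one, m1, hs.d10, hs.d11, map_add, map_sub, map_zero, Derivation.leibniz,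
      smul_eq_mul, n3, n6] at c
    simp only [Fin.mk_one, affinePart, tf, symm]
    linear_combination (6 * υ 1 + 2 * (Γ 0 0 1 + Γ 1 1 1)) * hc - c

end Coframe

end Algebra

/-! ### Partial derivatives and the ring of smooth functions on an open set -/

section SmoothFunctions

lemma contDiffOn_partialDeriv {W : Set Plane} (hW : IsOpen W) {f : Plane → ℝ}
    (hf : ContDiffOn ℝ ∞ f W) (i : Fin 2) : ContDiffOn ℝ ∞ (partialDeriv i f) W :=
  (hf.fderiv_of_isOpen hW (by simp)).clm_apply contDiffOn_const

lemma differentiableAt_of_contDiffOn {E F : Type*} [NormedAddCommGroup E] [NormedSpace ℝ E]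
    [NormedAddCommGroup F] [NormedSpace ℝ F] {W : Set E} (hW : IsOpen W) {f : E → F}
    (hf : ContDiffOn ℝ ∞ f W) {x : E} (hx : x ∈ W) : DifferentiableAt ℝ f x :=
  (hf.contDiffAt (hW.mem_nhds hx)).differentiableAt (by simp)

lemma partialDeriv_congr {W : Set Plane} (hW : IsOpen W) {f f' : Plane → ℝ} {i : Fin 2}
    (h : ∀ x ∈ W, f x = f' x) : ∀ x ∈ W, partialDeriv i f x = partialDeriv i f' x := by
  intro x hx
  have : f =ᶠ[𝓝 x] f' := by filter_upwards [hW.mem_nhds hx] with y hy using h y hy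
  rw [partialDeriv, partialDeriv, this.fderiv_eq]

lemma partialDeriv_add {f f' : Plane → ℝ} {i : Fin 2} {x : Plane}
    (hf : DifferentiableAt ℝ f x) (hf' : DifferentiableAt ℝ f' x) :
    partialDeriv i (fun y => f y + f' y) x = partialDeriv i f x + partialDeriv i f' x := by
  simp [partialDeriv, fderiv_fun_add hf hf']

lemma partialDeriv_mul {f f' : Plane → ℝ} {i : Fin 2} {x : Plane}
    (hf : DifferentiableAt ℝ f x) (hf' : DifferentiableAt ℝ f' x) :
    partialDeriv i (fun y => f y * f' y) x
      = f x * partialDeriv i f' x + f' x * partialDeriv i f x := by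
  simp [partialDeriv, fderiv_fun_mul hf hf']

lemma partialDeriv_mul_add_mul {a b a' b' : Plane → ℝ} {i : Fin 2} {x : Plane}
    (ha : DifferentiableAt ℝ a x) (hb : DifferentiableAt ℝ b x) (ha' : DifferentiableAt ℝ a' x)
    (hb' : DifferentiableAt ℝ b' x) :
    partialDeriv i (fun y => a y * b y + a' y * b' y) x
      = a x * partialDeriv i b x + b x * partialDeriv i a x
        + (a' x * partialDeriv i b' x + b' x * partialDeriv i a' x) := by
  rw [partialDeriv_add (ha.fun_mul hb) (ha'.fun_mul hb'), partialDeriv_mul ha hb,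
    partialDeriv_mul ha' hb']

lemma mulVec_apply_two (M : Matrix (Fin 2) (Fin 2) ℝ) (v : Plane) (a : Fin 2) :
    (M *ᵥ v) a = M a 0 * v 0 + M a 1 * v 1 := by
  simp [Matrix.mulVec, dotProduct, Fin.sum_univ_two]

lemma partialDeriv_comm {W : Set Plane} (hW : IsOpen W) {f : Plane → ℝ}
    (hf : ContDiffOn ℝ ∞ f W) {x : Plane} (hx : x ∈ W) (i j : Fin 2) :
    partialDeriv i (partialDeriv j f) x = partialDeriv j (partialDeriv i f) x := by
  have hs := (hf.contDiffAt (hW.mem_nhds hx)).isSymmSndFDerivAt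
    (by simpa using WithTop.coe_le_coe.2 (le_top : (2 : ℕ∞) ≤ ⊤))
  have h : ∀ i j, partialDeriv i (partialDeriv j f) x
      = fderiv ℝ (fderiv ℝ f) x (Pi.single i 1) (Pi.single j 1) := by
    intro i j
    have hd : DifferentiableAt ℝ (fderiv ℝ f) x :=
      differentiableAt_of_contDiffOn hW (hf.fderiv_of_isOpen hW (by simp)) hx
    unfold partialDeriv
    rw [fderiv_clm_apply hd (by fun_prop)]
    simp
  rw [h, h]
  exact hs _ _

/-- The derivative of a function on the plane is assembled from the partial derivatives. -/
lemma fderiv_eq_sum_partialDeriv (f : Plane → ℝ) (x v : Plane) :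
    fderiv ℝ f x v = v 0 * partialDeriv 0 f x + v 1 * partialDeriv 1 f x := by
  have : v = v 0 • Pi.single 0 1 + v 1 • Pi.single 1 1 := by
    ext i; fin_cases i <;> simp
  conv_lhs => rw [this]
  simp [partialDeriv]

/-- The ring of smooth functions on `W`, realized inside the ring of all functions on `W`, so that
equality is equality on `W` and identities can be verified by ring normalization. -/
def smoothFn (W : Opens Plane) : Subalgebra ℝ (W → ℝ) where
  carrier := {f | ∃ F : Plane → ℝ, ContDiffOn ℝ ∞ F (W : Set Plane) ∧ ∀ x : W, f x = F x}
  mul_mem' := by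
    rintro f f' ⟨F, hF, h⟩ ⟨F', hF', h'⟩
    exact ⟨fun x => F x * F' x, hF.mul hF', fun x => by simp [h, h']⟩
  add_mem' := by
    rintro f f' ⟨F, hF, h⟩ ⟨F', hF', h'⟩
    exact ⟨fun x => F x + F' x, hF.add hF', fun x => by simp [h, h']⟩
  algebraMap_mem' r := ⟨fun _ => r, contDiffOn_const, fun x => by simp⟩

variable {W : Opens Plane}

open Classical in
/-- The extension by zero of a smooth function on `W` to the plane. -/
def extendZero (f : smoothFn W) (x : Plane) : ℝ := if h : x ∈ W then f.1 ⟨x, h⟩ else 0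

lemma contDiffOn_extendZero (f : smoothFn W) : ContDiffOn ℝ ∞ (extendZero f) (W : Set Plane) := by
  obtain ⟨F, hF, h⟩ := f.2
  refine hF.congr fun x hx => ?_
  have hx' : x ∈ W := hx
  simp [extendZero, hx', h]

/-- The restriction to `W` of a function that is smooth on `W`. -/
def restrictSmooth (F : Plane → ℝ) (hF : ContDiffOn ℝ ∞ F W) : smoothFn W :=
  ⟨fun x => F x, F, hF, fun _ => rfl⟩

/-- The `i`-th partial derivative as a derivation of the ring of smooth functions. -/
def smoothDeriv (W : Opens Plane) (i : Fin 2) : Derivation ℝ (smoothFn W) (smoothFn W) :=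
  Derivation.mk'
    { toFun := fun f => restrictSmooth (partialDeriv i (extendZero f))
        (contDiffOn_partialDeriv W.isOpen (contDiffOn_extendZero f) i)
      map_add' := by
        intro f f'
        ext ⟨x, hx⟩
        have := partialDeriv_congr (i := i) W.isOpen
          (f := (extendZero (f + f'))) (f' := fun x => (extendZero f) x + (extendZero f') x)
          (fun x hx => by
            have hx' : x ∈ W := hx
            simp [extendZero, hx']) x hx
        simp only [restrictSmooth, this]
        exact partialDeriv_add
          (differentiableAt_of_contDiffOn W.isOpen (contDiffOn_extendZero f) hx)
          (differentiableAt_of_contDiffOn W.isOpen (contDiffOn_extendZero f') hx)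
      map_smul' := by
        intro r f
        ext ⟨x, hx⟩
        have := partialDeriv_congr (i := i) W.isOpen
          (f := (extendZero (r • f))) (f' := fun x => r * (extendZero f) x) (fun x hx => by
            have hx' : x ∈ W := hx
            simp [extendZero, hx']) x hx
        simp only [restrictSmooth, this]
        rw [partialDeriv_mul (by fun_prop)
          (differentiableAt_of_contDiffOn W.isOpen (contDiffOn_extendZero f) hx)]
        simp [partialDeriv] }
    (by
      intro f f'
      ext ⟨x, hx⟩
      have := partialDeriv_congr (i := i) W.isOpen
        (f := (extendZero (f * f'))) (f' := fun x => (extendZero f) x * (extendZero f') x)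
        (fun x hx => by
          have hx' : x ∈ W := hx
          simp [extendZero, hx']) x hx
      have hx' : x ∈ W := hx
      simp only [restrictSmooth, this, LinearMap.coe_mk, AddHom.coe_mk]
      rw [partialDeriv_mul (differentiableAt_of_contDiffOn W.isOpen (contDiffOn_extendZero f) hx)
        (differentiableAt_of_contDiffOn W.isOpen (contDiffOn_extendZero f') hx)]
      simp [extendZero, hx'])

lemma smoothDeriv_restrictSmooth {F : Plane → ℝ} (hF : ContDiffOn ℝ ∞ F W) (i : Fin 2) :
    smoothDeriv W i (restrictSmooth F hF)
      = restrictSmooth (partialDeriv i F) (contDiffOn_partialDeriv W.isOpen hF i) := by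
  ext ⟨x, hx⟩
  exact partialDeriv_congr W.isOpen (fun x hx => by
    have hx' : x ∈ W := hx
    simp [extendZero, restrictSmooth, hx']) x hx

lemma smoothDeriv_comm (f : smoothFn W) :
    smoothDeriv W 0 (smoothDeriv W 1 f) = smoothDeriv W 1 (smoothDeriv W 0 f) := by
  have hf : f = restrictSmooth (extendZero f) (contDiffOn_extendZero f) := by
    ext ⟨x, hx⟩
    simp [extendZero, restrictSmooth]
  rw [hf]
  simp only [smoothDeriv_restrictSmooth]
  ext ⟨x, hx⟩
  exact partialDeriv_comm W.isOpen (contDiffOn_extendZero f) hx 0 1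

lemma smoothFn_ext_iff {f f' : smoothFn W} : f = f' ↔ ∀ x : W, f.1 x = f'.1 x := by
  rw [Subtype.ext_iff, funext_iff]

end SmoothFunctions

/-! ### The Levi-Civita connection of a metric in coordinates -/

section LeviCivita

variable {U : Set Plane} {g : Plane → Matrix (Fin 2) (Fin 2) ℝ}

lemma IsRiemannianMetricOn.symm (hg : IsRiemannianMetricOn g U) {x : Plane} (hx : x ∈ U)
    (i j : Fin 2) : g x i j = g x j i := by
  have := (hg.posDef x hx).isHermitian.apply i j
  simpa using this.symm

lemma IsRiemannianMetricOn.det_ne_zero (hg : IsRiemannianMetricOn g U) {x : Plane} (hx : x ∈ U) :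
    (g x).det ≠ 0 := (hg.posDef x hx).det_pos.ne'

/-- The inverse of a smooth invertible matrix function is smooth. -/
lemma contDiffOn_inv_apply {E : Type*} [NormedAddCommGroup E] [NormedSpace ℝ E] {W : Set E}
    {M : E → Matrix (Fin 2) (Fin 2) ℝ} (hM : ∀ i j, ContDiffOn ℝ ∞ (fun x => M x i j) W)
    (hdet : ∀ x ∈ W, (M x).det ≠ 0) (i j : Fin 2) :
    ContDiffOn ℝ ∞ (fun x => (M x)⁻¹ i j) W := by
  have hd : ContDiffOn ℝ ∞ (fun x => (M x).det⁻¹) W := by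
    refine ContDiffOn.inv ?_ hdet
    simp only [Matrix.det_fin_two]
    exact ((hM 0 0).mul (hM 1 1)).sub ((hM 0 1).mul (hM 1 0))
  have ha : ContDiffOn ℝ ∞ (fun x => (M x).adjugate i j) W := by
    simp only [Matrix.adjugate_fin_two]
    fin_cases i <;> fin_cases j
    · exact hM 1 1
    · exact (hM 0 1).neg
    · exact (hM 1 0).neg
    · exact hM 0 0
  refine (hd.mul ha).congr fun x _ => ?_
  rw [Matrix.inv_def, Ring.inverse_eq_inv']
  rfl

lemma contDiffOn_christoffel (hU : IsOpen U) (hg : IsRiemannianMetricOn g U) (k i j : Fin 2) :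
    ContDiffOn ℝ ∞ (christoffel g k i j) U := by
  have hd : ∀ a b i, ContDiffOn ℝ ∞ (partialDeriv i fun y => g y a b) U := fun a b i =>
    contDiffOn_partialDeriv hU (hg.smooth a b) i
  refine contDiffOn_const.mul (ContDiffOn.sum fun l _ => ?_)
  exact (contDiffOn_inv_apply hg.smooth (fun x hx => hg.det_ne_zero hx) k l).mul
    (((hd _ _ _).add (hd _ _ _)).sub (hd _ _ _))

lemma contDiffOn_gaussianCurvature (hU : IsOpen U) (hg : IsRiemannianMetricOn g U) :
    ContDiffOn ℝ ∞ (gaussianCurvature g) U := by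
  have hc := contDiffOn_christoffel hU hg
  have hd : ∀ k i j l, ContDiffOn ℝ ∞ (partialDeriv l (christoffel g k i j)) U := fun k i j l =>
    contDiffOn_partialDeriv hU (hc k i j) l
  refine ContDiffOn.div ?_ ?_ (fun x hx => hg.det_ne_zero hx)
  · refine ContDiffOn.sum fun l _ => (hg.smooth _ _).mul ?_
    refine ((hd _ _ _ _).sub (hd _ _ _ _)).add (ContDiffOn.sum fun m _ => ?_)
    exact ((hc _ _ _).mul (hc _ _ _)).sub ((hc _ _ _).mul (hc _ _ _))
  · simp only [Matrix.det_fin_two]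
    exact ((hg.smooth 0 0).mul (hg.smooth 1 1)).sub ((hg.smooth 0 1).mul (hg.smooth 1 0))

lemma christoffel_symm (hU : IsOpen U) (hg : IsRiemannianMetricOn g U) {x : Plane} (hx : x ∈ U)
    (k i j : Fin 2) : christoffel g k i j x = christoffel g k j i x := by
  have h : ∀ l, partialDeriv l (fun y => g y i j) x = partialDeriv l (fun y => g y j i) x :=
    fun l => partialDeriv_congr hU (fun y hy => hg.symm hy i j) x hx
  simp only [christoffel, h]
  congr 1
  exact Finset.sum_congr rfl fun l _ => by ring

/-- The Christoffel symbols of the first kind. -/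
lemma sum_metric_mul_christoffel (hg : IsRiemannianMetricOn g U) {x : Plane}
    (hx : x ∈ U) (m i j : Fin 2) :
    g x m 0 * christoffel g 0 i j x + g x m 1 * christoffel g 1 i j x
      = 1 / 2 * (partialDeriv i (fun y => g y j m) x + partialDeriv j (fun y => g y i m) x
        - partialDeriv m (fun y => g y i j) x) := by
  have hinv : g x * (g x)⁻¹ = 1 := Matrix.mul_nonsing_inv _ (hg.det_ne_zero hx).isUnit
  have h : ∀ a b, g x a 0 * (g x)⁻¹ 0 b + g x a 1 * (g x)⁻¹ 1 b
      = (1 : Matrix (Fin 2) (Fin 2) ℝ) a b := fun a b => by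
    rw [← hinv, Matrix.mul_apply, Fin.sum_univ_two]
  have h0 := h m 0
  have h1 := h m 1
  simp only [christoffel, Fin.sum_univ_two]
  obtain rfl | rfl : m = 0 ∨ m = 1 := by omega
  all_goals
    simp at h0 h1
    linear_combination (1 / 2) * (partialDeriv i (fun y => g y j 0) x
      + partialDeriv j (fun y => g y i 0) x - partialDeriv 0 (fun y => g y i j) x) * h0
      + (1 / 2) * (partialDeriv i (fun y => g y j 1) x
      + partialDeriv j (fun y => g y i 1) x - partialDeriv 1 (fun y => g y i j) x) * h1

/-- The Levi-Civita connection preserves the metric. -/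
lemma partialDeriv_metric (hU : IsOpen U) (hg : IsRiemannianMetricOn g U) {x : Plane}
    (hx : x ∈ U) (i j k : Fin 2) :
    partialDeriv k (fun y => g y i j) x
      = christoffel g 0 k i x * g x 0 j + christoffel g 1 k i x * g x 1 j
        + (christoffel g 0 k j x * g x i 0 + christoffel g 1 k j x * g x i 1) := by
  have h1 := sum_metric_mul_christoffel hg hx j k i
  have h2 := sum_metric_mul_christoffel hg hx i k j
  have h : ∀ i j l, partialDeriv l (fun y => g y i j) x = partialDeriv l (fun y => g y j i) x :=
    fun i j l => partialDeriv_congr hU (fun y hy => hg.symm hy i j) x hx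
  rw [h j i k] at h2
  rw [hg.symm hx 0 j, hg.symm hx 1 j]
  linear_combination -h1 - h2

variable {W : Opens Plane}

/-- The entries of the metric as elements of the ring of smooth functions on `W`. -/
def metricFn (hg : IsRiemannianMetricOn g U) (hWU : (W : Set Plane) ⊆ U) (i j : Fin 2) :
    smoothFn W := restrictSmooth (fun x => g x i j) ((hg.smooth i j).mono hWU)

/-- The Christoffel symbols as elements of the ring of smooth functions on `W`. -/
def christoffelFn (hU : IsOpen U) (hg : IsRiemannianMetricOn g U) (hWU : (W : Set Plane) ⊆ U)
    (k i j : Fin 2) : smoothFn W :=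
  restrictSmooth (christoffel g k i j) ((contDiffOn_christoffel hU hg k i j).mono hWU)

/-- The Gaussian curvature as an element of the ring of smooth functions on `W`. -/
def curvatureFn (hU : IsOpen U) (hg : IsRiemannianMetricOn g U) (hWU : (W : Set Plane) ⊆ U) :
    smoothFn W :=
  restrictSmooth (gaussianCurvature g) ((contDiffOn_gaussianCurvature hU hg).mono hWU)

lemma isLeviCivita_christoffel (hU : IsOpen U) (hg : IsRiemannianMetricOn g U)
    (hWU : (W : Set Plane) ⊆ U) :
    IsLeviCivita (smoothDeriv W) (metricFn hg hWU) (christoffelFn hU hg hWU)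
      (curvatureFn hU hg hWU) := by
  have hdet : ∀ x ∈ (W : Set Plane), g x 0 0 * g x 1 1 - g x 0 1 * g x 0 1 ≠ 0 := by
    intro x hx
    have := hg.det_ne_zero (hWU hx)
    rwa [Matrix.det_fin_two, hg.symm (hWU hx) 1 0] at this
  have hu : ContDiffOn ℝ ∞ (fun x => (g x 0 0 * g x 1 1 - g x 0 1 * g x 0 1)⁻¹)
      (W : Set Plane) := by
    have h : ∀ i j, ContDiffOn ℝ ∞ (fun x => g x i j) (W : Set Plane) := fun i j =>
      (hg.smooth i j).mono hWU
    exact (((h 0 0).mul (h 1 1)).sub ((h 0 1).mul (h 0 1))).inv hdet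
  refine IsLeviCivita.of_component _ _ _ _ (restrictSmooth _ hu) smoothDeriv_comm ?_ ?_ ?_ ?_ ?_
  · rw [smoothFn_ext_iff]
    exact fun x => hg.symm (hWU x.2) 1 0
  · intro k
    rw [smoothFn_ext_iff]
    exact fun x => christoffel_symm hU hg (hWU x.2) k 1 0
  · intro i j k
    rw [metricFn, smoothDeriv_restrictSmooth, smoothFn_ext_iff]
    exact fun x => partialDeriv_metric hU hg (hWU x.2) i j k
  · rw [smoothFn_ext_iff]
    exact fun x => mul_inv_cancel₀ (hdet x x.2)
  · simp only [christoffelFn, smoothDeriv_restrictSmooth]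
    rw [smoothFn_ext_iff]
    intro x
    have := hdet x x.2
    have hK : gaussianCurvature g x * (g x 0 0 * g x 1 1 - g x 0 1 * g x 0 1)
        = ∑ l, g x l 0 * riemann g l 1 0 1 x := by
      rw [gaussianCurvature, Matrix.det_fin_two, hg.symm (hWU x.2) 1 0, div_mul_cancel₀ _ this]
    simp only [riemann, Fin.sum_univ_two] at hK
    exact hK.symm

end LeviCivita

/-! ### Fractional-linear integrals as coframes -/

section IntegralCoframe

variable {U : Set Plane} {g : Plane → Matrix (Fin 2) (Fin 2) ℝ}

/-- The coframe of a fractional-linear function: its numerator and denominator, as functions of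
the velocity `v = g⁻¹ p`, are the rows of `c g`. -/
def coframe (g c : Plane → Matrix (Fin 2) (Fin 2) ℝ) (x : Plane) : Matrix (Fin 2) (Fin 2) ℝ :=
  c x * g x

/-- The covariant derivative `∇_i (N_a)_j` of the `a`-th form of the coframe `N = c g`. -/
def covDer (g c : Plane → Matrix (Fin 2) (Fin 2) ℝ) (a i j : Fin 2) (x : Plane) : ℝ :=
  partialDeriv i (fun y => coframe g c y a j) x
    - (christoffel g 0 i j x * coframe g c x a 0 + christoffel g 1 i j x * coframe g c x a 1)

/-- The covariant derivative of the coframe, expressed in the coframe itself. -/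
def connForm (g c : Plane → Matrix (Fin 2) (Fin 2) ℝ) (k i j : Fin 2) (x : Plane) : ℝ :=
  (coframe g c x)⁻¹ k 0 * covDer g c 0 i j x + (coframe g c x)⁻¹ k 1 * covDer g c 1 i j x

/-- The `1`-form `υ` of an integral, read off from `connForm k i j = κ_i δ^k_j + υ_j δ^k_i`, see
`IsIntegralOn.covDer_eq`. The projective change of the Levi-Civita connection by `υ` makes the
forms of the coframe recurrent. -/
def upsilon (g c : Plane → Matrix (Fin 2) (Fin 2) ℝ) (j : Fin 2) (x : Plane) : ℝ :=
  if j = 0 then connForm g c 1 1 0 x else connForm g c 0 0 1 x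

/-- The `1`-form `κ` of an integral, read off from `connForm k i j = κ_i δ^k_j + υ_j δ^k_i`. -/
def kappa (g c : Plane → Matrix (Fin 2) (Fin 2) ℝ) (i : Fin 2) (x : Plane) : ℝ :=
  if i = 0 then connForm g c 1 0 1 x else connForm g c 0 1 0 x

lemma coframe_apply (g c : Plane → Matrix (Fin 2) (Fin 2) ℝ) (x : Plane) (a j : Fin 2) :
    coframe g c x a j = c x a 0 * g x 0 j + c x a 1 * g x 1 j := by
  rw [coframe, Matrix.mul_apply, Fin.sum_univ_two]

lemma hasFDerivAt_linear_in_momenta {f f' : Plane → ℝ} {x p : Plane}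
    (hf : DifferentiableAt ℝ f x) (hf' : DifferentiableAt ℝ f' x) :
    ∃ L : Plane × Plane →L[ℝ] ℝ,
      HasFDerivAt (fun z : Plane × Plane => f z.1 * z.2 0 + f' z.1 * z.2 1) L (x, p) ∧
      ∀ i, L (Pi.single i 1, 0) = partialDeriv i f x * p 0 + partialDeriv i f' x * p 1 ∧
        L (0, Pi.single i 1)
          = f x * (Pi.single i 1 : Plane) 0 + f' x * (Pi.single i 1 : Plane) 1 := by
  have e : ∀ j : Fin 2, HasFDerivAt (fun z : Plane × Plane => z.2 j)
      ((ContinuousLinearMap.proj j).comp (ContinuousLinearMap.snd ℝ Plane Plane)) (x, p) := fun j =>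
    ((ContinuousLinearMap.proj (R := ℝ) (φ := fun _ : Fin 2 => ℝ) j).comp
      (ContinuousLinearMap.snd ℝ Plane Plane)).hasFDerivAt
  have h1 : HasFDerivAt (fun z : Plane × Plane => f z.1) _ (x, p) :=
    HasFDerivAt.comp (x, p) (f := Prod.fst) (g := f) hf.hasFDerivAt hasFDerivAt_fst
  have h2 : HasFDerivAt (fun z : Plane × Plane => f' z.1) _ (x, p) :=
    HasFDerivAt.comp (x, p) (f := Prod.fst) (g := f') hf'.hasFDerivAt hasFDerivAt_fst
  refine ⟨_, (h1.mul (e 0)).add (h2.mul (e 1)), fun i => ⟨?_, ?_⟩⟩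
  · simp [partialDeriv]
    ring
  · simp

/-- Derivatives of the Hamiltonian at the point with velocity `v`. -/
lemma fderiv_hamiltonian (hU : IsOpen U) (hg : IsRiemannianMetricOn g U) {x : Plane} (hx : x ∈ U)
    (v : Plane) (i : Fin 2) :
    fderiv ℝ (hamiltonian g) (x, g x *ᵥ v) (Pi.single i 1, 0)
      = -(1 / 2) * (partialDeriv i (fun y => g y 0 0) x * v 0 * v 0
        + 2 * (partialDeriv i (fun y => g y 0 1) x * v 0 * v 1)
        + partialDeriv i (fun y => g y 1 1) x * v 1 * v 1) ∧
    fderiv ℝ (hamiltonian g) (x, g x *ᵥ v) (0, Pi.single i 1) = v i := by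
  have hI := contDiffOn_inv_apply hg.smooth (fun x hx => hg.det_ne_zero hx)
  have dI : ∀ i j, DifferentiableAt ℝ (fun y => (g y)⁻¹ i j) x := fun i j =>
    differentiableAt_of_contDiffOn hU (hI i j) hx
  have dg : ∀ i j, DifferentiableAt ℝ (fun y => g y i j) x := fun i j =>
    differentiableAt_of_contDiffOn hU (hg.smooth i j) hx
  set p := g x *ᵥ v with hp
  have hp0 : p 0 = g x 0 0 * v 0 + g x 0 1 * v 1 := by
    rw [hp, mulVec_apply_two]
  have hp1 : p 1 = g x 0 1 * v 0 + g x 1 1 * v 1 := by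
    rw [hp, mulVec_apply_two, hg.symm hx 1 0]
  -- the velocity is recovered from the momentum
  have hv : (g x)⁻¹ *ᵥ p = v := by
    rw [hp, Matrix.mulVec_mulVec, Matrix.nonsing_inv_mul _ (hg.det_ne_zero hx).isUnit,
      Matrix.one_mulVec]
  have hv0 : (g x)⁻¹ 0 0 * p 0 + (g x)⁻¹ 0 1 * p 1 = v 0 := by
    rw [← congrFun hv 0]; rw [mulVec_apply_two]
  have hv1 : (g x)⁻¹ 1 0 * p 0 + (g x)⁻¹ 1 1 * p 1 = v 1 := by
    rw [← congrFun hv 1]; rw [mulVec_apply_two]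
  have hsI : (g x)⁻¹ 1 0 = (g x)⁻¹ 0 1 := by
    simp [Matrix.inv_def, Matrix.adjugate_fin_two, hg.symm hx 1 0]
  -- differentiate the relation `g g⁻¹ = 1`
  have hdI : ∀ a b, g x a 0 * partialDeriv i (fun y => (g y)⁻¹ 0 b) x
      + (g x)⁻¹ 0 b * partialDeriv i (fun y => g y a 0) x
      + (g x a 1 * partialDeriv i (fun y => (g y)⁻¹ 1 b) x
      + (g x)⁻¹ 1 b * partialDeriv i (fun y => g y a 1) x) = 0 := by
    intro a b
    have h := partialDeriv_congr (i := i) hU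
      (f := fun y => g y a 0 * (g y)⁻¹ 0 b + g y a 1 * (g y)⁻¹ 1 b)
      (f' := fun _ => (1 : Matrix (Fin 2) (Fin 2) ℝ) a b) (fun y hy => by
        rw [← Matrix.mul_nonsing_inv _ (hg.det_ne_zero hy).isUnit, Matrix.mul_apply,
          Fin.sum_univ_two]) x hx
    rw [partialDeriv_mul_add_mul (dg _ _) (dI _ _) (dg _ _) (dI _ _)] at h
    rw [h]
    simp [partialDeriv]
  obtain ⟨L0, hL0, h0⟩ := hasFDerivAt_linear_in_momenta (p := p) (dI 0 0) (dI 0 1)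
  obtain ⟨L1, hL1, h1⟩ := hasFDerivAt_linear_in_momenta (p := p) (dI 1 0) (dI 1 1)
  have e : ∀ j : Fin 2, HasFDerivAt (fun z : Plane × Plane => z.2 j)
      ((ContinuousLinearMap.proj j).comp (ContinuousLinearMap.snd ℝ Plane Plane)) (x, p) := fun j =>
    ((ContinuousLinearMap.proj (R := ℝ) (φ := fun _ : Fin 2 => ℝ) j).comp
      (ContinuousLinearMap.snd ℝ Plane Plane)).hasFDerivAt
  have hz0 := (e 0).mul hL0
  have hz1 := (e 1).mul hL1
  have hH := (hz0.add hz1).const_mul (1 / 2 : ℝ)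
  have heq := hH.congr_of_eventuallyEq (f₁ := hamiltonian g)
    (Filter.Eventually.of_forall fun z => by
      simp only [hamiltonian, Fin.sum_univ_two, Pi.add_apply, Pi.mul_apply]
      ring)
  rw [heq.fderiv]
  have hsg : partialDeriv i (fun y => g y 1 0) x = partialDeriv i (fun y => g y 0 1) x :=
    partialDeriv_congr hU (fun y hy => hg.symm hy 1 0) x hx
  have hsg' := hg.symm hx 1 0
  simp only [smul_apply, add_apply, smul_eq_mul,
    ContinuousLinearMap.comp_apply, ContinuousLinearMap.coe_snd', ContinuousLinearMap.proj_apply,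
    (h0 i).1, (h0 i).2, (h1 i).1, (h1 i).2, Pi.zero_apply]
  constructor
  · have q00 := hdI 0 0
    have q01 := hdI 0 1
    have q10 := hdI 1 0
    have q11 := hdI 1 1
    rw [hsg, hsg'] at q10 q11
    linear_combination (1 / 2) * (v 0 * p 0 * q00 + v 0 * p 1 * q01 + v 1 * p 0 * q10
        + v 1 * p 1 * q11)
      + (1 / 2) * (partialDeriv i (fun y => (g y)⁻¹ 0 0) x * p 0
        + partialDeriv i (fun y => (g y)⁻¹ 0 1) x * p 1) * hp0
      + (1 / 2) * (partialDeriv i (fun y => (g y)⁻¹ 1 0) x * p 0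
        + partialDeriv i (fun y => (g y)⁻¹ 1 1) x * p 1) * hp1
      - (1 / 2) * (v 0 * partialDeriv i (fun y => g y 0 0) x
        + v 1 * partialDeriv i (fun y => g y 0 1) x) * hv0
      - (1 / 2) * (v 0 * partialDeriv i (fun y => g y 0 1) x
        + v 1 * partialDeriv i (fun y => g y 1 1) x) * hv1
  · rw [← congrFun hv i]
    obtain rfl | rfl : i = 0 ∨ i = 1 := by omega
    all_goals
      simp [mulVec_apply_two, hsI]
      ring

/-- The Poisson bracket of a linear function of momenta with the Hamiltonian is the quadratic form
of the symmetrized covariant derivative. -/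
lemma bracket_linear (hU : IsOpen U) (hg : IsRiemannianMetricOn g U) {x : Plane} (hx : x ∈ U)
    {c : Plane → Matrix (Fin 2) (Fin 2) ℝ} {a : Fin 2}
    (hc : ∀ j, DifferentiableAt ℝ (fun y => c y a j) x) (v : Plane) :
    (partialDeriv 0 (fun y => c y a 0) x * (g x *ᵥ v) 0
        + partialDeriv 0 (fun y => c y a 1) x * (g x *ᵥ v) 1) * v 0
      + (partialDeriv 1 (fun y => c y a 0) x * (g x *ᵥ v) 0
        + partialDeriv 1 (fun y => c y a 1) x * (g x *ᵥ v) 1) * v 1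
      + (c x a 0 * (1 / 2 * (partialDeriv 0 (fun y => g y 0 0) x * v 0 * v 0
        + 2 * (partialDeriv 0 (fun y => g y 0 1) x * v 0 * v 1)
        + partialDeriv 0 (fun y => g y 1 1) x * v 1 * v 1))
      + c x a 1 * (1 / 2 * (partialDeriv 1 (fun y => g y 0 0) x * v 0 * v 0
        + 2 * (partialDeriv 1 (fun y => g y 0 1) x * v 0 * v 1)
        + partialDeriv 1 (fun y => g y 1 1) x * v 1 * v 1)))
      = covDer g c a 0 0 x * v 0 * v 0 + (covDer g c a 0 1 x + covDer g c a 1 0 x) * v 0 * v 1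
        + covDer g c a 1 1 x * v 1 * v 1 := by
  have dg : ∀ i j, DifferentiableAt ℝ (fun y => g y i j) x := fun i j =>
    differentiableAt_of_contDiffOn hU (hg.smooth i j) hx
  have hN : ∀ i j, partialDeriv i (fun y => coframe g c y a j) x
      = c x a 0 * partialDeriv i (fun y => g y 0 j) x
        + g x 0 j * partialDeriv i (fun y => c y a 0) x
        + (c x a 1 * partialDeriv i (fun y => g y 1 j) x
        + g x 1 j * partialDeriv i (fun y => c y a 1) x) := by
    intro i j
    simp only [coframe_apply]
    exact partialDeriv_mul_add_mul (hc 0) (dg 0 j) (hc 1) (dg 1 j)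
  have hsg : ∀ i, partialDeriv i (fun y => g y 1 0) x = partialDeriv i (fun y => g y 0 1) x :=
    fun i => partialDeriv_congr hU (fun y hy => hg.symm hy 1 0) x hx
  have k := sum_metric_mul_christoffel hg hx
  have k000 := k 0 0 0
  have k001 := k 0 0 1
  have k011 := k 0 1 1
  have k100 := k 1 0 0
  have k101 := k 1 0 1
  have k111 := k 1 1 1
  have ks : ∀ k, christoffel g k 1 0 x = christoffel g k 0 1 x := fun k =>
    christoffel_symm hU hg hx k 1 0
  have hsg' := hg.symm hx 1 0
  simp only [hsg, hsg'] at k000 k001 k011 k100 k101 k111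
  simp only [covDer, hN, hsg]
  simp only [coframe_apply, ks, hsg', mulVec_apply_two]
  linear_combination c x a 0 * (v 0 * v 0 * k000 + 2 * v 0 * v 1 * k001 + v 1 * v 1 * k011)
    + c x a 1 * (v 0 * v 0 * k100 + 2 * v 0 * v 1 * k101 + v 1 * v 1 * k111)

/-- The symmetrized covariant derivative of the `a`-th form of the coframe on the vector `v`. -/
def symDer (g c : Plane → Matrix (Fin 2) (Fin 2) ℝ) (a : Fin 2) (x v : Plane) : ℝ :=
  covDer g c a 0 0 x * v 0 * v 0 + (covDer g c a 0 1 x + covDer g c a 1 0 x) * v 0 * v 1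
    + covDer g c a 1 1 x * v 1 * v 1

/-- At the point with velocity `v`, the bracket of a fractional-linear function with the
Hamiltonian is a cubic form in `v` divided by the square of the denominator. -/
lemma poissonBracket_eq (hU : IsOpen U) (hg : IsRiemannianMetricOn g U) {x : Plane} (hx : x ∈ U)
    {c : Plane → Matrix (Fin 2) (Fin 2) ℝ}
    (hc : ∀ a j, DifferentiableAt ℝ (fun y => c y a j) x) (v : Plane)
    (hD : (coframe g c x *ᵥ v) 1 ≠ 0) :
    poissonBracket (fracLin c) (hamiltonian g) (x, g x *ᵥ v)
      = (symDer g c 0 x v * (coframe g c x *ᵥ v) 1 - (coframe g c x *ᵥ v) 0 * symDer g c 1 x v)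
        / (coframe g c x *ᵥ v) 1 ^ 2 := by
  have hm : coframe g c x *ᵥ v = c x *ᵥ (g x *ᵥ v) := by rw [coframe, Matrix.mulVec_mulVec]
  rw [hm] at hD ⊢
  have b0 := bracket_linear hU hg hx (hc 0) v
  have b1 := bracket_linear hU hg hx (hc 1) v
  have hH := fderiv_hamiltonian hU hg hx v
  rw [← symDer] at b0 b1
  set p := g x *ᵥ v
  obtain ⟨L0, hL0, h0⟩ := hasFDerivAt_linear_in_momenta (p := p) (hc 0 0) (hc 0 1)
  obtain ⟨L1, hL1, h1⟩ := hasFDerivAt_linear_in_momenta (p := p) (hc 1 0) (hc 1 1)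
  have hcp : ∀ a (z : Plane × Plane), (c z.1 *ᵥ z.2) a = c z.1 a 0 * z.2 0 + c z.1 a 1 * z.2 1 := by
    exact fun a z => mulVec_apply_two _ _ _
  have hF : HasFDerivAt (fracLin c)
      (((c x *ᵥ p) 1 ^ 2)⁻¹ • ((c x *ᵥ p) 1 • L0 - (c x *ᵥ p) 0 • L1)) (x, p) := by
    have h : fracLin c = fun z => (c z.1 0 0 * z.2 0 + c z.1 0 1 * z.2 1)
        / (c z.1 1 0 * z.2 0 + c z.1 1 1 * z.2 1) := by
      funext z
      rw [fracLin, denom, hcp, hcp]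
    rw [h]
    have hD' := hD
    have e0 := hcp 0 (x, p)
    have e1 := hcp 1 (x, p)
    simp only at e0 e1
    rw [e1] at hD'
    rw [e0, e1]
    have hinv := (hasDerivAt_inv hD').comp_hasFDerivAt (x, p) hL1
    convert! hL0.mul hinv using 1
    ext z
    · simp
      field_simp
      ring
    · simp
      field_simp
      ring
  rw [poissonBracket, hF.fderiv, Fin.sum_univ_two]
  simp only [smul_apply, sub_apply, smul_eq_mul,
    (h0 _).1, (h0 _).2, (h1 _).1, (h1 _).2, (hH _).1, (hH _).2]
  rw [← b0, ← b1]
  simp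
  ring

end IntegralCoframe

/-! ### The first-order equations of an integral -/

section FirstOrder

variable {U : Set Plane} {g : Plane → Matrix (Fin 2) (Fin 2) ℝ}

/-- A binary cubic form that vanishes wherever a given nonzero linear form does not is zero. -/
lemma cubic_eq_zero {q0 q1 q2 q3 n0 n1 : ℝ} (hn : n0 ≠ 0 ∨ n1 ≠ 0)
    (h : ∀ s t : ℝ, n0 * s + n1 * t ≠ 0 →
      q0 * s * s * s + q1 * s * s * t + q2 * s * t * t + q3 * t * t * t = 0) :
    q0 = 0 ∧ q1 = 0 ∧ q2 = 0 ∧ q3 = 0 := by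
  -- the quartic form obtained by multiplication with the linear form vanishes everywhere
  have h' : ∀ s t : ℝ, (n0 * s + n1 * t) *
      (q0 * s * s * s + q1 * s * s * t + q2 * s * t * t + q3 * t * t * t) = 0 := by
    intro s t
    by_cases hst : n0 * s + n1 * t = 0
    · rw [hst, zero_mul]
    · rw [h s t hst, mul_zero]
  have a0 := h' 1 0
  have a1 := h' 0 1
  have a2 := h' 1 1
  have a3 := h' 1 (-1)
  have a4 := h' 1 2
  have e0 : n0 * q0 = 0 := by linear_combination a0
  have e4 : n1 * q3 = 0 := by linear_combination a1
  have e2 : n0 * q2 + n1 * q1 = 0 := by linear_combination (a2 + a3) / 2 - a0 - a1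
  have e13 : n0 * q3 + n1 * q2 + (n0 * q1 + n1 * q0) = 0 := by linear_combination (a2 - a3) / 2
  have e3 : n0 * q3 + n1 * q2 = 0 := by
    linear_combination a4 / 6 - e0 / 6 - 16 / 6 * e4 - 4 / 6 * e2 - 2 / 6 * e13
  have e1 : n0 * q1 + n1 * q0 = 0 := by linear_combination e13 - e3
  rcases hn with hn | hn
  · have z0 : q0 = 0 := by simpa [hn] using e0
    have z1 : q1 = 0 := by simpa [hn, z0] using e1
    have z2 : q2 = 0 := by simpa [hn, z1] using e2
    have z3 : q3 = 0 := by simpa [hn, z2] using e3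
    exact ⟨z0, z1, z2, z3⟩
  · have z3 : q3 = 0 := by simpa [hn] using e4
    have z2 : q2 = 0 := by simpa [hn, z3] using e3
    have z1 : q1 = 0 := by simpa [hn, z2] using e2
    have z0 : q0 = 0 := by simpa [hn, z1] using e1
    exact ⟨z0, z1, z2, z3⟩

lemma det_coframe_ne_zero (hg : IsRiemannianMetricOn g U) {x : Plane} (hx : x ∈ U)
    {c : Plane → Matrix (Fin 2) (Fin 2) ℝ} (hc : (c x).det ≠ 0) : (coframe g c x).det ≠ 0 := by
  rw [coframe, Matrix.det_mul]
  exact mul_ne_zero hc (hg.det_ne_zero hx)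

lemma covDer_eq_connForm (c : Plane → Matrix (Fin 2) (Fin 2) ℝ) {x : Plane}
    (hN : (coframe g c x).det ≠ 0) (a i j : Fin 2) :
    covDer g c a i j x = coframe g c x a 0 * connForm g c 0 i j x
      + coframe g c x a 1 * connForm g c 1 i j x := by
  have h : ∀ b, coframe g c x a 0 * (coframe g c x)⁻¹ 0 b
      + coframe g c x a 1 * (coframe g c x)⁻¹ 1 b = (1 : Matrix (Fin 2) (Fin 2) ℝ) a b := by
    intro b
    rw [← Matrix.mul_nonsing_inv _ hN.isUnit, Matrix.mul_apply, Fin.sum_univ_two]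
  have h0 := h 0
  have h1 := h 1
  simp only [connForm]
  obtain rfl | rfl : a = 0 ∨ a = 1 := by omega
  all_goals
    simp at h0 h1
    linear_combination -covDer g c 0 i j x * h0 - covDer g c 1 i j x * h1

lemma connForm_eq (c : Plane → Matrix (Fin 2) (Fin 2) ℝ) {x : Plane}
    (hN : (coframe g c x).det ≠ 0) {κ υ : Fin 2 → ℝ}
    (h : ∀ a i j, covDer g c a i j x
      = κ i * coframe g c x a j + υ j * coframe g c x a i) (k i j : Fin 2) :
    connForm g c k i j x = κ i * (1 : Matrix (Fin 2) (Fin 2) ℝ) k j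
      + υ j * (1 : Matrix (Fin 2) (Fin 2) ℝ) k i := by
  rw [← Matrix.nonsing_inv_mul _ hN.isUnit, Matrix.mul_apply, Matrix.mul_apply,
    Fin.sum_univ_two, Fin.sum_univ_two, connForm, h, h]
  ring

/-- The `1`-form `υ` is determined by the shape of the covariant derivative of the coframe. -/
lemma upsilon_eq_of_covDer (c : Plane → Matrix (Fin 2) (Fin 2) ℝ) {x : Plane}
    (hN : (coframe g c x).det ≠ 0) {κ υ : Fin 2 → ℝ}
    (h : ∀ a i j, covDer g c a i j x
      = κ i * coframe g c x a j + υ j * coframe g c x a i) (j : Fin 2) :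
    upsilon g c j x = υ j := by
  have := connForm_eq c hN h
  obtain rfl | rfl : j = 0 ∨ j = 1 := by omega
  all_goals simp [upsilon, this]

/-- A fractional-linear function is an integral exactly when the covariant derivative of its
coframe has the form `∇_i N_j = κ_i N_j + υ_j N_i`; this is the forward direction. -/
lemma IsIntegralOn.covDer_eq {W : Set Plane} {c : Plane → Matrix (Fin 2) (Fin 2) ℝ}
    (hc : IsIntegralOn g W c) (hU : IsOpen U) (hg : IsRiemannianMetricOn g U) (hW : IsOpen W)
    (hWU : W ⊆ U) {x : Plane} (hx : x ∈ W) (a i j : Fin 2) :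
    covDer g c a i j x
      = kappa g c i x * coframe g c x a j + upsilon g c j x * coframe g c x a i := by
  have hN := det_coframe_ne_zero hg (hWU hx) (hc.det_ne_zero x hx)
  have dc : ∀ a j, DifferentiableAt ℝ (fun y => c y a j) x := fun a j =>
    differentiableAt_of_contDiffOn hW (hc.smooth a j) hx
  have hS := covDer_eq_connForm c hN
  have hN' := hN
  rw [Matrix.det_fin_two] at hN'
  have hn : coframe g c x 1 0 ≠ 0 ∨ coframe g c x 1 1 ≠ 0 := by
    by_contra! h
    simp [h.1, h.2] at hN'
  -- the numerator of the bracket is the determinant of the coframe times the cubic form with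
  -- these coefficients
  have hcub : -connForm g c 1 0 0 x = 0 ∧
      connForm g c 0 0 0 x - (connForm g c 1 0 1 x + connForm g c 1 1 0 x) = 0 ∧
      connForm g c 0 0 1 x + connForm g c 0 1 0 x - connForm g c 1 1 1 x = 0 ∧
      connForm g c 0 1 1 x = 0 := by
    refine cubic_eq_zero hn fun s t hst => ?_
    have hD : (coframe g c x *ᵥ ![s, t]) 1 ≠ 0 := by
      rw [mulVec_apply_two]
      simpa using hst
    have hb := poissonBracket_eq hU hg (hWU hx) dc ![s, t] hD
    rw [hc.bracket_eq_zero x hx _ (by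
      have : denom c (x, g x *ᵥ ![s, t]) = (coframe g c x *ᵥ ![s, t]) 1 := by
        rw [denom, coframe, Matrix.mulVec_mulVec]
      rwa [this])] at hb
    have hb' := (div_eq_zero_iff.1 hb.symm).resolve_right (pow_ne_zero _ hD)
    refine (mul_eq_zero.1 ?_).resolve_left hN'
    simp only [symDer, mulVec_apply_two, hS, Matrix.cons_val_zero, Matrix.cons_val_one] at hb'
    linear_combination hb'
  obtain ⟨e0, e1, e2, e3⟩ := hcub
  rw [hS]
  obtain rfl | rfl : i = 0 ∨ i = 1 := by omega
  all_goals
    obtain rfl | rfl : j = 0 ∨ j = 1 := by omega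
    all_goals simp [kappa, upsilon]
  · linear_combination -coframe g c x a 1 * e0 + coframe g c x a 0 * e1
  · ring
  · ring
  · linear_combination -coframe g c x a 1 * e2 + coframe g c x a 0 * e3

/-- A coframe whose symmetrized covariant derivatives are multiples of the coframe, by the same
linear form, comes from an integral. -/
lemma isIntegralOn_of_symDer (hU : IsOpen U) (hg : IsRiemannianMetricOn g U) {W : Set Plane}
    (hW : IsOpen W) (hWU : W ⊆ U) {c : Plane → Matrix (Fin 2) (Fin 2) ℝ}
    (hs : ∀ i j, ContDiffOn ℝ ∞ (fun x => c x i j) W) (hdet : ∀ x ∈ W, (c x).det ≠ 0)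
    (h : ∀ x ∈ W, ∀ v, ∃ l : ℝ, ∀ a, symDer g c a x v = l * (coframe g c x *ᵥ v) a) :
    IsIntegralOn g W c := by
  refine ⟨hs, hdet, fun x hx p hp => ?_⟩
  have hpv : p = g x *ᵥ ((g x)⁻¹ *ᵥ p) := by
    rw [Matrix.mulVec_mulVec, Matrix.mul_nonsing_inv _ (hg.det_ne_zero (hWU hx)).isUnit,
      Matrix.one_mulVec]
  obtain ⟨l, hl⟩ := h x hx ((g x)⁻¹ *ᵥ p)
  rw [hpv, poissonBracket_eq hU hg (hWU hx)
    (fun a j => differentiableAt_of_contDiffOn hW (hs a j) hx), hl, hl]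
  · ring
  · rw [coframe, ← Matrix.mulVec_mulVec, ← hpv]
    exact hp

/-! ### Smooth dependence on parameters -/

section Parameters

variable {E : Type*} [NormedAddCommGroup E] [NormedSpace ℝ E] {O : Set E} {W : Set Plane}

lemma contDiffOn_partialDeriv_param (hO : IsOpen O) (hW : IsOpen W) {f : E → Plane → ℝ}
    (hf : ContDiffOn ℝ ∞ (fun z : E × Plane => f z.1 z.2) (O ×ˢ W)) (i : Fin 2) :
    ContDiffOn ℝ ∞ (fun z : E × Plane => partialDeriv i (f z.1) z.2) (O ×ˢ W) := by
  have h : ContDiffOn ℝ ∞ (fun z => fderiv ℝ (fun z : E × Plane => f z.1 z.2) z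
      ((0, Pi.single i 1) : E × Plane)) (O ×ˢ W) :=
    (hf.fderiv_of_isOpen (hO.prod hW) (by simp)).clm_apply contDiffOn_const
  refine h.congr fun z hz => ?_
  have hd := differentiableAt_of_contDiffOn (hO.prod hW) hf hz
  have hi : HasFDerivAt (fun x : Plane => ((z.1, x) : E × Plane))
      (ContinuousLinearMap.inr ℝ E Plane) z.2 := hasFDerivAt_prodMk_right z.1 z.2
  have hcomp : HasFDerivAt (f z.1) _ z.2 := HasFDerivAt.comp z.2
    (g := fun z : E × Plane => f z.1 z.2) hd.hasFDerivAt hi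
  rw [partialDeriv, hcomp.fderiv]
  simp

variable {c : E → Plane → Matrix (Fin 2) (Fin 2) ℝ}

/-- Half the exterior derivative of `υ`. -/
def mu (g c : Plane → Matrix (Fin 2) (Fin 2) ℝ) (x : Plane) : ℝ :=
  1 / 2 * (partialDeriv 0 (upsilon g c 1) x - partialDeriv 1 (upsilon g c 0) x)

lemma contDiffOn_connForm_param (hU : IsOpen U) (hg : IsRiemannianMetricOn g U) (hO : IsOpen O)
    (hW : IsOpen W) (hWU : W ⊆ U)
    (hc : ∀ i j, ContDiffOn ℝ ∞ (fun z : E × Plane => c z.1 z.2 i j) (O ×ˢ W))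
    (hdet : ∀ t ∈ O, ∀ x ∈ W, (c t x).det ≠ 0) (k i j : Fin 2) :
    ContDiffOn ℝ ∞ (fun z : E × Plane => connForm g (c z.1) k i j z.2) (O ×ˢ W) := by
  have lift : ∀ {f : Plane → ℝ}, ContDiffOn ℝ ∞ f U →
      ContDiffOn ℝ ∞ (fun z : E × Plane => f z.2) (O ×ˢ W) := fun hf =>
    (hf.mono hWU).comp contDiffOn_snd fun z hz => hz.2
  have hN : ∀ a j, ContDiffOn ℝ ∞ (fun z : E × Plane => coframe g (c z.1) z.2 a j) (O ×ˢ W) := by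
    intro a j
    simp only [coframe_apply]
    exact ((hc a 0).mul (lift (hg.smooth 0 j))).add ((hc a 1).mul (lift (hg.smooth 1 j)))
  have hI := contDiffOn_inv_apply (M := fun z : E × Plane => coframe g (c z.1) z.2) hN
    fun z hz => det_coframe_ne_zero hg (hWU hz.2) (hdet z.1 hz.1 z.2 hz.2)
  have hS : ∀ a, ContDiffOn ℝ ∞ (fun z : E × Plane => covDer g (c z.1) a i j z.2) (O ×ˢ W) := by
    intro a
    exact (contDiffOn_partialDeriv_param hO hW (f := fun t y => coframe g (c t) y a j)
      (hN a j) i).sub (((lift (contDiffOn_christoffel hU hg 0 i j)).mul (hN a 0)).add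
        ((lift (contDiffOn_christoffel hU hg 1 i j)).mul (hN a 1)))
  exact ((hI k 0).mul (hS 0)).add ((hI k 1).mul (hS 1))

lemma contDiffOn_upsilon_param (hU : IsOpen U) (hg : IsRiemannianMetricOn g U) (hO : IsOpen O)
    (hW : IsOpen W) (hWU : W ⊆ U)
    (hc : ∀ i j, ContDiffOn ℝ ∞ (fun z : E × Plane => c z.1 z.2 i j) (O ×ˢ W))
    (hdet : ∀ t ∈ O, ∀ x ∈ W, (c t x).det ≠ 0) (j : Fin 2) :
    ContDiffOn ℝ ∞ (fun z : E × Plane => upsilon g (c z.1) j z.2) (O ×ˢ W) := by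
  have h := contDiffOn_connForm_param hU hg hO hW hWU hc hdet
  obtain rfl | rfl : j = 0 ∨ j = 1 := by omega
  · exact h 1 1 0
  · exact h 0 0 1

lemma contDiffOn_kappa_param (hU : IsOpen U) (hg : IsRiemannianMetricOn g U) (hO : IsOpen O)
    (hW : IsOpen W) (hWU : W ⊆ U)
    (hc : ∀ i j, ContDiffOn ℝ ∞ (fun z : E × Plane => c z.1 z.2 i j) (O ×ˢ W))
    (hdet : ∀ t ∈ O, ∀ x ∈ W, (c t x).det ≠ 0) (i : Fin 2) :
    ContDiffOn ℝ ∞ (fun z : E × Plane => kappa g (c z.1) i z.2) (O ×ˢ W) := by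
  have h := contDiffOn_connForm_param hU hg hO hW hWU hc hdet
  obtain rfl | rfl : i = 0 ∨ i = 1 := by omega
  · exact h 1 0 1
  · exact h 0 1 0

lemma contDiffOn_mu_param (hU : IsOpen U) (hg : IsRiemannianMetricOn g U) (hO : IsOpen O)
    (hW : IsOpen W) (hWU : W ⊆ U)
    (hc : ∀ i j, ContDiffOn ℝ ∞ (fun z : E × Plane => c z.1 z.2 i j) (O ×ˢ W))
    (hdet : ∀ t ∈ O, ∀ x ∈ W, (c t x).det ≠ 0) :
    ContDiffOn ℝ ∞ (fun z : E × Plane => mu g (c z.1) z.2) (O ×ˢ W) := by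
  have h := contDiffOn_upsilon_param hU hg hO hW hWU hc hdet
  exact contDiffOn_const.mul
    ((contDiffOn_partialDeriv_param hO hW (f := fun t => upsilon g (c t) 1) (h 1) 0).sub
      (contDiffOn_partialDeriv_param hO hW (f := fun t => upsilon g (c t) 0) (h 0) 1))

/-- A function that is smooth on `W` when regarded as a constant family is smooth on `W`. -/
lemma contDiffOn_of_param {f : Plane → ℝ}
    (hf : ContDiffOn ℝ ∞ (fun z : ℝ × Plane => f z.2) (Set.univ ×ˢ W)) : ContDiffOn ℝ ∞ f W :=
  hf.comp (f := fun x => ((0 : ℝ), x)) (contDiffOn_const.prodMk contDiffOn_id)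
    fun _ hx => ⟨trivial, hx⟩

lemma IsIntegralOn.contDiffOn_upsilon {c : Plane → Matrix (Fin 2) (Fin 2) ℝ}
    (hc : IsIntegralOn g W c) (hU : IsOpen U) (hg : IsRiemannianMetricOn g U) (hW : IsOpen W)
    (hWU : W ⊆ U) (j : Fin 2) : ContDiffOn ℝ ∞ (upsilon g c j) W :=
  contDiffOn_of_param (contDiffOn_upsilon_param (c := fun _ => c) hU hg isOpen_univ hW hWU
    (fun i j => (hc.smooth i j).comp contDiffOn_snd fun _ hz => hz.2)
    (fun _ _ => hc.det_ne_zero) j)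

lemma IsIntegralOn.contDiffOn_kappa {c : Plane → Matrix (Fin 2) (Fin 2) ℝ}
    (hc : IsIntegralOn g W c) (hU : IsOpen U) (hg : IsRiemannianMetricOn g U) (hW : IsOpen W)
    (hWU : W ⊆ U) (i : Fin 2) : ContDiffOn ℝ ∞ (kappa g c i) W :=
  contDiffOn_of_param (contDiffOn_kappa_param (c := fun _ => c) hU hg isOpen_univ hW hWU
    (fun i j => (hc.smooth i j).comp contDiffOn_snd fun _ hz => hz.2)
    (fun _ _ => hc.det_ne_zero) i)

lemma IsIntegralOn.contDiffOn_mu {c : Plane → Matrix (Fin 2) (Fin 2) ℝ}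
    (hc : IsIntegralOn g W c) (hU : IsOpen U) (hg : IsRiemannianMetricOn g U) (hW : IsOpen W)
    (hWU : W ⊆ U) : ContDiffOn ℝ ∞ (mu g c) W :=
  contDiffOn_of_param (contDiffOn_mu_param (c := fun _ => c) hU hg isOpen_univ hW hWU
    (fun i j => (hc.smooth i j).comp contDiffOn_snd fun _ hz => hz.2)
    (fun _ _ => hc.det_ne_zero))

end Parameters

end FirstOrder

/-! ### Unique continuation -/

section Continuation

variable {W : Opens Plane}

lemma smoothDeriv_apply (f : smoothFn W) (i : Fin 2) (x : W) :
    (smoothDeriv W i f).1 x = partialDeriv i (extendZero f) x := rfl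

lemma extendZero_apply (f : smoothFn W) (x : W) : extendZero f x = f.1 x := by
  simp [extendZero]

lemma continuous_smoothFn (f : smoothFn W) : Continuous f.1 := by
  have h := (contDiffOn_extendZero f).continuousOn
  rw [continuousOn_iff_continuous_domRestrict] at h
  convert! h using 1
  funext x
  exact (extendZero_apply f x).symm

/-- A solution of a linear total differential system on a convex open set that vanishes at one
point vanishes identically. -/
lemma eq_zero_of_linear_system (hW : Convex ℝ (W : Set Plane)) {n : ℕ} (f : Fin n → smoothFn W)
    (h : ∀ i a, ∃ M : Fin n → smoothFn W, smoothDeriv W i (f a) = ∑ b, M b * f b)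
    {y : W} (hy : ∀ a, (f a).1 y = 0) (a : Fin n) : f a = 0 := by
  choose M hM using h
  -- along a segment this is a linear system of ordinary differential equations
  rw [smoothFn_ext_iff]
  intro x
  have hseg : ∀ t ∈ Set.Icc (0 : ℝ) 1, y.1 + t • (x.1 - y.1) ∈ W := fun t ht =>
    hW.add_smul_sub_mem y.2 x.2 ht
  set v := x.1 - y.1 with hv
  set γ : ℝ → Plane := fun t => y.1 + t • v with hγ
  have hγd : ∀ t, HasDerivAt γ v t := fun t => by
    have := ((hasDerivAt_id t).smul_const v).const_add y.1
    rw [one_smul] at this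
    exact this
  have hγc : Continuous γ := continuous_iff_continuousAt.2 fun t => (hγd t).continuousAt
  set F : ℝ → Fin n → ℝ := fun t a => extendZero (f a) (γ t) with hF
  set A : Fin n → Fin n → ℝ → ℝ := fun a b t =>
    v 0 * extendZero (M 0 a b) (γ t) + v 1 * extendZero (M 1 a b) (γ t) with hA
  have hext : ∀ φ : smoothFn W, ContinuousOn (fun t => extendZero φ (γ t)) (Set.Icc 0 1) :=
    fun φ => (contDiffOn_extendZero φ).continuousOn.comp hγc.continuousOn hseg
  have hAc : ContinuousOn (fun t => ∑ a, ∑ b, |A a b t|) (Set.Icc 0 1) := by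
    refine continuousOn_finsetSum _ fun a _ => continuousOn_finsetSum _ fun b _ => ?_
    exact ((continuousOn_const.mul (hext _)).add (continuousOn_const.mul (hext _))).abs
  obtain ⟨K, hK⟩ := isCompact_Icc.bddAbove_image hAc
  have hFd : ∀ t ∈ Set.Icc (0 : ℝ) 1, HasDerivAt F (fun a => ∑ b, A a b t * F t b) t := by
    intro t ht
    rw [hasDerivAt_pi]
    intro a
    have hd : HasFDerivAt (extendZero (f a)) _ (γ t) := (differentiableAt_of_contDiffOn W.isOpen
      (contDiffOn_extendZero (f a)) (hseg t ht)).hasFDerivAt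
    refine (hd.comp_hasDerivAt t (hγd t)).congr_deriv ?_
    rw [fderiv_eq_sum_partialDeriv]
    have hp : ∀ i, partialDeriv i (extendZero (f a)) (γ t)
        = ∑ b, extendZero (M i a b) (γ t) * F t b := by
      intro i
      have h1 := smoothDeriv_apply (f a) i ⟨γ t, hseg t ht⟩
      rw [← h1, hM]
      have h2 : ∀ φ : smoothFn W, φ.1 ⟨γ t, hseg t ht⟩ = extendZero φ (γ t) := fun φ =>
        (extendZero_apply φ ⟨γ t, hseg t ht⟩).symm
      simp [hF, ← h2]
    have : y.1 + t • v = γ t := rfl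
    rw [this, hp, hp, Finset.mul_sum, Finset.mul_sum, ← Finset.sum_add_distrib]
    exact Finset.sum_congr rfl fun b _ => by simp only [hA]; ring
  have hz := eq_zero_of_abs_deriv_le_mul_abs_self_of_eq_zero_right (f := F) (K := K) (a := 0)
    (b := 1) (f' := fun t a => ∑ b, A a b t * F t b)
    (fun t ht => (hFd t ht).continuousAt.continuousWithinAt)
    (fun t ht => (hFd t (Set.Ico_subset_Icc_self ht)).hasDerivWithinAt)
    (by
      ext a
      simp only [hF, hγ, zero_smul, add_zero, extendZero_apply, hy, Pi.zero_apply])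
    (fun t ht => by
      have hKt : ∑ a, ∑ b, |A a b t| ≤ K :=
        hK (Set.mem_image_of_mem _ (Set.Ico_subset_Icc_self ht))
      have hle : ∀ a, ∑ b, |A a b t| ≤ K := fun a =>
        (Finset.single_le_sum (f := fun a => ∑ b, |A a b t|)
          (fun _ _ => Finset.sum_nonneg fun _ _ => abs_nonneg _) (Finset.mem_univ a)).trans hKt
      have hK0 : 0 ≤ K := (Finset.sum_nonneg fun _ _ => Finset.sum_nonneg fun _ _ =>
        abs_nonneg _).trans hKt
      refine (pi_norm_le_iff_of_nonneg (by positivity)).2 fun a => ?_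
      calc ‖∑ b, A a b t * F t b‖ ≤ ∑ b, |A a b t| * ‖F t‖ := by
            refine (norm_sum_le _ _).trans (Finset.sum_le_sum fun b _ => ?_)
            rw [norm_mul, Real.norm_eq_abs]
            exact mul_le_mul_of_nonneg_left (norm_le_pi_norm _ b) (abs_nonneg _)
        _ ≤ K * ‖F t‖ := by
            rw [← Finset.sum_mul]
            exact mul_le_mul_of_nonneg_right (hle a) (norm_nonneg _))
    1 (by simp)
  have := congrFun hz a
  simpa [hF, hγ, hv, extendZero_apply] using this

variable {g' : Fin 2 → Fin 2 → smoothFn W} {Γ : Fin 2 → Fin 2 → Fin 2 → smoothFn W}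
  {K : smoothFn W}

/-- A solution is determined by the values of `υ` and `μ` at one point. -/
lemma IsSolution.unique (hW : Convex ℝ (W : Set Plane))
    (h : IsLeviCivita (smoothDeriv W) g' Γ K) {υ υ' : Fin 2 → smoothFn W} {μ μ' : smoothFn W}
    (hs : IsSolution (smoothDeriv W) g' Γ K υ μ) (hs' : IsSolution (smoothDeriv W) g' Γ K υ' μ')
    {y : W} (h0 : (υ 0).1 y = (υ' 0).1 y) (h1 : (υ 1).1 y = (υ' 1).1 y) (hm : μ.1 y = μ'.1 y) :
    υ = υ' ∧ μ = μ' := by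
  obtain ⟨e00, e01, e0m, e10, e11, e1m⟩ := hs.d_sub h hs'
  have key := eq_zero_of_linear_system hW ![υ 0 - υ' 0, υ 1 - υ' 1, μ - μ'] (y := y) (by
    intro i a
    fin_cases i <;> fin_cases a
    · exact ⟨![_, _, _], by rw [Fin.sum_univ_three]; exact e00⟩
    · exact ⟨![_, _, _], by rw [Fin.sum_univ_three]; exact e01⟩
    · exact ⟨![_, _, _], by rw [Fin.sum_univ_three]; exact e0m⟩
    · exact ⟨![_, _, _], by rw [Fin.sum_univ_three]; exact e10⟩
    · exact ⟨![_, _, _], by rw [Fin.sum_univ_three]; exact e11⟩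
    · exact ⟨![_, _, _], by rw [Fin.sum_univ_three]; exact e1m⟩) (by
    simp [Fin.forall_fin_succ, h0, h1, hm])
  have k0 := key 0
  have k1 := key 1
  have k2 := key 2
  simp only [Matrix.cons_val_zero, Matrix.cons_val_one, Matrix.cons_val] at k0 k1 k2
  refine ⟨?_, sub_eq_zero.1 k2⟩
  ext j : 1
  obtain rfl | rfl : j = 0 ∨ j = 1 := by omega
  · exact sub_eq_zero.1 k0
  · exact sub_eq_zero.1 k1

end Continuation

/-! ### Countability of the solutions when the curvature is not constant -/

/-- A polynomial of degree six or four has finitely many roots; only the terms needed in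
`finite_adapted_values` are present. -/
lemma finite_sextic {c6 c4 c2 c1 c0 : ℝ} (h : c6 ≠ 0 ∨ c4 ≠ 0) :
    {m : ℝ | c6 * m ^ 6 + c4 * m ^ 4 + c2 * m ^ 2 + c1 * m + c0 = 0}.Finite := by
  open Polynomial in
  set p : ℝ[X] := C c6 * X ^ 6 + C c4 * X ^ 4 + C c2 * X ^ 2 + C c1 * X + C c0 with hp
  have hp0 : p ≠ 0 := by
    intro h0
    have h6 : p.coeff 6 = c6 := by
      simp [hp]
    have h4 : p.coeff 4 = c4 := by
      simp [hp]
    rw [h0, Polynomial.coeff_zero] at h6 h4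
    rcases h with h | h
    · exact h h6.symm
    · exact h h4.symm
  refine (Polynomial.finite_setOfPred_isRoot hp0).subset fun m hm => ?_
  simpa [hp, Polynomial.IsRoot] using hm

/-- The algebraic conditions on a solution at a point, in coordinates adapted to `lam`: all but
finitely many of the values permitted by them have the same `μ`. -/
lemma finite_adapted_values (N a b h a' b' h' : ℝ) {l : ℝ} (hl : l ≠ 0) :
    ∃ m₀ : ℝ, {z : ℝ × ℝ × ℝ | 6 * z.2.2 * z.2.2 + 3 * z.1 + N = 0 ∧
      z.1 * z.1 = a + b * z.1 + h * z.2.1 ∧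
      z.1 * z.2.1 = l * z.2.2 + a' + b' * z.1 + h' * z.2.1 ∧ z.2.2 ≠ m₀}.Finite := by
  refine ⟨-(a' + b' * h') / l, ?_⟩
  refine Set.Finite.of_finite_image (f := fun z : ℝ × ℝ × ℝ => z.2.2) ?_ ?_
  · -- `σ` is a quadratic polynomial in `μ`; eliminating `ρ` gives a polynomial equation for `μ`
    by_cases hh : h = 0
    · refine (finite_sextic (c6 := 0) (c4 := 4) (c2 := 4 * (N / 3) + 2 * b) (c1 := 0)
        (c0 := (N / 3) ^ 2 + b * (N / 3) - a) (Or.inr (by norm_num))).subset ?_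
      rintro _ ⟨⟨σ, ρ, μ⟩, ⟨h0, h1, -, -⟩, rfl⟩
      simp only [Set.mem_ofPred_eq] at *
      have hσ : σ = -2 * μ ^ 2 - N / 3 := by linear_combination h0 / 3
      rw [hh, hσ] at h1
      linear_combination h1
    · refine (finite_sextic (c6 := -8) (c4 := -12 * (N / 3) - 4 * (b + h'))
        (c2 := -6 * (N / 3) ^ 2 - 4 * (N / 3) * (b + h') - 2 * (h' * b - a - h * b'))
        (c1 := -h * l) (c0 := -(N / 3) ^ 3 - (b + h') * (N / 3) ^ 2
          - (h' * b - a - h * b') * (N / 3) + h' * a - h * a') (Or.inl (by norm_num))).subset ?_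
      rintro _ ⟨⟨σ, ρ, μ⟩, ⟨h0, h1, h2, -⟩, rfl⟩
      simp only [Set.mem_ofPred_eq] at *
      have hσ : σ = -2 * μ ^ 2 - N / 3 := by linear_combination h0 / 3
      rw [hσ] at h1 h2
      linear_combination (-2 * μ ^ 2 - N / 3 - h') * h1 + h * h2
  · rintro ⟨σ, ρ, μ⟩ ⟨h0, h1, h2, h3⟩ ⟨σ', ρ', μ'⟩ ⟨h0', h1', h2', -⟩ (hμ : μ = μ')
    simp only at *
    subst hμ
    have hσ : σ = σ' := by linear_combination (h0 - h0') / 3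
    subst hσ
    have hρ : ρ = ρ' := by
      by_cases hh : h = 0
      · have hne : σ - h' ≠ 0 := by
          intro hz
          apply h3
          rw [eq_div_iff hl]
          linear_combination ρ * hz - h2 - b' * hz
        apply mul_left_cancel₀ hne
        linear_combination h2 - h2'
      · apply mul_left_cancel₀ hh
        linear_combination h1' - h1
    rw [hρ]

/-- All but finitely many of the values of `(υ, μ)` permitted by the integrability conditions at
a point where `lam` does not vanish have the same `μ`. -/
lemma finite_values (N p0 q0 r0 p1 q1 r1 : ℝ) {l0 l1 : ℝ} (hl : l0 ≠ 0 ∨ l1 ≠ 0) :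
    ∃ m₀ : ℝ, {z : ℝ × ℝ × ℝ | 6 * z.2.2 * z.2.2 + 3 * (l0 * z.2.1 - l1 * z.1) + N = 0 ∧
      15 * (l0 * z.2.1 - l1 * z.1) * z.1
        = 15 * z.2.2 * l0 + (p0 + q0 * z.1 + r0 * z.2.1) ∧
      15 * (l0 * z.2.1 - l1 * z.1) * z.2.1
        = 15 * z.2.2 * l1 + (p1 + q1 * z.1 + r1 * z.2.1) ∧ z.2.2 ≠ m₀}.Finite := by
  have hpos : l0 * l0 + l1 * l1 ≠ 0 := by
    rcases hl with hl | hl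
    · exact (add_pos_of_pos_of_nonneg (mul_self_pos.2 hl) (mul_self_nonneg _)).ne'
    · exact (add_pos_of_nonneg_of_pos (mul_self_nonneg _) (mul_self_pos.2 hl)).ne'
  set l := l0 * l0 + l1 * l1 with hldef
  obtain ⟨m₀, hm⟩ := finite_adapted_values N ((l0 * p1 - l1 * p0) / 15)
    ((-(l0 * q1 - l1 * q0) * l1 + (l0 * r1 - l1 * r0) * l0) / (15 * l))
    (((l0 * q1 - l1 * q0) * l0 + (l0 * r1 - l1 * r0) * l1) / (15 * l))
    ((l0 * p0 + l1 * p1) / 15)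
    ((-(l0 * q0 + l1 * q1) * l1 + (l0 * r0 + l1 * r1) * l0) / (15 * l))
    (((l0 * q0 + l1 * q1) * l0 + (l0 * r0 + l1 * r1) * l1) / (15 * l)) hpos
  refine ⟨m₀, Set.Finite.of_finite_image (f := fun z : ℝ × ℝ × ℝ =>
    (l0 * z.2.1 - l1 * z.1, l0 * z.1 + l1 * z.2.1, z.2.2)) (hm.subset ?_) ?_⟩
  · rintro _ ⟨⟨x, y, m⟩, ⟨h0, h1, h2, h3⟩, rfl⟩
    simp only [Set.mem_ofPred_eq] at *
    refine ⟨h0, ?_, ?_, h3⟩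
    · field_simp
      rw [hldef]
      linear_combination (l0 * l0 + l1 * l1) * (l0 * h2 - l1 * h1)
    · field_simp
      rw [hldef]
      linear_combination (l0 * l0 + l1 * l1) * (l0 * h1 + l1 * h2)
  · rintro ⟨x, y, m⟩ - ⟨x', y', m'⟩ - h
    simp only [Prod.mk.injEq] at h
    obtain ⟨h0, h1, h2⟩ := h
    have hx : x = x' := by
      apply mul_left_cancel₀ hpos
      linear_combination l0 * h1 - l1 * h0
    have hy : y = y' := by
      apply mul_left_cancel₀ hpos
      linear_combination l1 * h1 + l0 * h0
    rw [hx, hy, h2]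

/-- The coefficients of `affinePart` as an affine expression in `υ`. -/
lemma affinePart_eq {R : Type*} [CommRing R] [Algebra ℝ R] (d : Fin 2 → Derivation ℝ R R)
    (g : Fin 2 → Fin 2 → R) (Γ : Fin 2 → Fin 2 → Fin 2 → R) (K : R) (j : Fin 2) :
    ∃ p q r : R, ∀ υ, affinePart d g Γ K υ j = p + q * υ 0 + r * υ 1 := by
  have hj : ∃ e0 e1 : R, ∀ υ : Fin 2 → R, υ j = e0 * υ 0 + e1 * υ 1 := by
    obtain rfl | rfl : j = 0 ∨ j = 1 := by omega
    · exact ⟨1, 0, fun υ => by ring⟩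
    · exact ⟨0, 1, fun υ => by ring⟩
  obtain ⟨e0, e1, he⟩ := hj
  refine ⟨-2 * source d g Γ K * (Γ 0 0 j + Γ 1 1 j)
      + 3 * (lam d g K 0 * (K * g j 1) - lam d g K 1 * (K * g j 0)) + d j (source d g Γ K),
    -6 * source d g Γ K * e0 + 6 * lam d g K 1 * (Γ 0 0 j + Γ 1 1 j)
      + 3 * (-d j (lam d g K 1) + lam d g K 0 * Γ 0 j 1 - lam d g K 1 * Γ 0 j 0),
    -6 * source d g Γ K * e1 - 6 * lam d g K 0 * (Γ 0 0 j + Γ 1 1 j)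
      + 3 * (d j (lam d g K 0) + lam d g K 0 * Γ 1 j 1 - lam d g K 1 * Γ 1 j 0), fun υ => ?_⟩
  rw [affinePart, he υ]
  ring

section

variable {W : Opens Plane}

lemma smoothDeriv_congr {f f' : smoothFn W} {V : Set W} (hV : IsOpen V)
    (h : ∀ y ∈ V, f.1 y = f'.1 y) (i : Fin 2) :
    ∀ y ∈ V, (smoothDeriv W i f).1 y = (smoothDeriv W i f').1 y := by
  intro y hy
  refine partialDeriv_congr (W.isOpen.isOpenMap_subtype_val V hV) ?_ y ⟨y, hy, rfl⟩
  rintro _ ⟨z, hz, rfl⟩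
  rw [extendZero_apply, extendZero_apply, h z hz]

variable {g' : Fin 2 → Fin 2 → smoothFn W} {Γ : Fin 2 → Fin 2 → Fin 2 → smoothFn W}
  {K : smoothFn W}

/-- If the curvature is not constant, the system has at most countably many solutions. At a point
where `lam ≠ 0`, all but finitely many solutions share the value of `μ`. Doing this at the points
of a countable dense set leaves, up to countably many, solutions that share the function `μ`; two
different ones would force `μ = 0` and then `lam = 0`. -/
theorem countable_solutions (hW : Convex ℝ (W : Set Plane))
    (h : IsLeviCivita (smoothDeriv W) g' Γ K)
    (hlam : ∃ y : W, (lam (smoothDeriv W) g' K 0).1 y ≠ 0 ∨ (lam (smoothDeriv W) g' K 1).1 y ≠ 0) :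
    {p : (Fin 2 → smoothFn W) × smoothFn W |
      IsSolution (smoothDeriv W) g' Γ K p.1 p.2}.Countable := by
  set l0 := lam (smoothDeriv W) g' K 0 with hl0
  set l1 := lam (smoothDeriv W) g' K 1 with hl1
  set V : Set W := {y | l0.1 y ≠ 0 ∨ l1.1 y ≠ 0} with hV
  have hVo : IsOpen V := (isOpen_ne_fun (continuous_smoothFn l0) continuous_const).union
    (isOpen_ne_fun (continuous_smoothFn l1) continuous_const)
  have hfin : ∀ y : W, ∃ m₀ : ℝ, y ∈ V → {p : (Fin 2 → smoothFn W) × smoothFn W |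
      IsSolution (smoothDeriv W) g' Γ K p.1 p.2 ∧ p.2.1 y ≠ m₀}.Finite := by
    intro y
    by_cases hy : y ∈ V
    · obtain ⟨p0, q0, r0, h0⟩ := affinePart_eq (smoothDeriv W) g' Γ K 0
      obtain ⟨p1, q1, r1, h1⟩ := affinePart_eq (smoothDeriv W) g' Γ K 1
      obtain ⟨m₀, hm⟩ := finite_values ((source (smoothDeriv W) g' Γ K).1 y) (p0.1 y) (q0.1 y)
        (r0.1 y) (p1.1 y) (q1.1 y) (r1.1 y) hy
      refine ⟨m₀, fun _ => Set.Finite.of_finite_image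
        (f := fun p => ((p.1 0).1 y, (p.1 1).1 y, p.2.1 y)) (hm.subset ?_) ?_⟩
      · rintro _ ⟨⟨υ, μ⟩, ⟨hs, hne⟩, rfl⟩
        have c := congrArg (fun f : smoothFn W => f.1 y) (hs.constraint h)
        have c0 := congrArg (fun f : smoothFn W => f.1 y) (hs.d_constraint h 0)
        have c1 := congrArg (fun f : smoothFn W => f.1 y) (hs.d_constraint h 1)
        rw [h0] at c0
        rw [h1] at c1
        exact ⟨c, c0, c1, hne⟩
      · rintro ⟨υ, μ⟩ ⟨hs, -⟩ ⟨υ', μ'⟩ ⟨hs', -⟩ heq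
        simp only [Prod.mk.injEq] at heq
        obtain ⟨e1, e2⟩ := IsSolution.unique hW h hs hs' heq.1 heq.2.1 heq.2.2
        exact Prod.ext e1 e2
    · exact ⟨0, fun h => absurd h hy⟩
  choose m₀ hm₀ using hfin
  obtain ⟨D, hDc, hDd⟩ := TopologicalSpace.exists_countable_dense W
  set G : Set ((Fin 2 → smoothFn W) × smoothFn W) :=
    {p | IsSolution (smoothDeriv W) g' Γ K p.1 p.2 ∧ ∀ y ∈ V ∩ D, p.2.1 y = m₀ y} with hG
  have hcover : {p : (Fin 2 → smoothFn W) × smoothFn W |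
      IsSolution (smoothDeriv W) g' Γ K p.1 p.2} ⊆ (⋃ y ∈ V ∩ D, {p |
      IsSolution (smoothDeriv W) g' Γ K p.1 p.2 ∧ p.2.1 y ≠ m₀ y}) ∪ G := by
    intro p hp
    by_cases hgood : ∀ y ∈ V ∩ D, p.2.1 y = m₀ y
    · exact Or.inr ⟨hp, hgood⟩
    · push Not at hgood
      obtain ⟨y, hy, hne⟩ := hgood
      exact Or.inl (Set.mem_biUnion hy ⟨hp, hne⟩)
  have hGs : G.Subsingleton := by
    rintro ⟨υ, μ⟩ ⟨hs, hgood⟩ ⟨υ', μ'⟩ ⟨hs', hgood'⟩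
    by_contra hne
    have hμ : ∀ y ∈ V, μ.1 y = μ'.1 y := by
      have hcl : IsClosed {y | μ.1 y = μ'.1 y} :=
        isClosed_eq (continuous_smoothFn μ) (continuous_smoothFn μ')
      intro y hy
      have hsub : V ∩ D ⊆ {y | μ.1 y = μ'.1 y} := fun y hy =>
        (hgood y hy).trans (hgood' y hy).symm
      exact closure_minimal hsub hcl (hDd.open_subset_closure_inter hVo hy)
    obtain ⟨m0, m1⟩ := hs.d_mu h
    obtain ⟨m0', m1'⟩ := hs'.d_mu h
    have hμ0 : ∀ y ∈ V, μ.1 y = (0 : smoothFn W).1 y := by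
      intro y hy
      have d0 := smoothDeriv_congr hVo hμ 0 y hy
      have d1 := smoothDeriv_congr hVo hμ 1 y hy
      rw [m0, m0'] at d0
      rw [m1, m1'] at d1
      have hy' := hμ y hy
      have h3 : (3 : smoothFn W).1 y = 3 := rfl
      have e0 : ((υ 0).1 y - (υ' 0).1 y) * μ.1 y = 0 := by
        simp at d0
        rw [← hy', h3] at d0
        linear_combination d0 / 3
      have e1 : ((υ 1).1 y - (υ' 1).1 y) * μ.1 y = 0 := by
        simp at d1
        rw [← hy', h3] at d1
        linear_combination d1 / 3
      by_contra hz
      have hz' : μ.1 y ≠ 0 := hz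
      obtain ⟨a, b⟩ := IsSolution.unique hW h hs hs'
        (sub_eq_zero.1 ((mul_eq_zero.1 e0).resolve_right hz'))
        (sub_eq_zero.1 ((mul_eq_zero.1 e1).resolve_right hz')) hy'
      exact hne (Prod.ext a b)
    obtain ⟨y, hy⟩ := hlam
    have hyV : y ∈ V := hy
    have d0 := smoothDeriv_congr hVo hμ0 0 y hyV
    have d1 := smoothDeriv_congr hVo hμ0 1 y hyV
    have hz := hμ0 y hyV
    rw [m0] at d0
    rw [m1] at d1
    simp at d0 d1 hz
    simp only [hz, mul_zero, zero_add] at d0 d1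
    rcases hy with hy | hy
    · exact hy d0
    · exact hy d1
  refine Set.Countable.mono hcover (Set.Countable.union ?_ hGs.countable)
  exact (hDc.mono Set.inter_subset_right).biUnion fun y hy => (hm₀ y hy.1).countable

end

/-! ### Integrals with the same `υ` differ by a projective transformation -/

section Transitions

section

variable {R : Type*} [CommRing R] [Algebra ℝ R] {d : Fin 2 → Derivation ℝ R R}
  {g : Fin 2 → Fin 2 → R} {Γ : Fin 2 → Fin 2 → Fin 2 → R} {K : R}

/-- The entries of `N' adj(N)`, where the coframes `N` and `N'` have the same `υ`, all satisfy the
same scalar differential equation. -/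
lemma IsLeviCivita.d_transition (h : IsLeviCivita d g Γ K) {N N' : Fin 2 → Fin 2 → R}
    {κ κ' υ : Fin 2 → R}
    (hN : ∀ a i j, d i (N a j) = Γ 0 i j * N a 0 + Γ 1 i j * N a 1 + κ i * N a j + υ j * N a i)
    (hN' : ∀ a i j,
      d i (N' a j) = Γ 0 i j * N' a 0 + Γ 1 i j * N' a 1 + κ' i * N' a j + υ j * N' a i)
    (a b e i : Fin 2) :
    d i (N' a b * N e (1 - b) - N' a (1 - b) * N e b)
      = (κ' i + κ i + Γ 0 i 0 + Γ 1 i 1 + υ i) * (N' a b * N e (1 - b) - N' a (1 - b) * N e b) := by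
  have tf := h.torsion_free
  obtain rfl | rfl : i = 0 ∨ i = 1 := by omega
  all_goals
    obtain rfl | rfl : b = 0 ∨ b = 1 := by omega
    all_goals
      simp only [Fin.isValue, sub_self, sub_zero, map_sub, Derivation.leibniz, smul_eq_mul, hN, hN',
        tf]
      ring

end

variable {U : Set Plane} {g : Plane → Matrix (Fin 2) (Fin 2) ℝ} {W : Opens Plane}

section

variable {c : Plane → Matrix (Fin 2) (Fin 2) ℝ}

lemma contDiffOn_coframe (hg : IsRiemannianMetricOn g U) (hWU : (W : Set Plane) ⊆ U)
    (hc : ∀ i j, ContDiffOn ℝ ∞ (fun x => c x i j) (W : Set Plane)) (a j : Fin 2) :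
    ContDiffOn ℝ ∞ (fun x => coframe g c x a j) (W : Set Plane) := by
  simp only [coframe_apply]
  exact ((hc a 0).mul ((hg.smooth 0 j).mono hWU)).add ((hc a 1).mul ((hg.smooth 1 j).mono hWU))

/-- The coframe in the ring of smooth functions. -/
def coframeFn (hg : IsRiemannianMetricOn g U) (hWU : (W : Set Plane) ⊆ U)
    (hc : IsIntegralOn g W c) (a j : Fin 2) : smoothFn W :=
  restrictSmooth (fun x => coframe g c x a j) (contDiffOn_coframe hg hWU hc.smooth a j)

/-- The form `κ` of an integral in the ring of smooth functions. -/
def kappaFn (hU : IsOpen U) (hg : IsRiemannianMetricOn g U) (hWU : (W : Set Plane) ⊆ U)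
    (hc : IsIntegralOn g W c) (i : Fin 2) : smoothFn W :=
  restrictSmooth (kappa g c i) (hc.contDiffOn_kappa hU hg W.isOpen hWU i)

/-- The form `υ` of an integral in the ring of smooth functions. -/
def upsilonFn (hU : IsOpen U) (hg : IsRiemannianMetricOn g U) (hWU : (W : Set Plane) ⊆ U)
    (hc : IsIntegralOn g W c) (i : Fin 2) : smoothFn W :=
  restrictSmooth (upsilon g c i) (hc.contDiffOn_upsilon hU hg W.isOpen hWU i)

/-- The function `μ` of an integral in the ring of smooth functions. -/
def muFn (hU : IsOpen U) (hg : IsRiemannianMetricOn g U) (hWU : (W : Set Plane) ⊆ U)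
    (hc : IsIntegralOn g W c) : smoothFn W :=
  restrictSmooth (mu g c) (hc.contDiffOn_mu hU hg W.isOpen hWU)

variable (hU : IsOpen U) (hg : IsRiemannianMetricOn g U) (hWU : (W : Set Plane) ⊆ U)
  (hc : IsIntegralOn g W c)

lemma smoothDeriv_coframeFn (a i j : Fin 2) :
    smoothDeriv W i (coframeFn hg hWU hc a j)
      = christoffelFn hU hg hWU 0 i j * coframeFn hg hWU hc a 0
        + christoffelFn hU hg hWU 1 i j * coframeFn hg hWU hc a 1
        + kappaFn hU hg hWU hc i * coframeFn hg hWU hc a j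
        + upsilonFn hU hg hWU hc j * coframeFn hg hWU hc a i := by
  rw [coframeFn, smoothDeriv_restrictSmooth, smoothFn_ext_iff]
  intro x
  have h := hc.covDer_eq hU hg W.isOpen hWU x.2 a i j
  rw [covDer] at h
  have h' : partialDeriv i (fun y => coframe g c y a j) x
      = christoffel g 0 i j x * coframe g c x a 0 + christoffel g 1 i j x * coframe g c x a 1
        + kappa g c i x * coframe g c x a j + upsilon g c j x * coframe g c x a i := by
    linear_combination h
  exact h'

lemma exists_inv_det_coframeFn : ∃ u : smoothFn W,
    (coframeFn hg hWU hc 0 0 * coframeFn hg hWU hc 1 1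
      - coframeFn hg hWU hc 0 1 * coframeFn hg hWU hc 1 0) * u = 1 := by
  have hN := contDiffOn_coframe hg hWU hc.smooth
  have hdet : ∀ x ∈ (W : Set Plane), coframe g c x 0 0 * coframe g c x 1 1
      - coframe g c x 0 1 * coframe g c x 1 0 ≠ 0 := by
    intro x hx
    have := det_coframe_ne_zero hg (hWU hx) (hc.det_ne_zero x hx)
    rwa [Matrix.det_fin_two] at this
  refine ⟨restrictSmooth _ ((((hN 0 0).mul (hN 1 1)).sub ((hN 0 1).mul (hN 1 0))).inv hdet), ?_⟩
  rw [smoothFn_ext_iff]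
  exact fun x => mul_inv_cancel₀ (hdet x x.2)

/-- Half the exterior derivative of `υ` is minus the exterior derivative of `κ`. -/
lemma muFn_eq : muFn hU hg hWU hc = -(smoothDeriv W 0 (kappaFn hU hg hWU hc 1)
    - smoothDeriv W 1 (kappaFn hU hg hWU hc 0)) := by
  obtain ⟨u, hu⟩ := exists_inv_det_coframeFn hg hWU hc
  obtain ⟨-, -, h01, h10⟩ := (isLeviCivita_christoffel hU hg hWU).upsilon_eq hu
    (smoothDeriv_coframeFn hU hg hWU hc)
  have h2 : (2 : smoothFn W) * muFn hU hg hWU hc = smoothDeriv W 0 (upsilonFn hU hg hWU hc 1)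
      - smoothDeriv W 1 (upsilonFn hU hg hWU hc 0) := by
    rw [upsilonFn, upsilonFn, smoothDeriv_restrictSmooth, smoothDeriv_restrictSmooth,
      smoothFn_ext_iff]
    intro x
    have : 2 * mu g c x = partialDeriv 0 (upsilon g c 1) x - partialDeriv 1 (upsilon g c 0) x := by
      rw [mu]; ring
    exact this
  rw [← sub_eq_zero]
  apply eq_zero_of_two_mul
  linear_combination h2 + h01 - h10

/-- The forms `υ` of integrals are among the solutions of the closed differential system. -/
lemma isSolution_of_isIntegralOn : IsSolution (smoothDeriv W) (metricFn hg hWU)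
    (christoffelFn hU hg hWU) (curvatureFn hU hg hWU) (upsilonFn hU hg hWU hc)
    (muFn hU hg hWU hc) := by
  obtain ⟨u, hu⟩ := exists_inv_det_coframeFn hg hWU hc
  obtain ⟨h00, h11, h01, h10⟩ := (isLeviCivita_christoffel hU hg hWU).upsilon_eq hu
    (smoothDeriv_coframeFn hU hg hWU hc)
  have hm := muFn_eq hU hg hWU hc
  refine ⟨h00, h11, ?_, ?_⟩
  · rw [h01, hm]; ring
  · rw [h10, hm]; ring

end

/-- Two integrals on a convex set whose forms `υ` coincide differ by a constant projective
transformation. -/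
lemma exists_smul_eq_of_upsilon_eq (hU : IsOpen U) (hg : IsRiemannianMetricOn g U)
    (hW : Convex ℝ (W : Set Plane)) (hWU : (W : Set Plane) ⊆ U)
    {c c' : Plane → Matrix (Fin 2) (Fin 2) ℝ} (hc : IsIntegralOn g W c) (hc' : IsIntegralOn g W c')
    (hυ : upsilonFn hU hg hWU hc = upsilonFn hU hg hWU hc') {s : Plane} (hs : s ∈ W) :
    ∃ f : Plane → ℝ, ∀ x ∈ W, f x ≠ 0 ∧ c' x = f x • (c' s * (c s)⁻¹ * c x) := by
  have hN := smoothDeriv_coframeFn hU hg hWU hc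
  have hN' := smoothDeriv_coframeFn hU hg hWU hc'
  rw [← hυ] at hN'
  have hT := (isLeviCivita_christoffel hU hg hWU).d_transition hN hN'
  -- the transition matrix `c' adj c`
  set T : Plane → Matrix (Fin 2) (Fin 2) ℝ := fun x => c' x * (c x).adjugate with hTdef
  obtain ⟨P, θ, hP, hPd⟩ : ∃ (P : Fin 2 → Fin 2 → smoothFn W) (θ : Fin 2 → smoothFn W),
      (∀ (x : W) a b, (P a b).1 x = (g x).det * T x a b) ∧
      ∀ i a b, smoothDeriv W i (P a b) = θ i * P a b := by
    refine ⟨fun a b => coframeFn hg hWU hc' a b * coframeFn hg hWU hc (1 - b) (1 - b)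
      - coframeFn hg hWU hc' a (1 - b) * coframeFn hg hWU hc (1 - b) b, fun i => _,
      fun x a b => ?_, fun i a b => hT a b (1 - b) i⟩
    have : coframe g c' x a b * coframe g c x (1 - b) (1 - b)
        - coframe g c' x a (1 - b) * coframe g c x (1 - b) b = (g x).det * T x a b := by
      simp only [hTdef, coframe_apply, Matrix.det_fin_two, Matrix.adjugate_fin_two,
        Matrix.mul_apply, Fin.sum_univ_two]
      obtain rfl | rfl : b = 0 ∨ b = 1 := by omega
      all_goals
        simp
        ring
    exact this
  -- solutions of the same scalar equation have constant ratios
  have hprop : ∀ x : W, ∀ a b a' b', (P a b).1 x * (P a' b').1 ⟨s, hs⟩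
      = (P a' b').1 x * (P a b).1 ⟨s, hs⟩ := by
    intro x a b a' b'
    have hz := eq_zero_of_linear_system hW (n := 1)
      (fun _ => (P a' b').1 ⟨s, hs⟩ • P a b - (P a b).1 ⟨s, hs⟩ • P a' b') (y := ⟨s, hs⟩)
      (fun i _ => ⟨fun _ => θ i, by
        rw [map_sub, Derivation.map_smul, Derivation.map_smul, hPd, hPd, Fin.sum_univ_one,
          mul_sub, mul_smul_comm, mul_smul_comm]⟩)
      (fun _ => by
        have : (P a' b').1 ⟨s, hs⟩ * (P a b).1 ⟨s, hs⟩
          - (P a b).1 ⟨s, hs⟩ * (P a' b').1 ⟨s, hs⟩ = 0 := by ring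
        exact this) 0
    have hzx : (P a' b').1 ⟨s, hs⟩ * (P a b).1 x - (P a b).1 ⟨s, hs⟩ * (P a' b').1 x = 0 :=
      congrArg (fun f : smoothFn W => f.1 x) hz
    linear_combination hzx
  have hdetT : ∀ x ∈ W, (T x).det ≠ 0 := by
    intro x hx
    simp only [hTdef, Matrix.det_mul, Matrix.det_adjugate, Fintype.card_fin]
    simpa using ⟨hc'.det_ne_zero x hx, hc.det_ne_zero x hx⟩
  obtain ⟨a, b, hab⟩ : ∃ a b, T s a b ≠ 0 := by
    by_contra! h
    exact hdetT s hs (by simp [Matrix.det_fin_two, h])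
  have hTprop : ∀ x ∈ W, T x = (T x a b / T s a b) • T s := by
    intro x hx
    ext a' b'
    have hgx := hg.det_ne_zero (hWU hx)
    have hgs := hg.det_ne_zero (hWU hs)
    have h := hprop ⟨x, hx⟩ a' b' a b
    rw [hP, hP, hP, hP] at h
    have h' : T x a' b' * T s a b = T x a b * T s a' b' := by
      apply mul_left_cancel₀ hgx
      apply mul_left_cancel₀ hgs
      linear_combination h
    rw [Matrix.smul_apply, smul_eq_mul]
    field_simp
    exact h'
  refine ⟨fun x => T x a b / T s a b * ((c s).det / (c x).det), fun x hx => ⟨?_, ?_⟩⟩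
  · have h1 : T x a b ≠ 0 := by
      intro h0
      have := hTprop x hx
      rw [h0, zero_div, zero_smul] at this
      exact hdetT x hx (by rw [this]; simp)
    exact mul_ne_zero (div_ne_zero h1 hab) (div_ne_zero (hc.det_ne_zero s hs)
      (hc.det_ne_zero x hx))
  · have h1 : T x * c x = (c x).det • c' x := by
      simp only [hTdef]
      rw [Matrix.mul_assoc, Matrix.adjugate_mul, Matrix.mul_smul, Matrix.mul_one]
    have h2 : T s = (c s).det • (c' s * (c s)⁻¹) := by
      simp only [hTdef]
      rw [Matrix.inv_def, Ring.inverse_eq_inv', Matrix.mul_smul, smul_smul,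
        mul_inv_cancel₀ (hc.det_ne_zero s hs), one_smul]
    have h3 : c' x = (c x).det⁻¹ • (T x * c x) := by
      rw [h1, smul_smul, inv_mul_cancel₀ (hc.det_ne_zero x hx), one_smul]
    rw [h3, hTprop x hx, h2, smul_smul, Matrix.smul_mul, smul_smul]
    congr 1
    have := hTprop x hx
    rw [← h2]
    simp
    ring

end Transitions

/-! ### Transformations of integrals -/

section Transformations

variable {U : Set Plane} {g : Plane → Matrix (Fin 2) (Fin 2) ℝ}

lemma IsIntegralOn.mono {W W' : Set Plane} {c : Plane → Matrix (Fin 2) (Fin 2) ℝ}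
    (h : IsIntegralOn g W c) (hW : W' ⊆ W) : IsIntegralOn g W' c :=
  ⟨fun i j => (h.smooth i j).mono hW, fun x hx => h.det_ne_zero x (hW hx),
    fun x hx => h.bracket_eq_zero x (hW hx)⟩

lemma covDer_mul {x : Plane} {c M : Plane → Matrix (Fin 2) (Fin 2) ℝ}
    (hM : ∀ a b, DifferentiableAt ℝ (fun y => M y a b) x)
    (hN : ∀ a j, DifferentiableAt ℝ (fun y => coframe g c y a j) x) (a i j : Fin 2) :
    covDer g (fun y => M y * c y) a i j x
      = partialDeriv i (fun y => M y a 0) x * coframe g c x 0 j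
        + partialDeriv i (fun y => M y a 1) x * coframe g c x 1 j
        + (M x a 0 * covDer g c 0 i j x + M x a 1 * covDer g c 1 i j x) := by
  have h : ∀ y a j, coframe g (fun y => M y * c y) y a j
      = M y a 0 * coframe g c y 0 j + M y a 1 * coframe g c y 1 j := by
    intro y a j
    rw [coframe, Matrix.mul_assoc, Matrix.mul_apply, Fin.sum_univ_two]
    rfl
  simp only [covDer, h]
  rw [partialDeriv_mul_add_mul (hM a 0) (hN 0 j) (hM a 1) (hN 1 j)]
  ring

lemma coframe_mul (c M : Plane → Matrix (Fin 2) (Fin 2) ℝ) (x : Plane) :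
    coframe g (fun y => M y * c y) x = M x * coframe g c x := by
  rw [coframe, coframe, Matrix.mul_assoc]

/-- Multiplication of the coframe of an integral by a matrix `M` gives an integral if the
derivative of `M` along every vector `v` satisfies the same kind of equation. -/
lemma IsIntegralOn.mul {W : Set Plane} {c M : Plane → Matrix (Fin 2) (Fin 2) ℝ}
    (hc : IsIntegralOn g W c) (hU : IsOpen U) (hg : IsRiemannianMetricOn g U) (hW : IsOpen W)
    (hWU : W ⊆ U) (hM : ∀ a b, ContDiffOn ℝ ∞ (fun y => M y a b) W)
    (hdet : ∀ x ∈ W, (M x).det ≠ 0)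
    (h : ∀ x ∈ W, ∀ v, ∃ l : ℝ, ∀ a,
      (v 0 * partialDeriv 0 (fun y => M y a 0) x + v 1 * partialDeriv 1 (fun y => M y a 0) x)
          * (coframe g c x *ᵥ v) 0
        + (v 0 * partialDeriv 0 (fun y => M y a 1) x + v 1 * partialDeriv 1 (fun y => M y a 1) x)
          * (coframe g c x *ᵥ v) 1
        = l * (M x a 0 * (coframe g c x *ᵥ v) 0 + M x a 1 * (coframe g c x *ᵥ v) 1)) :
    IsIntegralOn g W (fun y => M y * c y) := by
  refine isIntegralOn_of_symDer hU hg hW hWU ?_ ?_ ?_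
  · intro i j
    simp only [Matrix.mul_apply, Fin.sum_univ_two]
    exact ((hM i 0).mul (hc.smooth 0 j)).add ((hM i 1).mul (hc.smooth 1 j))
  · intro x hx
    rw [Matrix.det_mul]
    exact mul_ne_zero (hdet x hx) (hc.det_ne_zero x hx)
  · intro x hx v
    obtain ⟨l, hl⟩ := h x hx v
    refine ⟨l + (kappa g c 0 x + upsilon g c 0 x) * v 0 + (kappa g c 1 x + upsilon g c 1 x) * v 1,
      fun a => ?_⟩
    have hcd := hc.covDer_eq hU hg hW hWU hx
    have hN := contDiffOn_coframe (W := ⟨W, hW⟩) hg hWU hc.smooth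
    have hmul := covDer_mul (g := g) (c := c) (M := M) (x := x)
      (fun a b => differentiableAt_of_contDiffOn hW (hM a b) hx)
      (fun a j => differentiableAt_of_contDiffOn hW (hN a j) hx)
    have hla := hl a
    rw [coframe_mul, ← Matrix.mulVec_mulVec, mulVec_apply_two (M x)]
    simp only [symDer, hmul, hcd]
    simp only [mulVec_apply_two] at hla ⊢
    linear_combination hla

/-- A projective transformation of an integral is an integral. -/
lemma IsIntegralOn.const_mul {W : Set Plane} {c : Plane → Matrix (Fin 2) (Fin 2) ℝ}
    (hc : IsIntegralOn g W c) (hU : IsOpen U) (hg : IsRiemannianMetricOn g U) (hW : IsOpen W)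
    (hWU : W ⊆ U) {m : Matrix (Fin 2) (Fin 2) ℝ} (hm : m.det ≠ 0) :
    IsIntegralOn g W (fun y => m * c y) :=
  hc.mul hU hg hW hWU (M := fun _ => m) (fun _ _ => contDiffOn_const) (fun _ _ => hm)
    fun x hx v => ⟨0, fun a => by simp [partialDeriv]⟩

/-- Multiplication of all coefficients by a nonvanishing function. -/
lemma IsIntegralOn.smul {W : Set Plane} {c : Plane → Matrix (Fin 2) (Fin 2) ℝ}
    (hc : IsIntegralOn g W c) (hU : IsOpen U) (hg : IsRiemannianMetricOn g U) (hW : IsOpen W)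
    (hWU : W ⊆ U) {f : Plane → ℝ} (hf : ContDiffOn ℝ ∞ f W) (hf0 : ∀ x ∈ W, f x ≠ 0) :
    IsIntegralOn g W (fun y => f y • c y) := by
  have := hc.mul hU hg hW hWU (M := fun y => f y • (1 : Matrix (Fin 2) (Fin 2) ℝ)) ?_ ?_ ?_
  · simpa using this
  · intro a b
    exact hf.smul contDiffOn_const
  · intro x hx
    simp [hf0 x hx]
  · intro x hx v
    refine ⟨(v 0 * partialDeriv 0 f x + v 1 * partialDeriv 1 f x) / f x, fun a => ?_⟩
    have := hf0 x hx
    have h0 : ∀ i, partialDeriv i (fun _ => (0 : ℝ)) x = 0 := fun i => by simp [partialDeriv]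
    obtain rfl | rfl : a = 0 ∨ a = 1 := by omega
    all_goals
      simp [h0]
      field_simp

lemma fracLin_smul (A : Plane → Matrix (Fin 2) (Fin 2) ℝ) {A' : Plane → Matrix (Fin 2) (Fin 2) ℝ}
    {f : ℝ} (hf : f ≠ 0) {x : Plane} (h : A' x = f • A x) (p : Plane) :
    fracLin A' (x, p) = fracLin A (x, p) := by
  simp only [fracLin, denom, h, Matrix.smul_mulVec, Pi.smul_apply, smul_eq_mul]
  exact mul_div_mul_left _ _ hf

lemma denom_smul (A : Plane → Matrix (Fin 2) (Fin 2) ℝ) {A' : Plane → Matrix (Fin 2) (Fin 2) ℝ}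
    {f : ℝ} {x : Plane} (h : A' x = f • A x) (p : Plane) :
    denom A' (x, p) = f * denom A (x, p) := by
  simp only [denom, h, Matrix.smul_mulVec, Pi.smul_apply, smul_eq_mul]

/-! ### Potentials of the coframe -/

/-- The Poincaré lemma for `1`-forms on a convex open subset of the plane. -/
lemma exists_potential {W : Set Plane} (hW : IsOpen W) (hWc : Convex ℝ W) {α : Fin 2 → Plane → ℝ}
    (hα : ∀ i, ContDiffOn ℝ ∞ (α i) W)
    (hd : ∀ x ∈ W, partialDeriv 0 (α 1) x = partialDeriv 1 (α 0) x) :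
    ∃ φ : Plane → ℝ, ContDiffOn ℝ ∞ φ W ∧ ∀ x ∈ W, ∀ i, partialDeriv i φ x = α i x := by
  set η : Plane → Plane →L[ℝ] ℝ := fun x =>
    α 0 x • ContinuousLinearMap.proj (R := ℝ) (φ := fun _ : Fin 2 => ℝ) 0
      + α 1 x • ContinuousLinearMap.proj (R := ℝ) (φ := fun _ : Fin 2 => ℝ) 1 with hη
  have hηs : ContDiffOn ℝ ∞ η W :=
    ((hα 0).smul contDiffOn_const).add ((hα 1).smul contDiffOn_const)
  have hdiff : ∀ x ∈ W, ∀ v w, fderiv ℝ η x v w = fderiv ℝ (α 0) x v * w 0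
      + fderiv ℝ (α 1) x v * w 1 := by
    intro x hx v w
    have h0 := (differentiableAt_of_contDiffOn hW (hα 0) hx).hasFDerivAt
    have h1 := (differentiableAt_of_contDiffOn hW (hα 1) hx).hasFDerivAt
    have : HasFDerivAt η _ x := (h0.smul_const
      (ContinuousLinearMap.proj (R := ℝ) (φ := fun _ : Fin 2 => ℝ) 0)).add
      (h1.smul_const (ContinuousLinearMap.proj (R := ℝ) (φ := fun _ : Fin 2 => ℝ) 1))
    rw [this.fderiv]
    simp
  obtain ⟨φ, hφ⟩ := hWc.exists_forall_hasFDerivAt_of_fderiv_symmetric hW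
    (hηs.differentiableOn (by simp)) (by
      intro x hx v w
      rw [hdiff x hx, hdiff x hx]
      simp only [fderiv_eq_sum_partialDeriv]
      linear_combination (v 0 * w 1 - w 0 * v 1) * hd x hx)
  refine ⟨φ, ?_, ?_⟩
  · rw [contDiffOn_infty_iff_fderiv_of_isOpen hW]
    refine ⟨fun x hx => (hφ x hx).differentiableAt.differentiableWithinAt, ?_⟩
    exact hηs.congr fun x hx => (hφ x hx).fderiv
  · intro x hx i
    rw [partialDeriv, (hφ x hx).fderiv]
    obtain rfl | rfl : i = 0 ∨ i = 1 := by omega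
    all_goals simp [hη]

/-- If `μ = 0`, the coefficients of an integral can be rescaled so that the coframe consists of
differentials. -/
lemma exists_potentials {W : Opens Plane} (hWc : Convex ℝ (W : Set Plane)) (hU : IsOpen U)
    (hg : IsRiemannianMetricOn g U) (hWU : (W : Set Plane) ⊆ U)
    {c : Plane → Matrix (Fin 2) (Fin 2) ℝ} (hc : IsIntegralOn g W c)
    (hμ : muFn hU hg hWU hc = 0) {s : Plane} :
    ∃ (c' : Plane → Matrix (Fin 2) (Fin 2) ℝ) (u : Fin 2 → Plane → ℝ), IsIntegralOn g W c' ∧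
      (∀ a, ContDiffOn ℝ ∞ (u a) (W : Set Plane)) ∧ (∀ a, u a s = 0) ∧
      ∀ x ∈ W, ∀ a i, partialDeriv i (u a) x = coframe g c' x a i := by
  have hκ := hc.contDiffOn_kappa hU hg W.isOpen hWU
  have hυ := hc.contDiffOn_upsilon hU hg W.isOpen hWU
  have hclosed : ∀ x ∈ (W : Set Plane), partialDeriv 0 (fun y => upsilon g c 1 y - kappa g c 1 y) x
      = partialDeriv 1 (fun y => upsilon g c 0 y - kappa g c 0 y) x := by
    intro x hx
    have hm : mu g c x = 0 := congrArg (fun f : smoothFn W => f.1 ⟨x, hx⟩) hμ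
    have hk := muFn_eq hU hg hWU hc
    rw [kappaFn, kappaFn, smoothDeriv_restrictSmooth, smoothDeriv_restrictSmooth] at hk
    have hk' : mu g c x = -(partialDeriv 0 (kappa g c 1) x - partialDeriv 1 (kappa g c 0) x) :=
      congrArg (fun f : smoothFn W => f.1 ⟨x, hx⟩) hk
    have hsub : ∀ i j, partialDeriv i (fun y => upsilon g c j y - kappa g c j y) x
        = partialDeriv i (upsilon g c j) x - partialDeriv i (kappa g c j) x := by
      intro i j
      simp [partialDeriv, fderiv_fun_sub (differentiableAt_of_contDiffOn W.isOpen (hυ j) hx)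
        (differentiableAt_of_contDiffOn W.isOpen (hκ j) hx)]
    have hm2 := hm
    rw [mu] at hm2
    rw [hsub, hsub]
    linear_combination 2 * hm2 + hm - hk'
  -- `υ - κ` is closed, and rescaling by the exponential of its potential makes `κ` equal to `υ`,
  -- that is, makes the forms of the coframe closed
  obtain ⟨h, hhs, hh⟩ := exists_potential W.isOpen hWc
    (α := fun i y => upsilon g c i y - kappa g c i y) (fun i => (hυ i).sub (hκ i)) hclosed
  have hes : ContDiffOn ℝ ∞ (fun y => Real.exp (h y)) (W : Set Plane) := hhs.exp
  have hc' := hc.smul hU hg W.isOpen hWU hes fun x _ => (Real.exp_pos _).ne'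
  set c' : Plane → Matrix (Fin 2) (Fin 2) ℝ := fun y => Real.exp (h y) • c y with hc'def
  have hN := contDiffOn_coframe hg hWU hc.smooth
  have hN' := contDiffOn_coframe hg hWU hc'.smooth
  have hcof : ∀ y a j, coframe g c' y a j = Real.exp (h y) * coframe g c y a j := by
    intro y a j
    rw [coframe, hc'def, Matrix.smul_mul]
    rfl
  have hrow : ∀ a, ∃ φ : Plane → ℝ, ContDiffOn ℝ ∞ φ (W : Set Plane) ∧
      ∀ x ∈ (W : Set Plane), ∀ i, partialDeriv i φ x = coframe g c' x a i := by
    intro a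
    refine exists_potential W.isOpen hWc (α := fun i y => coframe g c' y a i) (hN' a) ?_
    intro x hx
    have hd : ∀ i j, partialDeriv i (fun y => coframe g c' y a j) x = Real.exp (h x)
        * (partialDeriv i (fun y => coframe g c y a j) x
          + (upsilon g c i x - kappa g c i x) * coframe g c x a j) := by
      intro i j
      simp only [hcof]
      rw [partialDeriv_mul (differentiableAt_of_contDiffOn W.isOpen hes hx)
        (differentiableAt_of_contDiffOn W.isOpen (hN a j) hx)]
      have : partialDeriv i (fun y => Real.exp (h y)) x
          = Real.exp (h x) * (upsilon g c i x - kappa g c i x) := by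
        rw [← hh x hx i, partialDeriv, fderiv_exp
          (differentiableAt_of_contDiffOn W.isOpen hhs hx)]
        rfl
      rw [this]
      ring
    have h01 := hc.covDer_eq hU hg W.isOpen hWU hx a 0 1
    have h10 := hc.covDer_eq hU hg W.isOpen hWU hx a 1 0
    have hs := fun k => christoffel_symm hU hg (hWU hx) k 1 0
    rw [covDer] at h01 h10
    rw [hs, hs] at h10
    rw [hd, hd]
    linear_combination Real.exp (h x) * (h01 - h10)
  choose φ hφs hφ using hrow
  refine ⟨c', fun a y => φ a y - φ a s, hc', fun a => (hφs a).sub contDiffOn_const,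
    fun a => sub_self _, fun x hx a i => ?_⟩
  rw [← hφ a x hx i, partialDeriv, fderiv_sub_const]
  rfl

end Transformations

/-! ### Jets of integrals and constancy of the curvature -/

section Jets

variable {U : Set Plane} {g : Plane → Matrix (Fin 2) (Fin 2) ℝ} {W : Opens Plane}

/-- An integral is determined, up to a projective transformation, by the values of `υ` and `μ`
at one point. -/
lemma exists_smul_eq_of_jet_eq (hU : IsOpen U) (hg : IsRiemannianMetricOn g U)
    (hW : Convex ℝ (W : Set Plane)) (hWU : (W : Set Plane) ⊆ U)
    {c c' : Plane → Matrix (Fin 2) (Fin 2) ℝ} (hc : IsIntegralOn g W c) (hc' : IsIntegralOn g W c')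
    {s : Plane} (hs : s ∈ W) (hυ : ∀ j, upsilon g c j s = upsilon g c' j s)
    (hμ : mu g c s = mu g c' s) :
    ∃ f : Plane → ℝ, ∀ x ∈ W, f x ≠ 0 ∧ c' x = f x • (c' s * (c s)⁻¹ * c x) :=
  exists_smul_eq_of_upsilon_eq hU hg hW hWU hc hc' ((isSolution_of_isIntegralOn hU hg hWU hc).unique
    hW (isLeviCivita_christoffel hU hg hWU) (isSolution_of_isIntegralOn hU hg hWU hc')
    (y := ⟨s, hs⟩) (hυ 0) (hυ 1) hμ).1 hs

/-- On a surface of constant curvature the form `υ` of every integral is closed. -/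
lemma muFn_eq_zero (hU : IsOpen U) (hg : IsRiemannianMetricOn g U) (hWU : (W : Set Plane) ⊆ U)
    {c : Plane → Matrix (Fin 2) (Fin 2) ℝ} (hc : IsIntegralOn g W c) {κ : ℝ}
    (hκ : ∀ x ∈ W, gaussianCurvature g x = κ) : muFn hU hg hWU hc = 0 := by
  have hK : curvatureFn hU hg hWU = algebraMap ℝ (smoothFn W) κ := by
    rw [smoothFn_ext_iff]
    exact fun x => hκ x x.2
  have hl : ∀ j, lam (smoothDeriv W) (metricFn hg hWU) (curvatureFn hU hg hWU) j = 0 := by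
    intro j
    rw [lam, hK, Derivation.map_algebraMap, Derivation.map_algebraMap, zero_mul, zero_mul, sub_zero]
  -- the integrability condition reduces to `6 μ² = 0`
  have h := (isSolution_of_isIntegralOn hU hg hWU hc).constraint
    (isLeviCivita_christoffel hU hg hWU)
  simp only [source, hl, zero_mul, sub_zero, add_zero, mul_zero, map_zero] at h
  rw [smoothFn_ext_iff]
  intro x
  have hx : 6 * (muFn hU hg hWU hc).1 x * (muFn hU hg hWU hc).1 x = 0 :=
    congrArg (fun f : smoothFn W => f.1 x) h
  have : (muFn hU hg hWU hc).1 x = 0 := by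
    by_contra h0
    exact h0 (by simpa using hx)
  exact this

/-- The form `lam` vanishes only where the differential of the curvature does, hence not
identically unless the curvature is constant. -/
lemma exists_lam_ne_zero (hU : IsOpen U) (hg : IsRiemannianMetricOn g U)
    (hW : Convex ℝ (W : Set Plane)) (hWU : (W : Set Plane) ⊆ U) {s : Plane} (hs : s ∈ W)
    (hK : ¬ HasConstantCurvatureNear g s) :
    ∃ y : W, (lam (smoothDeriv W) (metricFn hg hWU) (curvatureFn hU hg hWU) 0).1 y ≠ 0 ∨
      (lam (smoothDeriv W) (metricFn hg hWU) (curvatureFn hU hg hWU) 1).1 y ≠ 0 := by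
  by_contra! h
  have hs' := (contDiffOn_gaussianCurvature hU hg).mono hWU
  apply hK
  refine ⟨gaussianCurvature g s, Filter.eventually_of_mem (W.isOpen.mem_nhds hs) fun x hx => ?_⟩
  refine W.isOpen.is_const_of_fderiv_eq_zero hW.isPreconnected
    (hs'.differentiableOn (by simp)) (fun y hy => ?_) hx hs
  obtain ⟨h0, h1⟩ := h ⟨y, hy⟩
  simp only [lam, curvatureFn, smoothDeriv_restrictSmooth] at h0 h1
  have e0 : partialDeriv 0 (gaussianCurvature g) y * g y 1 0
      - partialDeriv 1 (gaussianCurvature g) y * g y 0 0 = 0 := h0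
  have e1 : partialDeriv 0 (gaussianCurvature g) y * g y 1 1
      - partialDeriv 1 (gaussianCurvature g) y * g y 0 1 = 0 := h1
  have hd := hg.det_ne_zero (hWU hy)
  rw [Matrix.det_fin_two] at hd
  have d0 : partialDeriv 0 (gaussianCurvature g) y = 0 := by
    apply mul_right_cancel₀ hd
    linear_combination g y 0 0 * e1 - g y 0 1 * e0
  have d1 : partialDeriv 1 (gaussianCurvature g) y = 0 := by
    apply mul_right_cancel₀ hd
    linear_combination g y 1 0 * e1 - g y 1 1 * e0
  ext v
  rw [fderiv_eq_sum_partialDeriv, d0, d1]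
  simp

end Jets

/-! ### The family of integrals of a surface of constant curvature -/

section Flat

variable {U : Set Plane} {g : Plane → Matrix (Fin 2) (Fin 2) ℝ}

/-- The matrix `1 + ϑ ⊗ (-u₁, u₀)`. Multiplying a coframe `(du₀, du₁)` by this matrix again
gives the coframe of an integral. -/
def transvection (u : Fin 2 → Plane → ℝ) (ϑ : Fin 2 → ℝ) (x : Plane) : Matrix (Fin 2) (Fin 2) ℝ :=
  !![1 - ϑ 0 * u 1 x, ϑ 0 * u 0 x; -(ϑ 1 * u 1 x), 1 + ϑ 1 * u 0 x]

lemma det_transvection (u : Fin 2 → Plane → ℝ) (ϑ : Fin 2 → ℝ) (x : Plane) :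
    (transvection u ϑ x).det = 1 - ϑ 0 * u 1 x + ϑ 1 * u 0 x := by
  rw [transvection, Matrix.det_fin_two_of]
  ring

lemma partialDeriv_transvection {u : Fin 2 → Plane → ℝ} {x : Plane}
    (hu : ∀ a, DifferentiableAt ℝ (u a) x) (ϑ : Fin 2 → ℝ) (i a : Fin 2) :
    partialDeriv i (fun y => transvection u ϑ y a 0) x = -(ϑ a * partialDeriv i (u 1) x) ∧
      partialDeriv i (fun y => transvection u ϑ y a 1) x = ϑ a * partialDeriv i (u 0) x := by
  have h := fun (r k : ℝ) a => ((hu a).hasFDerivAt.const_mul r).const_add k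
  have hk : ∀ (r k : ℝ) a,
      partialDeriv i (fun y => k + r * u a y) x = r * partialDeriv i (u a) x := by
    intro r k a
    rw [partialDeriv, (h r k a).fderiv]
    rfl
  obtain rfl | rfl : a = 0 ∨ a = 1 := by omega
  · have e0 : (fun y => transvection u ϑ y 0 0) = fun y => 1 + -ϑ 0 * u 1 y := by
      funext y; simp [transvection]; ring
    have e1 : (fun y => transvection u ϑ y 0 1) = fun y => 0 + ϑ 0 * u 0 y := by
      funext y; simp [transvection]
    rw [e0, e1, hk, hk]
    exact ⟨by ring, rfl⟩
  · have e0 : (fun y => transvection u ϑ y 1 0) = fun y => 0 + -ϑ 1 * u 1 y := by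
      funext y; simp [transvection]
    have e1 : (fun y => transvection u ϑ y 1 1) = fun y => 1 + ϑ 1 * u 0 y := by
      funext y; simp [transvection]
    rw [e0, e1, hk, hk]
    exact ⟨by ring, rfl⟩

lemma contDiffOn_transvection_param {u : Fin 2 → Plane → ℝ} {W : Set Plane}
    (hu : ∀ a, ContDiffOn ℝ ∞ (u a) W) (a b : Fin 2) :
    ContDiffOn ℝ ∞ (fun z : (Fin 2 → ℝ) × Plane => transvection u z.1 z.2 a b)
      (Set.univ ×ˢ W) := by
  have h1 : ∀ a, ContDiffOn ℝ ∞ (fun z : (Fin 2 → ℝ) × Plane => u a z.2) (Set.univ ×ˢ W) :=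
    fun a => (hu a).comp contDiffOn_snd fun z hz => hz.2
  have h2 : ∀ a, ContDiffOn ℝ ∞ (fun z : (Fin 2 → ℝ) × Plane => z.1 a) (Set.univ ×ˢ W) :=
    fun a => by fun_prop
  obtain rfl | rfl : a = 0 ∨ a = 1 := by omega
  all_goals
    obtain rfl | rfl : b = 0 ∨ b = 1 := by omega
    all_goals simp only [transvection, Matrix.of_apply, Matrix.cons_val', Matrix.cons_val_zero,
      Matrix.cons_val_one, Matrix.cons_val_fin_one]
  · exact contDiffOn_const.sub ((h2 0).mul (h1 1))
  · exact (h2 0).mul (h1 0)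
  · exact ((h2 1).mul (h1 1)).neg
  · exact contDiffOn_const.add ((h2 1).mul (h1 0))

lemma contDiffOn_transvection {u : Fin 2 → Plane → ℝ} {W : Set Plane}
    (hu : ∀ a, ContDiffOn ℝ ∞ (u a) W) (ϑ : Fin 2 → ℝ) (a b : Fin 2) :
    ContDiffOn ℝ ∞ (fun x => transvection u ϑ x a b) W :=
  (contDiffOn_transvection_param hu a b).comp (f := fun x => (ϑ, x))
    (contDiffOn_const.prodMk contDiffOn_id) fun _ hx => ⟨trivial, hx⟩

variable {W : Set Plane} {c : Plane → Matrix (Fin 2) (Fin 2) ℝ} {u : Fin 2 → Plane → ℝ}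

/-- The derivative of the transvection along `v` is `ϑ ⊗ (-N₁ v, N₀ v)`, where `N` is the coframe,
and this annihilates the vector `N v`. -/
lemma IsIntegralOn.transvection_mul (hc : IsIntegralOn g W c) (hU : IsOpen U)
    (hg : IsRiemannianMetricOn g U) (hW : IsOpen W) (hWU : W ⊆ U)
    (hus : ∀ a, ContDiffOn ℝ ∞ (u a) W)
    (hu : ∀ x ∈ W, ∀ a i, partialDeriv i (u a) x = coframe g c x a i) {ϑ : Fin 2 → ℝ}
    (hdet : ∀ x ∈ W, (transvection u ϑ x).det ≠ 0) :
    IsIntegralOn g W (fun y => transvection u ϑ y * c y) := by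
  refine hc.mul hU hg hW hWU (contDiffOn_transvection hus ϑ) hdet fun x hx v => ⟨0, fun a => ?_⟩
  have h := fun i => partialDeriv_transvection (x := x)
    (fun a => differentiableAt_of_contDiffOn hW (hus a) hx) ϑ i a
  rw [(h 0).1, (h 0).2, (h 1).1, (h 1).2]
  simp only [hu x hx, mulVec_apply_two]
  ring

/-- The parameter of the transvection shifts the value of `υ` at the common zero of the potentials
by an arbitrary amount. -/
lemma upsilon_transvection_mul (hc : IsIntegralOn g W c) (hU : IsOpen U)
    (hg : IsRiemannianMetricOn g U) (hW : IsOpen W) (hWU : W ⊆ U)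
    (hus : ∀ a, ContDiffOn ℝ ∞ (u a) W)
    (hu : ∀ x ∈ W, ∀ a i, partialDeriv i (u a) x = coframe g c x a i) (ϑ : Fin 2 → ℝ)
    {s : Plane} (hs : s ∈ W) (hus0 : ∀ a, u a s = 0) (j : Fin 2) :
    upsilon g (fun y => transvection u ϑ y * c y) j s
      = upsilon g c j s - (ϑ 1 * coframe g c s 0 j - ϑ 0 * coframe g c s 1 j) := by
  have hM : transvection u ϑ s = 1 := by
    ext a b
    fin_cases a <;> fin_cases b <;> simp [transvection, hus0]
  have hcof : coframe g (fun y => transvection u ϑ y * c y) s = coframe g c s := by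
    rw [coframe_mul, hM, one_mul]
  refine upsilon_eq_of_covDer
    (κ := fun i => kappa g c i s + (ϑ 1 * coframe g c s 0 i - ϑ 0 * coframe g c s 1 i))
    (υ := fun j => upsilon g c j s - (ϑ 1 * coframe g c s 0 j - ϑ 0 * coframe g c s 1 j))
    (fun y => transvection u ϑ y * c y) ?_ ?_ j
  · rw [hcof]
    exact det_coframe_ne_zero hg (hWU hs) (hc.det_ne_zero s hs)
  · intro a i j
    have h := fun i => partialDeriv_transvection (x := s)
      (fun a => differentiableAt_of_contDiffOn hW (hus a) hs) ϑ i a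
    rw [covDer_mul (fun a b => differentiableAt_of_contDiffOn hW (contDiffOn_transvection hus ϑ a b)
      hs) (fun a j => differentiableAt_of_contDiffOn hW
        (contDiffOn_coframe (W := ⟨W, hW⟩) hg hWU hc.smooth a j) hs), (h i).1, (h i).2, hcof,
      hc.covDer_eq hU hg hW hWU hs, hc.covDer_eq hU hg hW hWU hs, hu s hs, hu s hs, hM]
    obtain rfl | rfl : a = 0 ∨ a = 1 := by omega
    all_goals
      simp
      ring

end Flat

/-! ### Derivatives of fractional-linear functions with respect to parameters -/

section MatDeriv

variable {E F : Type*} [NormedAddCommGroup E] [NormedSpace ℝ E] [NormedAddCommGroup F]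
  [NormedSpace ℝ F]

/-- The directional derivative, entry by entry, of a matrix-valued function. -/
def matDeriv (M : E → Matrix (Fin 2) (Fin 2) ℝ) (t v : E) : Matrix (Fin 2) (Fin 2) ℝ :=
  Matrix.of fun i j => fderiv ℝ (fun τ => M τ i j) t v

variable {A B : E → Matrix (Fin 2) (Fin 2) ℝ} {t v : E}

lemma differentiableAt_matrix_mul (hA : ∀ i j, DifferentiableAt ℝ (fun τ => A τ i j) t)
    (hB : ∀ i j, DifferentiableAt ℝ (fun τ => B τ i j) t) (i j : Fin 2) :
    DifferentiableAt ℝ (fun τ => (A τ * B τ) i j) t := by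
  simp only [Matrix.mul_apply, Fin.sum_univ_two]
  exact ((hA i 0).mul (hB 0 j)).add ((hA i 1).mul (hB 1 j))

lemma matDeriv_mul (hA : ∀ i j, DifferentiableAt ℝ (fun τ => A τ i j) t)
    (hB : ∀ i j, DifferentiableAt ℝ (fun τ => B τ i j) t) :
    matDeriv (fun τ => A τ * B τ) t v = matDeriv A t v * B t + A t * matDeriv B t v := by
  ext i j
  have h := ((hA i 0).hasFDerivAt.fun_mul (hB 0 j).hasFDerivAt).fun_add
    ((hA i 1).hasFDerivAt.fun_mul (hB 1 j).hasFDerivAt)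
  simp only [matDeriv, Matrix.of_apply, h.fderiv, Matrix.add_apply, Matrix.mul_apply,
    Fin.sum_univ_two]
  simp
  ring

@[simp] lemma matDeriv_const (m : Matrix (Fin 2) (Fin 2) ℝ) :
    matDeriv (fun _ : E => m) t v = 0 := by
  ext i j
  simp [matDeriv]

lemma matDeriv_comp {A : F → Matrix (Fin 2) (Fin 2) ℝ} {f : E → F}
    (hA : ∀ i j, DifferentiableAt ℝ (fun τ => A τ i j) (f t)) (hf : DifferentiableAt ℝ f t) :
    matDeriv (fun τ => A (f τ)) t v = matDeriv A (f t) (fderiv ℝ f t v) := by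
  ext i j
  have h : HasFDerivAt (fun τ => A (f τ) i j) _ t :=
    HasFDerivAt.comp t (g := fun τ => A τ i j) (hA i j).hasFDerivAt hf.hasFDerivAt
  simp only [matDeriv, Matrix.of_apply, h.fderiv]
  rfl

@[simp] lemma matDeriv_zero : matDeriv A t 0 = 0 := by
  ext i j
  simp [matDeriv]

lemma fderiv_mulVec_div (hA : ∀ i j, DifferentiableAt ℝ (fun τ => A τ i j) t) (p : Plane)
    (hp : (A t *ᵥ p) 1 ≠ 0) :
    fderiv ℝ (fun τ => (A τ *ᵥ p) 0 / (A τ *ᵥ p) 1) t v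
      = ((matDeriv A t v *ᵥ p) 0 * (A t *ᵥ p) 1 - (A t *ᵥ p) 0 * (matDeriv A t v *ᵥ p) 1)
        / (A t *ᵥ p) 1 ^ 2 := by
  have h : ∀ i, ∃ L : E →L[ℝ] ℝ, HasFDerivAt (fun τ => (A τ *ᵥ p) i) L t ∧
      L v = (matDeriv A t v *ᵥ p) i := by
    intro i
    simp only [mulVec_apply_two]
    refine ⟨_, ((hA i 0).hasFDerivAt.mul_const _).add ((hA i 1).hasFDerivAt.mul_const _), ?_⟩
    simp [matDeriv]
    ring
  obtain ⟨L0, h0, e0⟩ := h 0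
  obtain ⟨L1, h1, e1⟩ := h 1
  have h' := h0.fun_mul ((hasDerivAt_inv hp).comp_hasFDerivAt t h1)
  have he : (fun τ => (A τ *ᵥ p) 0 / (A τ *ᵥ p) 1)
      = fun τ => (A τ *ᵥ p) 0 * ((fun y => y⁻¹) ∘ fun τ => (A τ *ᵥ p) 1) τ := by
    funext τ
    exact div_eq_mul_inv _ _
  rw [he, h'.fderiv, ← e0, ← e1]
  simp
  field_simp
  ring

/-- If the fractional-linear function with matrix `A` does not change to first order in the
direction `v`, then `A` changes only by a multiple of itself. -/
lemma exists_matDeriv_eq_smul (hA : ∀ i j, DifferentiableAt ℝ (fun τ => A τ i j) t)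
    (hdet : (A t).det ≠ 0)
    (h : ∀ p : Plane, (A t *ᵥ p) 1 ≠ 0 → fderiv ℝ (fun τ => (A τ *ᵥ p) 0 / (A τ *ᵥ p) 1) t v = 0) :
    ∃ l : ℝ, matDeriv A t v = l • A t := by
  set D := matDeriv A t v * (A t)⁻¹ with hD
  have hDA : matDeriv A t v = D * A t := by
    rw [hD, Matrix.nonsing_inv_mul_cancel_right _ _ hdet.isUnit]
  have key : ∀ q : Plane, q 1 ≠ 0 → (D *ᵥ q) 0 * q 1 = q 0 * (D *ᵥ q) 1 := by
    intro q hq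
    have e : A t *ᵥ ((A t)⁻¹ *ᵥ q) = q := by
      rw [Matrix.mulVec_mulVec, Matrix.mul_nonsing_inv _ hdet.isUnit, Matrix.one_mulVec]
    have h' := h ((A t)⁻¹ *ᵥ q) (by rwa [e])
    rw [fderiv_mulVec_div hA _ (by rwa [e]), e, Matrix.mulVec_mulVec, ← hD, div_eq_zero_iff] at h'
    exact sub_eq_zero.1 (h'.resolve_right (pow_ne_zero _ hq))
  have k0 := key ![0, 1] (by simp)
  have k1 := key ![1, 1] (by simp)
  have k2 := key ![-1, 1] (by simp)
  simp [mulVec_apply_two] at k0 k1 k2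
  refine ⟨D 0 0, ?_⟩
  have h10 : D 1 0 = 0 := by linarith
  have h11 : D 1 1 = D 0 0 := by linarith
  have : D = D 0 0 • (1 : Matrix (Fin 2) (Fin 2) ℝ) := by
    ext i j
    fin_cases i <;> fin_cases j <;> simp [k0, h10, h11]
  rw [hDA]
  conv_lhs => rw [this]
  rw [Matrix.smul_mul, one_mul]

lemma fderiv_mulVec_div_eq_zero (hA : ∀ i j, DifferentiableAt ℝ (fun τ => A τ i j) t) {l : ℝ}
    (h : matDeriv A t v = l • A t) (p : Plane) (hp : (A t *ᵥ p) 1 ≠ 0) :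
    fderiv ℝ (fun τ => (A τ *ᵥ p) 0 / (A τ *ᵥ p) 1) t v = 0 := by
  rw [fderiv_mulVec_div hA p hp, h, Matrix.smul_mulVec, Pi.smul_apply, Pi.smul_apply, smul_eq_mul,
    smul_eq_mul]
  simp
  left
  ring

end MatDeriv

/-! ### Families of integrals up to projective transformations -/

section BaseFamily

variable {U : Set Plane} {g : Plane → Matrix (Fin 2) (Fin 2) ℝ} {s : Plane} {r : ℕ}

lemma differentiableAt_param {E : Type*} [NormedAddCommGroup E] [NormedSpace ℝ E] {O : Set E}
    {W : Set Plane} {f : E → Plane → ℝ} (hO : IsOpen O) (hW : IsOpen W)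
    (hf : ContDiffOn ℝ ∞ (fun z : E × Plane => f z.1 z.2) (O ×ˢ W)) {t : E} (ht : t ∈ O) {x : Plane}
    (hx : x ∈ W) : DifferentiableAt ℝ (fun τ => f τ x) t :=
  DifferentiableAt.comp t (f := fun τ : E => (τ, x)) (g := fun z : E × Plane => f z.1 z.2)
    (differentiableAt_of_contDiffOn (hO.prod hW) hf (Set.mk_mem_prod ht hx)) (by fun_prop)

/-- A smooth family of integrals, normalized by the value of the coefficients at `s`, that depends
effectively on its parameters, even if multiples of the coefficients are disregarded. Since the
value at `s` is fixed, the orbits of the members under projective transformations form a family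
with three more parameters. -/
structure IsBaseFamily (g : Plane → Matrix (Fin 2) (Fin 2) ℝ) (U : Set Plane) (s : Plane)
    (O : Set (Fin r → ℝ)) (W : Set Plane) (b : (Fin r → ℝ) → Plane → Matrix (Fin 2) (Fin 2) ℝ) :
    Prop where
  isOpen_param : IsOpen O
  isOpen_base : IsOpen W
  base_subset : W ⊆ U
  mem_base : s ∈ W
  smooth : ∀ i j, ContDiffOn ℝ ∞ (fun z : (Fin r → ℝ) × Plane => b z.1 z.2 i j) (O ×ˢ W)
  integral : ∀ ϑ ∈ O, IsIntegralOn g W (b ϑ)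
  const_at : ∀ ϑ ∈ O, ∀ ϑ' ∈ O, b ϑ s = b ϑ' s
  effective : ∀ ϑ ∈ O, ∀ v : Fin r → ℝ,
    (∀ᶠ x in 𝓝 s, ∃ l : ℝ, matDeriv (fun τ => b τ x) ϑ v = l • b ϑ x) → v = 0

/-- The coordinate chart on the projective transformations whose upper left entry is nonzero. -/
def chart (t : Fin 3 → ℝ) : Matrix (Fin 2) (Fin 2) ℝ := !![1, t 0; t 1, t 2]

lemma matDeriv_chart (t v : Fin 3 → ℝ) : matDeriv chart t v = !![0, v 0; v 1, v 2] := by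
  have hp : ∀ i, fderiv ℝ (fun τ : Fin 3 → ℝ => τ i) t v = v i := fun i => by
    have h : HasFDerivAt (fun τ : Fin 3 → ℝ => τ i)
        (ContinuousLinearMap.proj (R := ℝ) (φ := fun _ : Fin 3 => ℝ) i) t :=
      (ContinuousLinearMap.proj (R := ℝ) (φ := fun _ : Fin 3 => ℝ) i).hasFDerivAt
    rw [h.fderiv]
    rfl
  ext i j
  fin_cases i <;> fin_cases j <;> simp [matDeriv, chart, hp]

lemma contDiff_chart (i j : Fin 2) : ContDiff ℝ ∞ (fun t => chart t i j) := by
  fin_cases i <;> fin_cases j <;> simp [chart] <;> fun_prop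

/-- The chart coordinates among the parameters of the extended family. -/
def chartCoord (r : ℕ) : (Fin (3 + r) → ℝ) →L[ℝ] (Fin 3 → ℝ) :=
  ContinuousLinearMap.pi fun i => ContinuousLinearMap.proj (Fin.castAdd r i)

/-- The parameters of the base family among those of the extended family. -/
def baseCoord (r : ℕ) : (Fin (3 + r) → ℝ) →L[ℝ] (Fin r → ℝ) :=
  ContinuousLinearMap.pi fun i => ContinuousLinearMap.proj (Fin.natAdd 3 i)

lemma eq_zero_of_coord {v : Fin (3 + r) → ℝ} (h1 : chartCoord r v = 0) (h2 : baseCoord r v = 0) :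
    v = 0 := by
  funext i
  exact Fin.addCases (fun i => congrFun h1 i) (fun i => congrFun h2 i) i

/-- The family of the projective transforms `chart · b`. -/
def chartFamily (b : (Fin r → ℝ) → Plane → Matrix (Fin 2) (Fin 2) ℝ) (t : Fin (3 + r) → ℝ)
    (x : Plane) : Matrix (Fin 2) (Fin 2) ℝ :=
  chart (chartCoord r t) * b (baseCoord r t) x

/-- The parameters of the extended family for which the projective transformation is invertible. -/
def chartDomain (O : Set (Fin r → ℝ)) : Set (Fin (3 + r) → ℝ) :=
  {t | (chart (chartCoord r t)).det ≠ 0 ∧ baseCoord r t ∈ O}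

lemma mul_right_cancel_of_det {A A' B : Matrix (Fin 2) (Fin 2) ℝ} (hB : B.det ≠ 0)
    (h : A * B = A' * B) : A = A' := by
  rw [← Matrix.mul_nonsing_inv_cancel_right _ A hB.isUnit, h,
    Matrix.mul_nonsing_inv_cancel_right _ A' hB.isUnit]

lemma mul_left_cancel_of_det {A A' B : Matrix (Fin 2) (Fin 2) ℝ} (hB : B.det ≠ 0)
    (h : B * A = B * A') : A = A' := by
  rw [← Matrix.nonsing_inv_mul_cancel_left _ A hB.isUnit, h,
    Matrix.nonsing_inv_mul_cancel_left _ A' hB.isUnit]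

variable {O : Set (Fin r → ℝ)} {W : Set Plane}
  {b : (Fin r → ℝ) → Plane → Matrix (Fin 2) (Fin 2) ℝ}

lemma IsBaseFamily.differentiableAt (h : IsBaseFamily g U s O W b) {ϑ : Fin r → ℝ} (hϑ : ϑ ∈ O)
    {x : Plane} (hx : x ∈ W) (i j : Fin 2) : DifferentiableAt ℝ (fun τ => b τ x i j) ϑ :=
  differentiableAt_param (f := fun τ x => b τ x i j) h.isOpen_param h.isOpen_base (h.smooth i j)
    hϑ hx

lemma IsBaseFamily.matDeriv_at (h : IsBaseFamily g U s O W b) {ϑ : Fin r → ℝ} (hϑ : ϑ ∈ O)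
    (v : Fin r → ℝ) : matDeriv (fun τ => b τ s) ϑ v = 0 := by
  ext i j
  have : (fun τ => b τ s i j) =ᶠ[𝓝 ϑ] fun _ => b ϑ s i j :=
    Filter.eventually_of_mem (h.isOpen_param.mem_nhds hϑ) fun τ hτ =>
      congrFun (congrFun (h.const_at τ hτ ϑ hϑ) i) j
  simp [matDeriv, this.fderiv_eq]

lemma IsBaseFamily.const_mul (h : IsBaseFamily g U s O W b) (hU : IsOpen U)
    (hg : IsRiemannianMetricOn g U) {Q : Matrix (Fin 2) (Fin 2) ℝ} (hQ : Q.det ≠ 0) :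
    IsBaseFamily g U s O W (fun ϑ x => Q * b ϑ x) where
  isOpen_param := h.isOpen_param
  isOpen_base := h.isOpen_base
  base_subset := h.base_subset
  mem_base := h.mem_base
  smooth i j := by
    simp only [Matrix.mul_apply, Fin.sum_univ_two]
    exact (contDiffOn_const.mul (h.smooth 0 j)).add (contDiffOn_const.mul (h.smooth 1 j))
  integral ϑ hϑ := (h.integral ϑ hϑ).const_mul hU hg h.isOpen_base h.base_subset hQ
  const_at ϑ hϑ ϑ' hϑ' := by rw [h.const_at ϑ hϑ ϑ' hϑ']
  effective ϑ hϑ v hv := by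
    refine h.effective ϑ hϑ v ?_
    filter_upwards [hv, h.isOpen_base.mem_nhds h.mem_base] with x ⟨l, hl⟩ hx
    refine ⟨l, mul_left_cancel_of_det hQ ?_⟩
    rw [matDeriv_mul (A := fun _ => Q) (B := fun τ => b τ x) (fun _ _ => differentiableAt_const _)
      (h.differentiableAt hϑ hx), matDeriv_const, zero_mul, zero_add] at hl
    rw [hl, Matrix.mul_smul]

/-- The orbits of a base family under projective transformations form an effective family. -/
theorem IsBaseFamily.isIntegralFamily (h : IsBaseFamily g U s O W b) (hU : IsOpen U)
    (hg : IsRiemannianMetricOn g U) :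
    IsIntegralFamily g U s (3 + r) (chartDomain O) W (chartFamily b) where
  isOpen_param := by
    refine IsOpen.inter ?_ (h.isOpen_param.preimage (baseCoord r).continuous)
    refine isOpen_ne_fun ?_ continuous_const
    simp only [Matrix.det_fin_two]
    have : ∀ i j, Continuous fun t => chart (chartCoord r t) i j := fun i j =>
      (contDiff_chart i j).continuous.comp (chartCoord r).continuous
    exact ((this 0 0).mul (this 1 1)).sub ((this 0 1).mul (this 1 0))
  isOpen_base := h.isOpen_base
  base_subset := h.base_subset
  mem_base := h.mem_base
  smooth i j := by
    have h1 : ∀ i j, ContDiffOn ℝ ∞ (fun z : (Fin (3 + r) → ℝ) × Plane =>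
        chart (chartCoord r z.1) i j) (chartDomain O ×ˢ W) := fun i j =>
      ((contDiff_chart i j).comp ((chartCoord r).contDiff.comp contDiff_fst)).contDiffOn
    have h2 : ∀ i j, ContDiffOn ℝ ∞ (fun z : (Fin (3 + r) → ℝ) × Plane =>
        b (baseCoord r z.1) z.2 i j) (chartDomain O ×ˢ W) := fun i j =>
      (h.smooth i j).comp (f := fun z : (Fin (3 + r) → ℝ) × Plane => (baseCoord r z.1, z.2))
        (((baseCoord r).contDiff.comp contDiff_fst).prodMk contDiff_snd).contDiffOn
        fun z hz => ⟨hz.1.2, hz.2⟩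
    simp only [chartFamily, Matrix.mul_apply, Fin.sum_univ_two]
    exact ((h1 i 0).mul (h2 0 j)).add ((h1 i 1).mul (h2 1 j))
  integral t ht := (h.integral _ ht.2).const_mul hU hg h.isOpen_base h.base_subset ht.1
  effective t ht v hv := by
    have hchart : ∀ i j, DifferentiableAt ℝ (fun τ => chart τ i j) (chartCoord r t) := fun i j =>
      (contDiff_chart i j).differentiable (by simp) _
    have key : ∀ᶠ x in 𝓝 s, x ∈ W ∧ ∃ l : ℝ,
        !![0, chartCoord r v 0; chartCoord r v 1, chartCoord r v 2] * b (baseCoord r t) x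
          + chart (chartCoord r t) * matDeriv (fun τ => b τ x) (baseCoord r t) (baseCoord r v)
          = l • (chart (chartCoord r t) * b (baseCoord r t) x) := by
      filter_upwards [hv, h.isOpen_base.mem_nhds h.mem_base] with x hx hxW
      refine ⟨hxW, ?_⟩
      have d1 : ∀ i j, DifferentiableAt ℝ (fun τ => chart (chartCoord r τ) i j) t := fun i j =>
        (hchart i j).comp t (chartCoord r).differentiableAt
      have d2 : ∀ i j, DifferentiableAt ℝ (fun τ => b (baseCoord r τ) x i j) t := fun i j =>
        DifferentiableAt.comp t (g := fun τ => b τ x i j) (h.differentiableAt ht.2 hxW i j)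
          (baseCoord r).differentiableAt
      obtain ⟨l, hl⟩ := exists_matDeriv_eq_smul (A := fun τ => chartFamily b τ x) (v := v)
        (differentiableAt_matrix_mul d1 d2)
        (by
          rw [chartFamily, Matrix.det_mul]
          exact mul_ne_zero ht.1 ((h.integral _ ht.2).det_ne_zero x hxW)) hx
      refine ⟨l, ?_⟩
      simp only [chartFamily] at hl
      rw [matDeriv_mul d1 d2, matDeriv_comp hchart (chartCoord r).differentiableAt,
        matDeriv_comp (A := fun τ => b τ x) (h.differentiableAt ht.2 hxW)
          (baseCoord r).differentiableAt, matDeriv_chart, ContinuousLinearMap.fderiv,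
        ContinuousLinearMap.fderiv] at hl
      exact hl
    -- at the point `s` only the chart varies, and its upper left entry is normalized
    have h1 : chartCoord r v = 0 := by
      obtain ⟨-, l, hl⟩ := key.self_of_nhds
      rw [h.matDeriv_at ht.2, mul_zero, add_zero, ← Matrix.smul_mul] at hl
      have hm := mul_right_cancel_of_det ((h.integral _ ht.2).det_ne_zero s h.mem_base) hl
      have hl0 : l = 0 := by simpa [chart] using (congrFun (congrFun hm 0) 0).symm
      rw [hl0, zero_smul] at hm
      funext i
      fin_cases i
      · exact congrFun (congrFun hm 0) 1
      · exact congrFun (congrFun hm 1) 0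
      · exact congrFun (congrFun hm 1) 1
    refine eq_zero_of_coord h1 (h.effective _ ht.2 _ ?_)
    filter_upwards [key] with x ⟨_, l, hl⟩
    refine ⟨l, mul_left_cancel_of_det ht.1 ?_⟩
    have hz : !![(0 : ℝ), chartCoord r v 0; chartCoord r v 1, chartCoord r v 2] = 0 := by
      ext i j
      fin_cases i <;> fin_cases j <;> simp [h1]
    rw [hz, zero_mul, zero_add] at hl
    rw [hl, Matrix.mul_smul]

/-- The transposition of numerator and denominator. -/
def swap : Matrix (Fin 2) (Fin 2) ℝ := !![0, 1; 1, 0]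

/-- Two charts cover the group of projective transformations. -/
lemma exists_chart {m : Matrix (Fin 2) (Fin 2) ℝ} (hm : m.det ≠ 0) :
    ∃ k : ℝ, k ≠ 0 ∧ ∃ t, m = k • chart t ∨ m = k • (chart t * swap) := by
  by_cases h : m 0 0 = 0
  · have h' : m 0 1 ≠ 0 := by
      intro h'
      exact hm (by rw [Matrix.det_fin_two, h, h']; ring)
    refine ⟨m 0 1, h', ![m 0 0 / m 0 1, m 1 1 / m 0 1, m 1 0 / m 0 1], Or.inr ?_⟩
    ext i j
    fin_cases i <;> fin_cases j <;> simp [chart, swap, h] <;> field_simp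
  · refine ⟨m 0 0, h, ![m 0 1 / m 0 0, m 1 0 / m 0 0, m 1 1 / m 0 0], Or.inl ?_⟩
    ext i j
    fin_cases i <;> fin_cases j <;> simp [chart] <;> field_simp

/-- Countably many base families that contain all integrals up to projective transformations
give countably many effective families that contain all integrals. -/
lemma exists_covering (hU : IsOpen U) (hg : IsRiemannianMetricOn g U)
    {O : ℕ → Set (Fin r → ℝ)} {W : ℕ → Set Plane}
    {b : ℕ → (Fin r → ℝ) → Plane → Matrix (Fin 2) (Fin 2) ℝ}
    (h : ∀ n, IsBaseFamily g U s (O n) (W n) (b n))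
    (hcov : ∀ c', IsLocalIntegral g U s c' → ∃ n, ∃ ϑ ∈ O n, ∃ m : Matrix (Fin 2) (Fin 2) ℝ,
      m.det ≠ 0 ∧ ∀ᶠ x in 𝓝 s, ∃ f : ℝ, f ≠ 0 ∧ c' x = f • (m * b n ϑ x)) :
    ∃ (O : ℕ → Set (Fin (3 + r) → ℝ)) (W : ℕ → Set Plane)
      (c : ℕ → (Fin (3 + r) → ℝ) → Plane → Matrix (Fin 2) (Fin 2) ℝ),
    (∀ n, IsIntegralFamily g U s (3 + r) (O n) (W n) (c n)) ∧
    ∀ c', IsLocalIntegral g U s c' → ∃ n, ∃ t ∈ O n, SameGerm s (c n t) c' := by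
  set Q : Bool → Matrix (Fin 2) (Fin 2) ℝ := fun β => cond β swap 1 with hQdef
  have hQ : ∀ β, (Q β).det ≠ 0 := by
    intro β
    cases β <;> simp [Q, swap]
  refine ⟨fun n => chartDomain (O n.div2), fun n => W n.div2,
    fun n => chartFamily fun ϑ x => Q n.bodd * b n.div2 ϑ x,
    fun n => ((h n.div2).const_mul hU hg (hQ n.bodd)).isIntegralFamily hU hg, fun c' hc' => ?_⟩
  obtain ⟨n, ϑ, hϑ, m, hm, hev⟩ := hcov c' hc'
  obtain ⟨k, hk, t, ht⟩ := exists_chart hm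
  obtain ⟨β, hβ⟩ : ∃ β, m = k • (chart t * Q β) := by
    rcases ht with ht | ht
    · exact ⟨false, by simpa [Q] using ht⟩
    · exact ⟨true, ht⟩
  have e1 : chartCoord r (Fin.append t ϑ) = t := by
    funext i
    exact Fin.append_left t ϑ i
  have e2 : baseCoord r (Fin.append t ϑ) = ϑ := by
    funext i
    exact Fin.append_right t ϑ i
  refine ⟨Nat.bit β n, Fin.append t ϑ, ⟨?_, ?_⟩, ?_⟩
  · rw [e1]
    intro h0
    rw [hβ, Matrix.det_smul, Matrix.det_mul, h0] at hm
    simp at hm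
  · rw [e2, Nat.div2_bit]
    exact hϑ
  · filter_upwards [hev] with x ⟨f, hf, hx⟩ p _ _
    refine (fracLin_smul _ (mul_ne_zero hf hk) ?_ p).symm
    rw [hx, hβ, chartFamily, e1, e2, Nat.div2_bit, Nat.bodd_bit, Matrix.smul_mul, smul_smul,
      Matrix.mul_assoc]

/-- The upper bound for the number of parameters of an effective family of integrals that are
projectively equivalent to members of a base family. -/
theorem IsIntegralFamily.card_le {k : ℕ} {O : Set (Fin k → ℝ)} {W : Set Plane}
    {c : (Fin k → ℝ) → Plane → Matrix (Fin 2) (Fin 2) ℝ} (h : IsIntegralFamily g U s k O W c)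
    {t₀ : Fin k → ℝ} (ht : t₀ ∈ O) {Ob : Set (Fin r → ℝ)} {Wb : Set Plane}
    {b : (Fin r → ℝ) → Plane → Matrix (Fin 2) (Fin 2) ℝ} (hb : IsBaseFamily g U s Ob Wb b)
    {ϑ : (Fin k → ℝ) → Fin r → ℝ} (hϑ : DifferentiableAt ℝ ϑ t₀) (hϑO : ∀ᶠ τ in 𝓝 t₀, ϑ τ ∈ Ob)
    (hcb : ∀ᶠ x in 𝓝 s, ∀ᶠ τ in 𝓝 t₀, ∃ f : ℝ, f ≠ 0 ∧
      c τ x = f • (c τ s * (b (ϑ τ) s)⁻¹ * b (ϑ τ) x)) : k ≤ 3 + r := by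
  have hϑ₀ : ϑ t₀ ∈ Ob := hϑO.self_of_nhds
  have hcd : ∀ x ∈ W, ∀ i j, DifferentiableAt ℝ (fun τ => c τ x i j) t₀ := fun x hx i j =>
    differentiableAt_param (f := fun τ x => c τ x i j) h.isOpen_param h.isOpen_base (h.smooth i j)
      ht hx
  have hcs := hcd s h.mem_base
  -- The direction `v` leaves the integral unchanged to first order if its image under the
  -- derivative of the value at `s` is a multiple of that value and it does not change `ϑ`. The
  -- linear map `L` expresses this, so it is injective, from dimension `k + 1` to dimension `4 + r`.
  let L : ((Fin k → ℝ) × ℝ) →ₗ[ℝ] (Matrix (Fin 2) (Fin 2) ℝ × (Fin r → ℝ)) :=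
    { toFun := fun z => (matDeriv (fun τ => c τ s) t₀ z.1 - z.2 • c t₀ s, fderiv ℝ ϑ t₀ z.1)
      map_add' := by
        intro z z'
        refine Prod.ext ?_ (by simp)
        ext i j
        simp [matDeriv]
        ring
      map_smul' := by
        intro a z
        refine Prod.ext ?_ (by simp)
        ext i j
        simp [matDeriv]
        ring }
  have hinj : Function.Injective L := by
    rw [injective_iff_map_eq_zero]
    rintro ⟨v, l⟩ hz
    have hz1 : matDeriv (fun τ => c τ s) t₀ v = l • c t₀ s := sub_eq_zero.1 (congrArg Prod.fst hz)
    have hz2 : fderiv ℝ ϑ t₀ v = 0 := congrArg Prod.snd hz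
    have hv : v = 0 := by
      refine h.effective t₀ ht v ?_
      filter_upwards [hcb, h.isOpen_base.mem_nhds h.mem_base, hb.isOpen_base.mem_nhds hb.mem_base]
        with x hx hxW hxb p hp
      set B := (b (ϑ t₀) s)⁻¹ with hB
      set A : (Fin k → ℝ) → Matrix (Fin 2) (Fin 2) ℝ := fun τ => c τ s * B * b (ϑ τ) x with hA
      have hfx : ∀ᶠ τ in 𝓝 t₀, ∃ f : ℝ, f ≠ 0 ∧ c τ x = f • A τ := by
        filter_upwards [hx, hϑO] with τ ⟨f, hf, e⟩ hτ
        exact ⟨f, hf, by rw [e, hb.const_at _ hτ _ hϑ₀]⟩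
      have heq : (fun τ => fracLin (c τ) (x, p)) =ᶠ[𝓝 t₀]
          fun τ => (A τ *ᵥ p) 0 / (A τ *ᵥ p) 1 := by
        filter_upwards [hfx] with τ ⟨f, hf, e⟩
        exact fracLin_smul (fun _ => A τ) hf e p
      have d1 : ∀ i j, DifferentiableAt ℝ (fun τ => (c τ s * B) i j) t₀ :=
        differentiableAt_matrix_mul hcs fun _ _ => differentiableAt_const _
      have d2 : ∀ i j, DifferentiableAt ℝ (fun τ => b (ϑ τ) x i j) t₀ := fun i j =>
        DifferentiableAt.comp t₀ (g := fun τ => b τ x i j) (hb.differentiableAt hϑ₀ hxb i j) hϑ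
      rw [heq.fderiv_eq]
      refine fderiv_mulVec_div_eq_zero (l := l) (differentiableAt_matrix_mul d1 d2) ?_ p ?_
      · rw [matDeriv_mul d1 d2,
          matDeriv_mul (B := fun _ => B) hcs fun _ _ => differentiableAt_const _,
          matDeriv_comp (A := fun τ => b τ x) (hb.differentiableAt hϑ₀ hxb) hϑ, hz1, hz2]
        simp
      · obtain ⟨f, hf, e⟩ := hfx.self_of_nhds
        rw [denom_smul (fun _ => A t₀) e p] at hp
        exact right_ne_zero_of_mul hp
    subst hv
    rw [matDeriv_zero] at hz1
    have hl : l = 0 := by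
      by_contra hl
      have : c t₀ s = 0 := (smul_eq_zero.1 hz1.symm).resolve_left hl
      exact (h.integral t₀ ht).det_ne_zero s h.mem_base (by rw [this]; simp)
    rw [hl]
    rfl
  have := LinearMap.finrank_le_finrank_of_injective hinj
  simp [Module.finrank_prod, Module.finrank_matrix] at this
  omega

end BaseFamily

/-! ### The dimension for constant curvature -/

section ConstantCurvature

variable {U : Set Plane} {g : Plane → Matrix (Fin 2) (Fin 2) ℝ} {s : Plane}
  {c : Plane → Matrix (Fin 2) (Fin 2) ℝ} {u : Fin 2 → Plane → ℝ}

lemma transvection_eq_one (hu : ∀ a, u a s = 0) (ϑ : Fin 2 → ℝ) : transvection u ϑ s = 1 := by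
  ext a b
  fin_cases a <;> fin_cases b <;> simp [transvection, hu]

lemma matDeriv_transvection (ϑ v : Fin 2 → ℝ) (x : Plane) :
    matDeriv (fun τ => transvection u τ x) ϑ v
      = !![-(v 0 * u 1 x), v 0 * u 0 x; -(v 1 * u 1 x), v 1 * u 0 x] := by
  have h : ∀ i, HasFDerivAt (fun τ : Fin 2 → ℝ => τ i)
      (ContinuousLinearMap.proj (R := ℝ) (φ := fun _ : Fin 2 => ℝ) i) ϑ := fun i =>
    (ContinuousLinearMap.proj (R := ℝ) (φ := fun _ : Fin 2 => ℝ) i).hasFDerivAt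
  ext i j
  fin_cases i <;> fin_cases j
  · change fderiv ℝ (fun τ : Fin 2 → ℝ => 1 - τ 0 * u 1 x) ϑ v = _
    rw [(((h 0).mul_const (u 1 x)).const_sub 1).fderiv]
    simp [mul_comm]
  · change fderiv ℝ (fun τ : Fin 2 → ℝ => τ 0 * u 0 x) ϑ v = _
    rw [((h 0).mul_const (u 0 x)).fderiv]
    simp [mul_comm]
  · change fderiv ℝ (fun τ : Fin 2 → ℝ => -(τ 1 * u 1 x)) ϑ v = _
    rw [((h 1).mul_const (u 1 x)).fun_neg.fderiv]
    simp [mul_comm]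
  · change fderiv ℝ (fun τ : Fin 2 → ℝ => 1 + τ 1 * u 0 x) ϑ v = _
    rw [(((h 1).mul_const (u 0 x)).const_add 1).fderiv]
    simp [mul_comm]

lemma isBaseFamily_transvection {W : Set Plane} (hc : IsIntegralOn g W c) (hU : IsOpen U)
    (hg : IsRiemannianMetricOn g U) (hW : IsOpen W) (hWU : W ⊆ U)
    (hus : ∀ a, ContDiffOn ℝ ∞ (u a) W)
    (hu : ∀ x ∈ W, ∀ a i, partialDeriv i (u a) x = coframe g c x a i)
    (hs : s ∈ W) (hus0 : ∀ a, u a s = 0) {O : Set (Fin 2 → ℝ)} (hO : IsOpen O)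
    (hdet : ∀ ϑ ∈ O, ∀ x ∈ W, (transvection u ϑ x).det ≠ 0) :
    IsBaseFamily g U s O W (fun ϑ x => transvection u ϑ x * c x) where
  isOpen_param := hO
  isOpen_base := hW
  base_subset := hWU
  mem_base := hs
  smooth i j := by
    have h1 := fun i j => (contDiffOn_transvection_param hus i j).mono
      (Set.prod_mono (Set.subset_univ O) subset_rfl)
    have h2 : ∀ i j, ContDiffOn ℝ ∞ (fun z : (Fin 2 → ℝ) × Plane => c z.2 i j) (O ×ˢ W) :=
      fun i j => (hc.smooth i j).comp contDiffOn_snd fun z hz => hz.2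
    simp only [Matrix.mul_apply, Fin.sum_univ_two]
    exact ((h1 i 0).mul (h2 0 j)).add ((h1 i 1).mul (h2 1 j))
  integral ϑ hϑ := hc.transvection_mul hU hg hW hWU hus hu (hdet ϑ hϑ)
  const_at ϑ _ ϑ' _ := by rw [transvection_eq_one hus0, transvection_eq_one hus0]
  effective ϑ hϑ v hv := by
    have hz : ∀ᶠ x in 𝓝 s, ∀ a b, v a * u b x = 0 := by
      filter_upwards [hv, hW.mem_nhds hs] with x ⟨l, hl⟩ hx
      have hd : ∀ i j, DifferentiableAt ℝ (fun τ => transvection u τ x i j) ϑ := fun i j =>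
        differentiableAt_param (f := fun τ x => transvection u τ x i j) isOpen_univ hW
          (contDiffOn_transvection_param hus i j) (Set.mem_univ ϑ) hx
      rw [matDeriv_mul (B := fun _ => c x) hd (fun _ _ => differentiableAt_const _), matDeriv_const,
        mul_zero, add_zero, ← Matrix.smul_mul] at hl
      have hm := mul_right_cancel_of_det (hc.det_ne_zero x hx) hl
      rw [matDeriv_transvection] at hm
      -- the left hand side has rank one, while the right hand side is a multiple of an
      -- invertible matrix
      have hl0 : l = 0 := by
        have h := congrArg Matrix.det hm
        rw [Matrix.det_smul, Matrix.det_fin_two_of] at h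
        have h' : l ^ 2 * (transvection u ϑ x).det = 0 := by
          rw [Fintype.card_fin] at h
          rw [← h]
          ring
        simpa [hdet ϑ hϑ x hx] using h'
      rw [hl0, zero_smul] at hm
      have e := fun a b => congrFun (congrFun hm a) b
      have e00 := e 0 0
      have e01 := e 0 1
      have e10 := e 1 0
      have e11 := e 1 1
      simp only [Matrix.of_apply, Matrix.cons_val', Matrix.cons_val_zero, Matrix.cons_val_one,
        Matrix.cons_val_fin_one, Matrix.zero_apply, neg_eq_zero] at e00 e01 e10 e11
      intro a b
      obtain rfl | rfl : a = 0 ∨ a = 1 := by omega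
      all_goals
        obtain rfl | rfl : b = 0 ∨ b = 1 := by omega
        all_goals assumption
    have hN := det_coframe_ne_zero hg (hWU hs) (hc.det_ne_zero s hs)
    funext a
    by_contra ha
    have hN0 : ∀ b i, coframe g c s b i = 0 := by
      intro b i
      rw [← hu s hs]
      have : u b =ᶠ[𝓝 s] fun _ => 0 := hz.mono fun x hx => (mul_eq_zero.1 (hx a b)).resolve_left ha
      simp [partialDeriv, this.fderiv_eq]
    exact hN (by simp [Matrix.det_fin_two, hN0])

/-- Bounded parameters give transvections that are invertible over a common neighbourhood. -/
lemma exists_ball_det_transvection_ne_zero {W : Set Plane} (hW : IsOpen W) (hs : s ∈ W)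
    (hus : ∀ a, ContDiffOn ℝ ∞ (u a) W) (hus0 : ∀ a, u a s = 0) {R : ℝ} (hR : 0 < R) :
    ∃ ε > 0, Metric.ball s ε ⊆ W ∧ ∀ ϑ ∈ Metric.ball (0 : Fin 2 → ℝ) R, ∀ x ∈ Metric.ball s ε,
      (transvection u ϑ x).det ≠ 0 := by
  have h : ∀ a, ∀ᶠ x in 𝓝 s, |u a x| < 1 / (2 * R) := by
    intro a
    have hcont : ContinuousAt (fun x => |u a x|) s :=
      (differentiableAt_of_contDiffOn hW (hus a) hs).continuousAt.abs
    refine hcont.eventually_lt continuousAt_const ?_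
    rw [hus0, abs_zero]
    positivity
  obtain ⟨ε, hε, hb⟩ := Metric.eventually_nhds_iff_ball.1
    ((hW.eventually_mem hs).and ((h 0).and (h 1)))
  refine ⟨ε, hε, fun x hx => (hb x hx).1, fun ϑ hϑ x hx => ?_⟩
  obtain ⟨-, h0, h1⟩ := hb x hx
  rw [mem_ball_zero_iff] at hϑ
  have hprod : ∀ a b, |u a x| < 1 / (2 * R) → |ϑ b * u a x| < 1 / 2 := by
    intro a b ha
    have hϑb : |ϑ b| < R := (norm_le_pi_norm ϑ b).trans_lt hϑ
    rw [abs_mul]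
    calc |ϑ b| * |u a x| ≤ R * |u a x| := by gcongr
      _ < R * (1 / (2 * R)) := by gcongr
      _ = 1 / 2 := by field_simp
  have e0 := abs_lt.1 (hprod 1 0 h1)
  have e1 := abs_lt.1 (hprod 0 1 h0)
  rw [det_transvection]
  linarith [e0.2, e1.1]

lemma mu_eq_zero {W : Set Plane} (hU : IsOpen U) (hg : IsRiemannianMetricOn g U) (hW : IsOpen W)
    (hWU : W ⊆ U) (hc : IsIntegralOn g W c) {κ : ℝ} (hκ : ∀ x ∈ W, gaussianCurvature g x = κ)
    (hs : s ∈ W) : mu g c s = 0 :=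
  congrArg (fun f : smoothFn ⟨W, hW⟩ => f.1 ⟨s, hs⟩)
    (muFn_eq_zero (W := ⟨W, hW⟩) hU hg hWU hc hκ)

/-- The parameter for which the transvection changes `υ` at `s` by `δ`. -/
def transvectionParam (N : Matrix (Fin 2) (Fin 2) ℝ) (δ : Fin 2 → ℝ) : Fin 2 → ℝ :=
  ![(δ 1 * N 0 0 - δ 0 * N 0 1) / N.det, (δ 1 * N 1 0 - δ 0 * N 1 1) / N.det]

lemma transvectionParam_spec {N : Matrix (Fin 2) (Fin 2) ℝ} (hN : N.det ≠ 0) (δ : Fin 2 → ℝ)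
    (j : Fin 2) : transvectionParam N δ 1 * N 0 j - transvectionParam N δ 0 * N 1 j = -δ j := by
  have hN' := Matrix.det_fin_two N
  obtain rfl | rfl : j = 0 ∨ j = 1 := by omega
  all_goals
    simp only [transvectionParam, Matrix.cons_val_zero, Matrix.cons_val_one]
    field_simp
    rw [hN']
    ring

/-- On a surface of constant curvature every integral is a projective transform of a member of
the family obtained from one integral by transvections. -/
lemma exists_smul_eq_transvection {W : Set Plane} (hc : IsIntegralOn g W c) (hU : IsOpen U)
    (hg : IsRiemannianMetricOn g U) (hW : IsOpen W) (hWc : Convex ℝ W) (hWU : W ⊆ U)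
    (hus : ∀ a, ContDiffOn ℝ ∞ (u a) W)
    (hu : ∀ x ∈ W, ∀ a i, partialDeriv i (u a) x = coframe g c x a i)
    (hs : s ∈ W) (hus0 : ∀ a, u a s = 0) {κ : ℝ} (hκ : ∀ x ∈ W, gaussianCurvature g x = κ)
    {c' : Plane → Matrix (Fin 2) (Fin 2) ℝ} (hc' : IsIntegralOn g W c') {ϑ : Fin 2 → ℝ}
    (hϑ : ϑ = transvectionParam (coframe g c s) fun j => upsilon g c' j s - upsilon g c j s)
    (hdet : ∀ x ∈ W, (transvection u ϑ x).det ≠ 0) :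
    ∃ f : Plane → ℝ, ∀ x ∈ W, f x ≠ 0 ∧
      c' x = f x • (c' s * (transvection u ϑ s * c s)⁻¹ * (transvection u ϑ x * c x)) := by
  have hb := hc.transvection_mul hU hg hW hWU hus hu hdet
  refine exists_smul_eq_of_jet_eq (W := ⟨W, hW⟩) hU hg hWc hWU hb hc' hs (fun j => ?_) ?_
  · rw [upsilon_transvection_mul hc hU hg hW hWU hus hu ϑ hs hus0, hϑ,
      transvectionParam_spec (det_coframe_ne_zero hg (hWU hs) (hc.det_ne_zero s hs))]
    ring
  · rw [mu_eq_zero hU hg hW hWU hb hκ hs, mu_eq_zero hU hg hW hWU hc' hκ hs]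

/-- If the curvature is constant, the space of integrals has dimension `5`: three parameters of a
projective transformation and two of a transvection. -/
theorem integralSpaceHasDim_five (hU : IsOpen U) (hg : IsRiemannianMetricOn g U)
    (hI : ∃ c, IsLocalIntegral g U s c) (hK : HasConstantCurvatureNear g s) :
    IntegralSpaceHasDim g U s 5 := by
  obtain ⟨c₀, W₀, hW₀, hW₀U, hsW₀, hc₀⟩ := hI
  obtain ⟨κ, hκ⟩ := hK
  obtain ⟨ε, hε, hb⟩ := Metric.eventually_nhds_iff_ball.1
    ((hW₀.eventually_mem hsW₀).and hκ)
  set W : Set Plane := Metric.ball s ε with hWdef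
  have hW : IsOpen W := Metric.isOpen_ball
  have hWU : W ⊆ U := fun x hx => hW₀U (hb x hx).1
  have hsW : s ∈ W := Metric.mem_ball_self hε
  have hκW : ∀ x ∈ W, gaussianCurvature g x = κ := fun x hx => (hb x hx).2
  have hc₁ : IsIntegralOn g W c₀ := hc₀.mono fun x hx => (hb x hx).1
  obtain ⟨c, u, hc, hus, hus0, hu⟩ := exists_potentials (W := ⟨W, hW⟩) (convex_ball s ε) hU hg hWU
    hc₁ (muFn_eq_zero (W := ⟨W, hW⟩) hU hg hWU hc₁ hκW) (s := s)
  set Θ : (Plane → Matrix (Fin 2) (Fin 2) ℝ) → Fin 2 → ℝ := fun c' =>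
    transvectionParam (coframe g c s) fun j => upsilon g c' j s - upsilon g c j s with hΘ
  have hpos : ∀ n : ℕ, (0 : ℝ) < n + 1 := fun n => by positivity
  -- parameters of norm less than `n + 1` are admissible over the ball of radius `δ n`
  choose δ hδ hδW hδdet using fun n : ℕ =>
    exists_ball_det_transvection_ne_zero hW hsW hus hus0 (hpos n)
  set b : (Fin 2 → ℝ) → Plane → Matrix (Fin 2) (Fin 2) ℝ := fun ϑ x =>
    transvection u ϑ x * c x with hbdef
  have hbase : ∀ n : ℕ, IsBaseFamily g U s (Metric.ball 0 (n + 1)) (Metric.ball s (δ n)) b :=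
    fun n => isBaseFamily_transvection (hc.mono (hδW n)) hU hg Metric.isOpen_ball
      ((hδW n).trans hWU) (fun a => (hus a).mono (hδW n)) (fun x hx => hu x (hδW n hx))
      (Metric.mem_ball_self (hδ n)) hus0 Metric.isOpen_ball (hδdet n)
  have hnf : ∀ (n : ℕ) {r : ℝ} {c' : Plane → Matrix (Fin 2) (Fin 2) ℝ}, 0 < r →
      Metric.ball s r ⊆ Metric.ball s (δ n) → IsIntegralOn g (Metric.ball s r) c' →
      Θ c' ∈ Metric.ball 0 ((n : ℝ) + 1) → ∃ f : Plane → ℝ, ∀ x ∈ Metric.ball s r, f x ≠ 0 ∧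
        c' x = f x • (c' s * (b (Θ c') s)⁻¹ * b (Θ c') x) := by
    intro n r c' hr hsub hc' hn
    have hsub' := hsub.trans (hδW n)
    exact exists_smul_eq_transvection (hc.mono hsub') hU hg Metric.isOpen_ball
      (convex_ball s r) (hsub'.trans hWU) (fun a => (hus a).mono hsub')
      (fun x hx => hu x (hsub' hx)) (Metric.mem_ball_self hr) hus0 (fun x hx => hκW x (hsub' hx))
      hc' rfl fun x hx => hδdet n _ hn x (hsub hx)
  have hex : ∀ ϑ : Fin 2 → ℝ, ∃ n : ℕ, ϑ ∈ Metric.ball 0 ((n : ℝ) + 1) := by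
    intro ϑ
    obtain ⟨n, hn⟩ := exists_nat_gt ‖ϑ‖
    exact ⟨n, mem_ball_zero_iff.2 (hn.trans (lt_add_one _))⟩
  refine ⟨exists_covering (r := 2) hU hg hbase ?_, ?_⟩
  · rintro c' ⟨W', hW', -, hsW', hc'⟩
    obtain ⟨n, hn⟩ := hex (Θ c')
    obtain ⟨r, hr, hball⟩ := Metric.isOpen_iff.1 (hW'.inter (Metric.isOpen_ball (ε := δ n))) s
      ⟨hsW', Metric.mem_ball_self (hδ n)⟩
    obtain ⟨f, hf⟩ := hnf n hr (fun x hx => (hball hx).2) (hc'.mono fun x hx => (hball hx).1) hn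
    refine ⟨n, Θ c', hn, c' s * (b (Θ c') s)⁻¹, ?_, ?_⟩
    · rw [Matrix.det_mul]
      refine mul_ne_zero (hc'.det_ne_zero s hsW') ?_
      exact (Matrix.isUnit_nonsing_inv_det _ (((hbase n).integral _ hn).det_ne_zero s
        (Metric.mem_ball_self (hδ n))).isUnit).ne_zero
    · filter_upwards [Metric.ball_mem_nhds s hr] with x hx
      exact ⟨f x, hf x hx⟩
  · intro k O W' cf h hne
    obtain ⟨t₀, ht⟩ := hne
    obtain ⟨n, hn⟩ := hex (Θ (cf t₀))
    have hdiff : DifferentiableAt ℝ (fun τ => Θ (cf τ)) t₀ := by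
      have hυ : ∀ j, DifferentiableAt ℝ (fun τ => upsilon g (cf τ) j s) t₀ := fun j =>
        differentiableAt_param (f := fun τ x => upsilon g (cf τ) j x) h.isOpen_param h.isOpen_base
          (contDiffOn_upsilon_param hU hg h.isOpen_param h.isOpen_base h.base_subset h.smooth
            (fun t ht => (h.integral t ht).det_ne_zero) j) ht h.mem_base
      rw [differentiableAt_pi]
      intro i
      fin_cases i
      all_goals
        simp [Θ, transvectionParam]
        fun_prop
    refine h.card_le ht (hbase n) hdiff
      (hdiff.continuousAt.eventually (Metric.isOpen_ball.mem_nhds hn)) ?_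
    obtain ⟨r, hr, hball⟩ := Metric.isOpen_iff.1
      (h.isOpen_base.inter (Metric.isOpen_ball (ε := δ n))) s
      ⟨h.mem_base, Metric.mem_ball_self (hδ n)⟩
    filter_upwards [Metric.ball_mem_nhds s hr] with x hx
    filter_upwards [hdiff.continuousAt.eventually (Metric.isOpen_ball.mem_nhds hn),
      h.isOpen_param.mem_nhds ht] with τ hτ hτO
    obtain ⟨f, hf⟩ := hnf n hr (fun x hx => (hball hx).2)
      ((h.integral τ hτO).mono fun x hx => (hball hx).1) hτ
    exact ⟨f x, hf x hx⟩

end ConstantCurvature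

/-! ### The dimension for nonconstant curvature -/

section NonconstantCurvature

variable {U : Set Plane} {g : Plane → Matrix (Fin 2) (Fin 2) ℝ} {s : Plane}
  {c : Plane → Matrix (Fin 2) (Fin 2) ℝ}

/-- The values of `υ` and `μ` at `s`, which determine an integral up to a projective
transformation. -/
def jet (g : Plane → Matrix (Fin 2) (Fin 2) ℝ) (s : Plane) (c : Plane → Matrix (Fin 2) (Fin 2) ℝ) :
    (Fin 2 → ℝ) × ℝ := (fun j => upsilon g c j s, mu g c s)

/-- If the curvature is not constant near `s`, the jets at `s` of integrals are countably many. -/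
lemma countable_jets {W : Set Plane} (hU : IsOpen U) (hg : IsRiemannianMetricOn g U)
    (hW : IsOpen W) (hWc : Convex ℝ W) (hWU : W ⊆ U) (hs : s ∈ W)
    (hK : ¬ HasConstantCurvatureNear g s) :
    {z | ∃ c, IsIntegralOn g W c ∧ jet g s c = z}.Countable := by
  let W' : Opens Plane := ⟨W, hW⟩
  refine ((countable_solutions (W := W') hWc (isLeviCivita_christoffel hU hg hWU)
    (exists_lam_ne_zero (W := W') hU hg hWc hWU hs hK)).image
      fun p => (fun j => (p.1 j).1 ⟨s, hs⟩, p.2.1 ⟨s, hs⟩)).mono ?_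
  rintro _ ⟨c, hc, rfl⟩
  exact ⟨(upsilonFn (W := W') hU hg hWU hc, muFn (W := W') hU hg hWU hc),
    isSolution_of_isIntegralOn hU hg hWU hc, rfl⟩

/-- A single integral is a base family without parameters. -/
lemma isBaseFamily_const {W : Set Plane} (hc : IsIntegralOn g W c) (hW : IsOpen W) (hWU : W ⊆ U)
    (hs : s ∈ W) : IsBaseFamily (r := 0) g U s Set.univ W (fun _ => c) where
  isOpen_param := isOpen_univ
  isOpen_base := hW
  base_subset := hWU
  mem_base := hs
  smooth i j := (hc.smooth i j).comp contDiffOn_snd fun _ hz => hz.2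
  integral _ _ := hc
  const_at _ _ _ _ := rfl
  effective _ _ _ _ := Subsingleton.elim _ _

/-- A restatement of `exists_smul_eq_of_jet_eq` for a set. -/
lemma exists_smul_eq_of_jet {W : Set Plane} (hU : IsOpen U) (hg : IsRiemannianMetricOn g U)
    (hW : IsOpen W) (hWc : Convex ℝ W) (hWU : W ⊆ U) {c' : Plane → Matrix (Fin 2) (Fin 2) ℝ}
    (hc : IsIntegralOn g W c) (hc' : IsIntegralOn g W c') (hs : s ∈ W)
    (h : jet g s c = jet g s c') :
    ∃ f : Plane → ℝ, ∀ x ∈ W, f x ≠ 0 ∧ c' x = f x • (c' s * (c s)⁻¹ * c x) :=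
  exists_smul_eq_of_jet_eq (W := ⟨W, hW⟩) hU hg hWc hWU hc hc' hs
    (fun j => congrFun (congrArg Prod.fst h) j) (congrArg Prod.snd h)

/-- If the curvature is not constant, the jet is locally constant along families of integrals,
being a continuous function with countably many values. -/
lemma IsIntegralFamily.eventually_jet_eq {k : ℕ} {O : Set (Fin k → ℝ)} {W : Set Plane}
    {c : (Fin k → ℝ) → Plane → Matrix (Fin 2) (Fin 2) ℝ} (h : IsIntegralFamily g U s k O W c)
    (hU : IsOpen U) (hg : IsRiemannianMetricOn g U) (hK : ¬ HasConstantCurvatureNear g s)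
    {t₀ : Fin k → ℝ} (ht : t₀ ∈ O) : ∀ᶠ τ in 𝓝 t₀, jet g s (c τ) = jet g s (c t₀) := by
  obtain ⟨ε, hε, hεW⟩ := Metric.isOpen_iff.1 h.isOpen_base s h.mem_base
  obtain ⟨δ, hδ, hδO⟩ := Metric.isOpen_iff.1 h.isOpen_param t₀ ht
  have hcont : ContinuousOn (fun τ => jet g s (c τ)) (Metric.ball t₀ δ) := by
    have hdet := fun t ht => (h.integral t ht).det_ne_zero
    refine ContinuousOn.prodMk (continuousOn_pi.2 fun j τ hτ => ?_) fun τ hτ => ?_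
    · exact (differentiableAt_param (f := fun τ x => upsilon g (c τ) j x) h.isOpen_param
        h.isOpen_base (contDiffOn_upsilon_param hU hg h.isOpen_param h.isOpen_base h.base_subset
          h.smooth hdet j) (hδO hτ) h.mem_base).continuousAt.continuousWithinAt
    · exact (differentiableAt_param (f := fun τ x => mu g (c τ) x) h.isOpen_param
        h.isOpen_base (contDiffOn_mu_param hU hg h.isOpen_param h.isOpen_base h.base_subset
          h.smooth hdet) (hδO hτ) h.mem_base).continuousAt.continuousWithinAt
  have hcount := countable_jets (s := s) hU hg (Metric.isOpen_ball (ε := ε)) (convex_ball s ε)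
    (hεW.trans h.base_subset) (Metric.mem_ball_self hε) hK
  have himage := hcount.isTotallyDisconnected _ (by
    rintro _ ⟨τ, hτ, rfl⟩
    exact ⟨c τ, (h.integral τ (hδO hτ)).mono hεW, rfl⟩)
    ((convex_ball t₀ δ).isPreconnected.image _ hcont)
  filter_upwards [Metric.ball_mem_nhds t₀ hδ] with τ hτ
  exact himage (Set.mem_image_of_mem _ hτ) (Set.mem_image_of_mem _ (Metric.mem_ball_self hδ))

/-- If the curvature is not constant, the space of integrals has dimension `3`: there are countably
many orbits of the group of projective transformations. -/
theorem integralSpaceHasDim_three (hU : IsOpen U) (hg : IsRiemannianMetricOn g U) (hs : s ∈ U)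
    (hI : ∃ c, IsLocalIntegral g U s c) (hK : ¬ HasConstantCurvatureNear g s) :
    IntegralSpaceHasDim g U s 3 := by
  obtain ⟨ε, hε, hεU⟩ := Metric.isOpen_iff.1 hU s hs
  set S : Set ((Fin 2 → ℝ) × ℝ) := {z | ∃ c, IsLocalIntegral g U s c ∧ jet g s c = z} with hS
  have hcount : S.Countable := by
    refine (Set.countable_iUnion fun n : ℕ => countable_jets (s := s) hU hg
      (Metric.isOpen_ball (ε := ε / (n + 1))) (convex_ball s _) ((Metric.ball_subset_ball ?_).trans
        hεU) (Metric.mem_ball_self (by positivity)) hK).mono ?_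
    · exact div_le_self hε.le (by linarith [(Nat.cast_nonneg n : (0 : ℝ) ≤ n)])
    · rintro z ⟨c, ⟨W, hW, -, hsW, hc⟩, hz⟩
      obtain ⟨δ, hδ, hδW⟩ := Metric.isOpen_iff.1 hW s hsW
      obtain ⟨n, hn⟩ := exists_nat_gt (ε / δ)
      refine Set.mem_iUnion.2 ⟨n, c, hc.mono ((Metric.ball_subset_ball ?_).trans hδW), hz⟩
      rw [div_le_iff₀ (by positivity)]
      rw [div_lt_iff₀ hδ] at hn
      linarith
  obtain ⟨z, hz⟩ := hcount.exists_eq_range (by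
    obtain ⟨c, hc⟩ := hI
    exact ⟨_, c, hc, rfl⟩)
  have hmem : ∀ n, z n ∈ S := fun n => hz ▸ Set.mem_range_self n
  choose b hb hbz using hmem
  choose W hW hWU hsW hbW using hb
  have hbase : ∀ n, IsBaseFamily (r := 0) g U s Set.univ (W n) (fun _ => b n) := fun n =>
    isBaseFamily_const (hbW n) (hW n) (hWU n) (hsW n)
  refine ⟨exists_covering (r := 0) hU hg hbase ?_, ?_⟩
  · rintro c' ⟨W', hW', hWU', hsW', hc'⟩
    have hjet : jet g s c' ∈ S := ⟨c', ⟨W', hW', hWU', hsW', hc'⟩, rfl⟩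
    rw [hz] at hjet
    obtain ⟨n, hn⟩ := hjet
    obtain ⟨r, hr, hball⟩ := Metric.isOpen_iff.1 (hW'.inter (hW n)) s ⟨hsW', hsW n⟩
    obtain ⟨f, hf⟩ := exists_smul_eq_of_jet hU hg (Metric.isOpen_ball (ε := r)) (convex_ball s r)
      (fun x hx => hWU' (hball hx).1) ((hbW n).mono fun x hx => (hball hx).2)
      (hc'.mono fun x hx => (hball hx).1) (Metric.mem_ball_self hr) ((hbz n).trans hn)
    refine ⟨n, 0, Set.mem_univ _, c' s * (b n s)⁻¹, ?_, ?_⟩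
    · rw [Matrix.det_mul]
      exact mul_ne_zero (hc'.det_ne_zero s hsW') (Matrix.isUnit_nonsing_inv_det _
        ((hbW n).det_ne_zero s (hsW n)).isUnit).ne_zero
    · filter_upwards [Metric.ball_mem_nhds s hr] with x hx
      exact ⟨f x, hf x hx⟩
  · intro k O W' cf h hne
    obtain ⟨t₀, ht⟩ := hne
    obtain ⟨r, hr, hball⟩ := Metric.isOpen_iff.1 h.isOpen_base s h.mem_base
    refine h.card_le (r := 0) ht
      (isBaseFamily_const (h.integral t₀ ht) h.isOpen_base h.base_subset h.mem_base)
      (ϑ := fun _ => 0) (differentiableAt_const _) (Filter.Eventually.of_forall fun _ => trivial) ?_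
    filter_upwards [Metric.ball_mem_nhds s hr] with x hx
    filter_upwards [h.eventually_jet_eq hU hg hK ht, h.isOpen_param.mem_nhds ht] with τ hτ hτO
    obtain ⟨f, hf⟩ := exists_smul_eq_of_jet hU hg (Metric.isOpen_ball (ε := r)) (convex_ball s r)
      (hball.trans h.base_subset) ((h.integral t₀ ht).mono hball) ((h.integral τ hτO).mono hball)
      (Metric.mem_ball_self hr) hτ.symm
    exact ⟨f x, hf x hx⟩

end NonconstantCurvature

end FracLin

end

theorem mainTheorem2 (U : Set FracLin.Plane) (hU : IsOpen U)
    (g : FracLin.Plane → Matrix (Fin 2) (Fin 2) ℝ) (hg : FracLin.IsRiemannianMetricOn g U)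
    (s : FracLin.Plane) (hs : s ∈ U)
    (hI : ∃ c, FracLin.IsLocalIntegral g U s c) :
    (FracLin.IntegralSpaceHasDim g U s 5 ↔ FracLin.HasConstantCurvatureNear g s) ∧
      (FracLin.IntegralSpaceHasDim g U s 3 ∨ FracLin.IntegralSpaceHasDim g U s 5) := by
  by_cases hK : FracLin.HasConstantCurvatureNear g s
  · have h5 := FracLin.integralSpaceHasDim_five hU hg hI hK
    exact ⟨⟨fun _ => hK, fun _ => h5⟩, Or.inr h5⟩
  · have h3 := FracLin.integralSpaceHasDim_three hU hg hs hI hK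
    refine ⟨⟨fun h5 => ?_, fun h => absurd h hK⟩, Or.inl h3⟩
    -- the covering for dimension five provides a nonempty family with five parameters
    obtain ⟨c, hc⟩ := hI
    obtain ⟨⟨O, W, cf, hfam, hcov⟩, -⟩ := h5
    obtain ⟨n, t, ht, -⟩ := hcov c hc
    have := h3.2 5 (O n) (W n) (cf n) (hfam n) ⟨t, ht⟩
    omega
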